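/- **Conventions.** A graded poset is a finite poset $X$ with a function $\dim:X\to\mathbb Z$ that is monotone and satisfies $\dim y=\dim x+1$ whenever $y$ covers $x$; $X(i)$ is the set of $i$-dimensional elements ($i$-faces). $X$ is a $d$-poset if every face lies below a $d$-face and there is a face $\emptyset\in X(-1)$ with $\emptyset\le x$ for all $x\in X$. For $i\le j\le k$ let $F^{\max}_{i,j,k}(X)$ and $F^{\min}_{i,j,k}(X)$ be the maximum and minimum, over all $x\in X(i)$, $z\in X(k)$ with $x\le z$, of $\#\{y\in X(j): x\le y\le z\}$ (both are $0$ if there are no such $x,z$), $F^{\max}_{j,k}=F^{\max}_{-1,j,k}$, and $L(X)=\max_{-1\le i\le j\le k\le d}F^{\max}_{i,j,k}/F^{\min}_{i,j,k}$; $X$ is lower-regular if $F^{\max}_{i,j,k}=F^{\min}_{i,j,k}$ for all $i\le j\le k$. A function $w:X\to(0,\infty)$ is proper if $w(X(d))=1$ and $w(x)=\sum_{y\in X(d),\,y\ge x} w(y)/\#\{x'\in X(\dim x):x'\le y\}$ for all $x$, where $w(A)=\sum_{a\in A}w(a)$. The link of $z$ is $X_z=\{x:x\ge z\}$ with $\dim_z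 x=\dim x-\dim z-1$ and weights $$w_z(x)=\frac{1}{w(\{y\in X(d):y\ge z\})}\sum_{y\in X(d),\,y\ge x}\frac{w(y)}{\#\{x'\in X(\dim x): z\le x'\le y\}}.$$ Rings are commutative. An $R$-orientation assigns a unit $[y:x]\in R^\times$ to each pair in which $y$ covers $x$, such that $\sum_{x<y<z}[z:y][y:x]=0$ whenever $x\le z$ and $\dim z=\dim x+2$. An $R$-sheaf $\mathcal F$ on $X$ consists of $R$-modules $\mathcal F(x)$ and functorial linear restriction maps $\mathrm{res}_{y\leftarrow x}:\mathcal F(x)\to\mathcal F(y)$ for $x\le y$; $\mathcal F_z$ is its restriction to $X_z$, which inherits the orientation. Put $C^i=\prod_{x\in X(i)}\mathcal F(x)$, $(df)(y)=\sum_{x\in X(i),\,x\le y}[y:x]\,\mathrm{res}_{y\leftarrow x}f(x)$ for $f\in C^i$, $y\in X(i+1)$, $Z^i=\ker(d|_{C^i})$, $B^i=d(C^{i-1})$, $\|f\|=w(\{x: f(x)\ne0\})$, $\mathrm{dist}(f,g)=\|f-g\|$. Let $\mathrm{cse}_i(X,w,\mathcal F)$ and $\mathrm{cbe}_i(X,w,\mathcal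 F)$ be the suprema in $[0,\infty]$ of all $\mu\in[0,\infty)$ such that $\|df\|\ge\mu\,\mathrm{dist}(f,Z^i)$, respectively $\|df\|\ge\mu\,\mathrm{dist}(f,B^i)$, for all $f\in C^i$, and let $\mathrm{ccd}_i(X,w,\mathcal F)=\inf\{\|f\|:f\in Z^i\setminus B^i\}\in[0,\infty]$. A weighted hypergraph with a relation $\sim$ on its vertices is an $(\alpha,\beta)$-skeleton expander if for every set $A$ of vertices, the set $E_2(A)$ of hyperedges containing two distinct $u,v\in A$ with $u\sim v$ satisfies $w(E_2(A))\le\alpha w(A)+\beta w(A)^2$. $\mathrm{ugr}(X,w)$ has vertices $X(0)$, hyperedges $X(1)$, incidence $\le$ and weights $w$, and $u\sim v$ means that $u\ne v$ lie on a common hyperedge. $\mathrm{NI}^{1,1,2}(X,w)$ has vertices $X(1)$, hyperedges $X(2)$, incidence $\le$ and weights $w$, and $x\sim y$ means that $x,y$ lie on a common hyperedge and $\emptyset$ is the only maximal lower bound of $x$ and $y$. For a real $q\ge0$, the *correction algorithm* takes $f\in C^0$ and, as long as there are $u\in X(0)$ and $g\in\mathcal F(u)$ with $\|df+d(g^u)\|<\|df\|-q\,w(u)$,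 where $g^u\in C^0$ is $g$ at $u$ and $0$ elsewhere, replaces $f$ by $f+g^u$ for some such $u,g$; when there are none it returns the current $f$. **Theorem (criterion for $0$-cosystolic expansion).** For every $F\in\{1,2,\dots\}$ and $L\in[1,\infty)$ there are constants $E,E',E'',E''',D,D',D''>0$ such that the following holds. Let $R$ be a ring, let $(X,w)$ be a properly weighted $R$-oriented $d$-poset, $d\ge2$, with $L(X)\le L$ and $F^{\max}_{0,2}(X),F^{\max}_{1,2}(X)\le F$, and let $\mathcal F$ be an $R$-sheaf on $X$. Let $\varepsilon,\varepsilon'>0$ and $\alpha_0,\beta_0,\alpha_{-1},\beta_{-1},\alpha_{||},\beta_{||}\ge0$, and suppose that - (1a) $\mathrm{cbe}_{-1}(X_v,w_v,\mathcal F_v)\ge\varepsilon$ for all $v\in X(0)$; - (1b) $\mathrm{cbe}_{-1}(X_e,w_e,\mathcal F_e)\ge\varepsilon'$ for all $e\in X(1)$; - (1c) $\mathrm{cbe}_{0}(X_v,w_v,\mathcal F_v)\ge\varepsilon'$ for all $v\in X(0)$; - (2a) $\mathrm{ugr}(X_v,w_v)$ is an $(\alpha_0,\beta_0)$-skeleton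 expander for all $v\in X(0)$; - (2b) $\mathrm{ugr}(X,w)$ is an $(\alpha_{-1},\beta_{-1})$-skeleton expander; - (2c) $\mathrm{NI}^{1,1,2}(X,w)$ is an $(\alpha_{||},\beta_{||})$-skeleton expander. Suppose further that $\alpha_{-1}<E\varepsilon$ and that $h_{-1},h_0,h_{||}\in(0,1]$ satisfy $$(\alpha_0+\beta_0h_0)+(\alpha_{||}+\beta_{||}h_{||})+\frac{\alpha_{-1}+\beta_{-1}h_{-1}}{h_0}\le E'\varepsilon'.$$ Then $$\mathrm{cse}_0(X,w,\mathcal F)\ge\frac{E''}{h_0^{-1}h_{-1}^{-1}+h_{||}^{-1}}\qquad\text{and}\qquad \mathrm{ccd}_0(X,w,\mathcal F)\ge\frac{E'''(E\varepsilon-\alpha_{-1})}{\beta_{-1}}$$ (the last fraction is $+\infty$ if $\beta_{-1}=0$). Moreover, if $f\in C^0$ satisfies $\mathrm{dist}(f,Z^0)<\frac{D}{h_0^{-1}h_{-1}^{-1}+h_{||}^{-1}}$, then every run of the correction algorithm on $f$ with $q=D'h_0$ stops, and every $f'$ it can return satisfies $f'\in Z^0$ and $\mathrm{dist}(f,f')\le\frac{1}{D''h_0}\mathrm{dist}(f,Z^0)$.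 All of this holds with the explicit values $(E,E',E'',E''',D,D',D'')=$ - $\left(L^{-8},\ \tfrac14L^{-18}F^{-5},\ \tfrac12L^{-13}F^{-2},\ L^{-3},\ L^{-15}F^{-1},\ \tfrac14L^{-12}F^{-2},\ \tfrac14L^{-16}F^{-3}\right)$ for every $X$ as above; - $\left(1,\ \tfrac14F^{-2},\ \tfrac12F^{-1},\ 1,\ F^{-1},\ \tfrac14F^{-1},\ \tfrac14F^{-2}\right)$ if $X$ is lower-regular; - $\left(1,\tfrac1{12},\tfrac12,1,\tfrac12,\tfrac14,\tfrac18\right)$ if $X$ is (the face poset of) a simplicial complex; - $\left(1,\tfrac1{16},\tfrac12,1,\tfrac12,\tfrac14,\tfrac18\right)$ if $X$ is a cube complex, i.e. the subfaces of every $n$-face, $n\ge0$, form a poset isomorphic to the face poset (empty face included) of $[0,1]^n$; - $\left(L^{-8},\ \tfrac1{4m}L^{-18},\ \tfrac12L^{-13},\ L^{-3},\ \tfrac12L^{-15},\ \tfrac14L^{-12},\ \tfrac18L^{-16}\right)$ if the faces of $X$ of dimension at most $2$ form an $m$-gon complex ($m\ge2$), i.e. the vertices and edges of every $2$-face are those of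 an $m$-gon. -/

import Mathlib

namespace CosystolicExpansion

noncomputable section

open scoped Classical NNReal ENNReal

universe u v v'

/-! ### Graded posets

A finite graded poset is a finite partial order `X` with Mathlib's `GradeOrder ℤ X`: the grading is
strictly monotone and `x ⋖ y` implies `dim x + 1 = dim y`. -/

/-- The dimension of a face of a graded poset. -/
abbrev dim {X : Type u} [PartialOrder X] [GradeOrder ℤ X] (x : X) : ℤ := grade ℤ x

/-- `X(i)`, the type of `i`-faces. -/
abbrev Face (X : Type u) [PartialOrder X] [GradeOrder ℤ X] (i : ℤ) : Type u := {x : X // dim x = i}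

/-- A `d`-poset: every face lies in a `d`-face, and there is a smallest face `⊥` (the empty face),
which has dimension `-1`. -/
structure IsDPoset (X : Type u) [PartialOrder X] [OrderBot X] [GradeOrder ℤ X] (d : ℕ) : Prop where
  dim_bot : dim (⊥ : X) = -1
  pure : ∀ x : X, ∃ y : X, dim y = d ∧ x ≤ y

/-- The number of `j`-faces `y` with `x ≤ y ≤ z`. -/
def numBetween {X : Type u} [PartialOrder X] [Fintype X] [GradeOrder ℤ X] (x z : X) (j : ℤ) : ℕ :=
  (Finset.univ.filter fun y : X => dim y = j ∧ x ≤ y ∧ y ≤ z).card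

/-- `F^max_{i,j,k}(X)`; it is `0` if no `i`-face is contained in a `k`-face. -/
def Fmax (X : Type u) [PartialOrder X] [Fintype X] [GradeOrder ℤ X] (i j k : ℤ) : ℕ :=
  sSup {n : ℕ | ∃ x z : X, dim x = i ∧ dim z = k ∧ x ≤ z ∧ n = numBetween x z j}

/-- `F^min_{i,j,k}(X)`; it is `0` if no `i`-face is contained in a `k`-face. -/
def Fmin (X : Type u) [PartialOrder X] [Fintype X] [GradeOrder ℤ X] (i j k : ℤ) : ℕ :=
  sInf {n : ℕ | ∃ x z : X, dim x = i ∧ dim z = k ∧ x ≤ z ∧ n = numBetween x z j}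

/-- The lower irregularity `L(X) = max_{-1 ≤ i ≤ j ≤ k ≤ d} F^max_{i,j,k} / F^min_{i,j,k}`
of a `d`-poset (a maximum over a finite nonempty set of triples). -/
def lowerIrregularity (X : Type u) [PartialOrder X] [Fintype X] [GradeOrder ℤ X] (d : ℕ) : ℝ :=
  sSup {r : ℝ | ∃ i j k : ℤ, -1 ≤ i ∧ i ≤ j ∧ j ≤ k ∧ k ≤ d ∧
    r = (Fmax X i j k : ℝ) / (Fmin X i j k : ℝ)}

/-- Lower-regular graded posets. -/
def IsLowerRegular (X : Type u) [PartialOrder X] [Fintype X] [GradeOrder ℤ X] : Prop :=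
  ∀ i j k : ℤ, i ≤ j → j ≤ k → Fmax X i j k = Fmin X i j k

/-- `X` is the face poset (empty face included) of an abstract simplicial complex `Δ`, graded by
`dim = card - 1`. -/
def IsSimplicialComplex (X : Type u) [PartialOrder X] [GradeOrder ℤ X] : Prop :=
  ∃ (V : Type) (Δ : Set (Finset V)) (φ : X ≃o Δ),
    IsLowerSet Δ ∧ ∀ x : X, dim x = ((φ x : Finset V).card : ℤ) - 1

/-- The face poset of the `n`-dimensional cube `[0,1]^n`, empty face `⊥` included: a nonempty face is
a product of nonempty faces of `[0,1]`, each given by its set of endpoints. -/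
abbrev CubeFaces (n : ℕ) : Type := WithBot (Fin n → {s : Finset Bool // s.Nonempty})

/-- `X` is a cube complex: every `n`-face is an `n`-dimensional cube, i.e. its poset of subfaces
is isomorphic to that of `[0,1]^n`. -/
def IsCubeComplex (X : Type u) [PartialOrder X] [GradeOrder ℤ X] : Prop :=
  ∀ (n : ℕ) (x : X), dim x = n → Nonempty (Set.Iic x ≃o CubeFaces n)

/-- The subposet of faces of dimension at most `2` is an `m`-gon complex: the vertices and the edges
of every `2`-face can be indexed cyclically by `ℤ/mℤ`, so that the edge `j` has precisely the two
vertices `j` and `j + 1`. -/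
def IsGonComplex (X : Type u) [PartialOrder X] [GradeOrder ℤ X] (m : ℕ) : Prop :=
  2 ≤ m ∧ ∀ x : X, dim x = 2 → ∃ p e : ZMod m → X,
    Function.Injective p ∧ Function.Injective e ∧
    (∀ y : X, (dim y = 0 ∧ y ≤ x) ↔ y ∈ Set.range p) ∧
    (∀ y : X, (dim y = 1 ∧ y ≤ x) ↔ y ∈ Set.range e) ∧
    ∀ i j : ZMod m, p i ≤ e j ↔ i = j ∨ i = j + 1

/-! ### Proper weight functions and links -/

/-- A proper weight function on a graded poset of dimension `d`. The sum runs over the `d`-faces `y`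
containing `x`, and the denominator is the number of `dim x`-faces of `y`. -/
structure IsProperWeight {X : Type u} [PartialOrder X] [Fintype X] [GradeOrder ℤ X]
    (d : ℕ) (w : X → ℝ) : Prop where
  pos : ∀ x, 0 < w x
  sum_top : ∑ y ∈ Finset.univ.filter (fun y : X => dim y = d), w y = 1
  eq_sum : ∀ x, w x = ∑ y ∈ Finset.univ.filter (fun y : X => dim y = d ∧ x ≤ y),
    w y / ((Finset.univ.filter fun x' : X => dim x' = dim x ∧ x' ≤ y).card : ℝ)

/-- The link `X_z = {x | z ≤ x}`. -/
abbrev Link {X : Type u} [PartialOrder X] (z : X) : Type u := Set.Ici z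

instance linkFintype {X : Type u} [PartialOrder X] [Fintype X] (z : X) : Fintype (Link z) :=
  Fintype.ofFinite _

/-- The grading `dim_z x = dim x - dim z - 1` of the link at `z`. -/
instance linkGradeOrder {X : Type u} [PartialOrder X] [GradeOrder ℤ X] (z : X) :
    GradeOrder ℤ (Link z) where
  grade x := dim x.1 - dim z - 1
  grade_strictMono := by
    intro a b hab
    have h : dim a.1 < dim b.1 := grade_strictMono hab
    show dim a.1 - dim z - 1 < dim b.1 - dim z - 1
    omega
  covBy_grade := by
    intro a b hab
    have hc : a.1 ⋖ b.1 :=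
      ⟨hab.1, fun c hac hcb => hab.2 (c := ⟨c, le_trans a.2 hac.le⟩) hac hcb⟩
    have h : dim a.1 + 1 = dim b.1 := Order.succ_eq_of_covBy (hc.grade ℤ)
    have h' : dim b.1 - dim z - 1 = Order.succ (dim a.1 - dim z - 1) := by
      rw [Int.succ_eq_succ, Int.succ]
      omega
    show dim a.1 - dim z - 1 ⋖ dim b.1 - dim z - 1
    rw [h']
    exact Order.covBy_succ _

/-- The weight function `w_z` that `w` induces on the link at `z`. -/
def linkWeight {X : Type u} [PartialOrder X] [Fintype X] [GradeOrder ℤ X]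
    (d : ℕ) (w : X → ℝ) (z : X) : Link z → ℝ := fun x =>
  (∑ y ∈ Finset.univ.filter (fun y : X => dim y = d ∧ z ≤ y), w y)⁻¹ *
    ∑ y ∈ Finset.univ.filter (fun y : X => dim y = d ∧ x.1 ≤ y),
      w y / ((Finset.univ.filter fun x' : X => dim x' = dim x.1 ∧ z ≤ x' ∧ x' ≤ y).card : ℝ)

/-! ### Orientations, sheaves and cochains -/

/-- An `R`-orientation: `coeff y x` is `[y : x]`. Only the values at pairs with `x ⋖ y` are
meaningful, and only these are ever used. -/
structure PosetOrientation (R : Type v) [CommRing R] (X : Type u) [PartialOrder X] [Fintype X]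
    [GradeOrder ℤ X] where
  coeff : X → X → Rˣ
  sum_eq_zero : ∀ x z : X, x ≤ z → dim z = dim x + 2 →
    ∑ y ∈ Finset.univ.filter (fun y : X => x < y ∧ y < z), (coeff z y : R) * (coeff y x : R) = 0

/-- The orientation that the link at `z` inherits. -/
def PosetOrientation.link {R : Type v} [CommRing R] {X : Type u} [PartialOrder X] [Fintype X]
    [GradeOrder ℤ X] (O : PosetOrientation R X) (z : X) : PosetOrientation R (Link z) where
  coeff y x := O.coeff y.1 x.1
  sum_eq_zero := by
    intro x t hxt hdim
    have hd : dim t.1 = dim x.1 + 2 := by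
      have h : dim t.1 - dim z - 1 = dim x.1 - dim z - 1 + 2 := hdim
      omega
    rw [← O.sum_eq_zero x.1 t.1 hxt hd]
    refine Finset.sum_bij (fun y _ => y.1) ?_ ?_ ?_ ?_
    · intro y hy
      simpa using hy
    · intro a _ b _ h
      exact Subtype.ext h
    · intro y hy
      have hy' : x.1 < y ∧ y < t.1 := by simpa using hy
      exact ⟨⟨y, le_trans x.2 hy'.1.le⟩, Finset.mem_filter.2 ⟨Finset.mem_univ _, hy'⟩, rfl⟩
    · intro y _
      rfl

/-- An `R`-sheaf on a poset. -/
structure PosetSheaf (R : Type v) [CommRing R] (X : Type u) [PartialOrder X] where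
  obj : X → Type v'
  [addCommGroup : ∀ x, AddCommGroup (obj x)]
  [module : ∀ x, Module R (obj x)]
  res : ∀ {x y : X}, x ≤ y → (obj x →ₗ[R] obj y)
  res_refl : ∀ (x : X) (s : obj x), res (le_refl x) s = s
  res_res : ∀ {x y z : X} (hxy : x ≤ y) (hyz : y ≤ z) (s : obj x),
    res hyz (res hxy s) = res (hxy.trans hyz) s

attribute [instance] PosetSheaf.addCommGroup PosetSheaf.module

/-- The restriction of a sheaf to the link at `z`. -/
abbrev PosetSheaf.link {R : Type v} [CommRing R] {X : Type u} [PartialOrder X]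
    (S : PosetSheaf.{u, v, v'} R X) (z : X) : PosetSheaf.{u, v, v'} R (Link z) where
  obj x := S.obj x.1
  res h := S.res h
  res_refl x s := S.res_refl x.1 s
  res_res hxy hyz s := S.res_res hxy hyz s

/-- The `R`-module `C^i(X, S)` of `i`-cochains. -/
abbrev Cochain {R : Type v} [CommRing R] {X : Type u} [PartialOrder X] [GradeOrder ℤ X]
    (S : PosetSheaf.{u, v, v'} R X) (i : ℤ) : Type (max u v') := ∀ x : Face X i, S.obj x.1

section Cohomology

variable {R : Type v} [CommRing R] {X : Type u} [PartialOrder X] [Fintype X] [GradeOrder ℤ X]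

/-- The coboundary map `(d f)(y) = ∑_{x ∈ y(i)} [y : x] res_{y ← x} f(x)` from `C^i` to `C^j`. It is
only used for `j = i + 1`; two indices avoid casts between `C^i` and `C^{i-1+1}`. -/
def coboundary (O : PosetOrientation R X) (S : PosetSheaf.{u, v, v'} R X) (i j : ℤ) :
    Cochain S i →ₗ[R] Cochain S j where
  toFun f y := ∑ x : Face X i,
    if h : x.1 ≤ y.1 then (O.coeff y.1 x.1 : R) • S.res h (f x) else 0
  map_add' f g := by
    funext y
    rw [Pi.add_apply, ← Finset.sum_add_distrib]
    refine Finset.sum_congr rfl fun x _ => ?_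
    by_cases h : x.1 ≤ y.1 <;> simp [h]
  map_smul' r f := by
    funext y
    rw [Pi.smul_apply, Finset.smul_sum]
    refine Finset.sum_congr rfl fun x _ => ?_
    by_cases h : x.1 ≤ y.1 <;> simp [h, smul_smul, mul_comm]

/-- The `i`-cocycles `Z^i`. -/
def cocycles (O : PosetOrientation R X) (S : PosetSheaf.{u, v, v'} R X) (i : ℤ) :
    Submodule R (Cochain S i) := LinearMap.ker (coboundary O S i (i + 1))

/-- The `i`-coboundaries `B^i`. -/
def coboundaries (O : PosetOrientation R X) (S : PosetSheaf.{u, v, v'} R X) (i : ℤ) :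
    Submodule R (Cochain S i) := LinearMap.range (coboundary O S (i - 1) i)

/-- `‖f‖_w = w(supp f)`. -/
def wnorm (w : X → ℝ) {S : PosetSheaf.{u, v, v'} R X} {i : ℤ} (f : Cochain S i) : ℝ :=
  ∑ x ∈ Finset.univ.filter (fun x : Face X i => f x ≠ 0), w x.1

/-- `dist_w(f, A) = min_{g ∈ A} ‖f - g‖_w`. -/
def wdist (w : X → ℝ) {S : PosetSheaf.{u, v, v'} R X} {i : ℤ} (f : Cochain S i)
    (A : Submodule R (Cochain S i)) : ℝ :=
  ⨅ g : A, wnorm w (f - g.1)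

/-- The `i`-cosystolic expansion `cse_i(X, w, S)`: the supremum in `[0, ∞]` of all `μ ∈ [0, ∞)` with
`‖d f‖ ≥ μ dist(f, Z^i)` for all `f`. -/
def cse (O : PosetOrientation R X) (w : X → ℝ) (S : PosetSheaf.{u, v, v'} R X) (i : ℤ) : ℝ≥0∞ :=
  ⨆ μ ∈ {μ : ℝ≥0 | ∀ f : Cochain S i,
    (μ : ℝ) * wdist w f (cocycles O S i) ≤ wnorm w (coboundary O S i (i + 1) f)}, (μ : ℝ≥0∞)

/-- The `i`-coboundary expansion `cbe_i(X, w, S)`: the supremum in `[0, ∞]` of all `μ ∈ [0, ∞)` with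
`‖d f‖ ≥ μ dist(f, B^i)` for all `f`. -/
def cbe (O : PosetOrientation R X) (w : X → ℝ) (S : PosetSheaf.{u, v, v'} R X) (i : ℤ) : ℝ≥0∞ :=
  ⨆ μ ∈ {μ : ℝ≥0 | ∀ f : Cochain S i,
    (μ : ℝ) * wdist w f (coboundaries O S i) ≤ wnorm w (coboundary O S i (i + 1) f)}, (μ : ℝ≥0∞)

/-- The `i`-cocycle distance `ccd_i(X, w, S)`, the infimum in `[0, ∞]` of `‖f‖` over
`f ∈ Z^i - B^i`. -/
def ccd (O : PosetOrientation R X) (w : X → ℝ) (S : PosetSheaf.{u, v, v'} R X) (i : ℤ) : ℝ≥0∞ :=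
  ⨅ f ∈ {f : Cochain S i | f ∈ cocycles O S i ∧ f ∉ coboundaries O S i},
    ENNReal.ofReal (wnorm w f)

/-! ### The correction algorithm -/

/-- The extension by zero `g^u ∈ C^k(X, S)` of a cochain `g` on the link at `u`. -/
def extendByZero {S : PosetSheaf.{u, v, v'} R X} (u : X) (k : ℤ)
    (g : Cochain (S.link u) (k - dim u - 1)) : Cochain S k := fun x =>
  if h : u ≤ x.1 then
    g ⟨⟨x.1, h⟩, show dim x.1 - dim u - 1 = k - dim u - 1 by rw [x.2]⟩
  else 0

/-- One round of the correction algorithm with parameter `q` in degree `k`: it may pass from `f` to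
`f' = f + g^u` if `u` is a face with `0 ≤ dim u ≤ k`, `g ∈ C^{k - dim u - 1}(X_u, S_u)` and
`‖d f + d (g^u)‖ < ‖d f‖ - q w(u)`. -/
def CorrectionStep (O : PosetOrientation R X) (w : X → ℝ) (S : PosetSheaf.{u, v, v'} R X)
    (k : ℤ) (q : ℝ) (f f' : Cochain S k) : Prop :=
  ∃ u : X, 0 ≤ dim u ∧ dim u ≤ k ∧ ∃ g : Cochain (S.link u) (k - dim u - 1),
    wnorm w (coboundary O S k (k + 1) f + coboundary O S k (k + 1) (extendByZero u k g)) <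
      wnorm w (coboundary O S k (k + 1) f) - q * w u ∧
    f' = f + extendByZero u k g

/-- On the input `f`, some run of the correction algorithm (which repeats the above round, with
arbitrary choices of `u` and `g`, for as long as this is possible) returns `f'`. -/
def CorrectionReturns (O : PosetOrientation R X) (w : X → ℝ) (S : PosetSheaf.{u, v, v'} R X)
    (k : ℤ) (q : ℝ) (f f' : Cochain S k) : Prop :=
  Relation.ReflTransGen (CorrectionStep O w S k q) f f' ∧
    ∀ f'', ¬ CorrectionStep O w S k q f' f''

/-- Every run of the correction algorithm on the input `f` stops. -/
def CorrectionHalts (O : PosetOrientation R X) (w : X → ℝ) (S : PosetSheaf.{u, v, v'} R X)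
    (k : ℤ) (q : ℝ) (f : Cochain S k) : Prop :=
  Acc (fun f₂ f₁ => CorrectionStep O w S k q f₁ f₂) f

end Cohomology

/-! ### Hypergraphs and skeleton expansion -/

/-- A weighted hypergraph with vertex set `V` and hyperedge set `E` (multiple hyperedges are
allowed). -/
structure WeightedHypergraph (V : Type u) (E : Type v) where
  inc : V → E → Prop
  wV : V → ℝ
  wE : E → ℝ

/-- A related weighted hypergraph: related vertices lie on a common hyperedge. -/
structure RelatedHypergraph (V : Type u) (E : Type v) extends WeightedHypergraph V E where
  rel : V → V → Prop
  exists_inc : ∀ x y, rel x y → ∃ e, inc x e ∧ inc y e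

/-- The standard relation: distinct vertices that lie on a common hyperedge. -/
def WeightedHypergraph.standard {V : Type u} {E : Type v} (H : WeightedHypergraph V E) :
    RelatedHypergraph V E where
  toWeightedHypergraph := H
  rel x y := x ≠ y ∧ ∃ e, H.inc x e ∧ H.inc y e
  exists_inc _ _ h := h.2

/-- `E_2(A)`: the hyperedges containing two distinct related vertices from `A`. -/
def RelatedHypergraph.edges₂ {V : Type u} {E : Type v} [Fintype E] (H : RelatedHypergraph V E)
    (A : Finset V) : Finset E :=
  Finset.univ.filter fun e =>
    ∃ x ∈ A, ∃ y ∈ A, x ≠ y ∧ H.inc x e ∧ H.inc y e ∧ H.rel x y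

/-- `(α, β)`-skeleton expanders: `w(E_2(A)) ≤ α w(A) + β w(A)²` for all sets `A` of vertices. -/
def RelatedHypergraph.IsSkeletonExpander {V : Type u} {E : Type v} [Fintype E]
    (H : RelatedHypergraph V E) (α β : ℝ) : Prop :=
  ∀ A : Finset V, ∑ e ∈ H.edges₂ A, H.wE e ≤ α * (∑ x ∈ A, H.wV x) + β * (∑ x ∈ A, H.wV x) ^ 2

/-- The weighted hypergraph `ugr(X, w)` underlying a weighted graded poset: vertices `X(0)`,
hyperedges `X(1)`. As any hypergraph, it is given the standard relation. -/
def ugr {X : Type u} [PartialOrder X] [GradeOrder ℤ X] (w : X → ℝ) :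
    RelatedHypergraph (Face X 0) (Face X 1) :=
  WeightedHypergraph.standard
    { inc := fun x e => x.1 ≤ e.1
      wV := fun x => w x.1
      wE := fun e => w e.1 }

/-- `Inf {x, y}`: the set of maximal lower bounds of `x` and `y`. -/
def infs {X : Type u} [PartialOrder X] (x y : X) : Set X :=
  {z | Maximal (fun t => t ≤ x ∧ t ≤ y) z}

/-- The no-intersection hypergraph `NI^{i,j,k}(X, w)`: vertices `X(i) ∪ X(j)`, hyperedges `X(k)`. -/
def noIntersection {X : Type u} [PartialOrder X] [OrderBot X] [GradeOrder ℤ X] (w : X → ℝ)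
    (i j k : ℤ) : RelatedHypergraph {x : X // dim x = i ∨ dim x = j} (Face X k) where
  inc x z := x.1 ≤ z.1
  wV x := if i = j then w x.1 else w x.1 / 2
  wE z := w z.1
  rel x y := (∃ z : Face X k, x.1 ≤ z.1 ∧ y.1 ≤ z.1) ∧ infs x.1 y.1 = {⊥} ∧
    ((dim x.1 = i ∧ dim y.1 = j) ∨ (dim x.1 = j ∧ dim y.1 = i))
  exists_inc _ _ h := h.1

/-! ### The explicit constants -/

/-- The constants `E, E', E'', E''', D, D', D''`. -/
@[ext] structure Constants where
  E : ℝ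
  E' : ℝ
  E'' : ℝ
  E''' : ℝ
  D : ℝ
  D' : ℝ
  D'' : ℝ

/-- The constants valid for all posets `X` with the parameters `F` and `L`. -/
def generalConstants (F : ℕ) (L : ℝ) : Constants where
  E := 1 / L ^ 8
  E' := 1 / (4 * L ^ 18 * (F : ℝ) ^ 5)
  E'' := 1 / (2 * L ^ 13 * (F : ℝ) ^ 2)
  E''' := 1 / L ^ 3
  D := 1 / (L ^ 15 * (F : ℝ))
  D' := 1 / (4 * L ^ 12 * (F : ℝ) ^ 2)
  D'' := 1 / (4 * L ^ 16 * (F : ℝ) ^ 3)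

/-- The constants for lower-regular `X`. -/
def lowerRegularConstants (F : ℕ) : Constants where
  E := 1
  E' := 1 / (4 * (F : ℝ) ^ 2)
  E'' := 1 / (2 * (F : ℝ))
  E''' := 1
  D := 1 / (F : ℝ)
  D' := 1 / (4 * (F : ℝ))
  D'' := 1 / (4 * (F : ℝ) ^ 2)

/-- The constants for simplicial complexes. -/
def simplicialConstants : Constants where
  E := 1
  E' := 1 / 12
  E'' := 1 / 2
  E''' := 1
  D := 1 / 2
  D' := 1 / 4
  D'' := 1 / 8

/-- The constants for cube complexes. -/
def cubeConstants : Constants where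
  E := 1
  E' := 1 / 16
  E'' := 1 / 2
  E''' := 1
  D := 1 / 2
  D' := 1 / 4
  D'' := 1 / 8

/-- The constants for `X` whose faces of dimension at most `2` form an `m`-gon complex. -/
def gonConstants (m : ℕ) (L : ℝ) : Constants where
  E := 1 / L ^ 8
  E' := 1 / (4 * (m : ℝ) * L ^ 18)
  E'' := 1 / (2 * L ^ 13)
  E''' := 1 / L ^ 3
  D := 1 / (2 * L ^ 15)
  D' := 1 / (4 * L ^ 12)
  D'' := 1 / (8 * L ^ 16)

/-- `c` is one of the tuples of constants listed for the poset `X`. -/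
inductive ListedConstants (X : Type u) [PartialOrder X] [Fintype X] [GradeOrder ℤ X]
    (F : ℕ) (L : ℝ) : Constants → Prop
  | general : ListedConstants X F L (generalConstants F L)
  | lowerRegular (h : IsLowerRegular X) : ListedConstants X F L (lowerRegularConstants F)
  | simplicial (h : IsSimplicialComplex X) : ListedConstants X F L simplicialConstants
  | cube (h : IsCubeComplex X) : ListedConstants X F L cubeConstants
  | gon (m : ℕ) (h : IsGonComplex X m) : ListedConstants X F L (gonConstants m L)

end

end CosystolicExpansion

open CosystolicExpansion

namespace CosystolicExpansion

universe u v v'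

/-! The core is `eq_zero_of_locallyMinimal`: a 1-cocycle b of small norm vanishes if no modification
by d(s), with s supported at one vertex v, lowers ‖b‖ by more than Q·h₀·w(v). Call a vertex heavy if
b restricted to its link has norm at least h₀, and light otherwise. Call a 2-face bad if it contains
two support edges of b meeting at a light vertex, or two disjoint support edges, or an edge joining
two heavy vertices. The weight of the bad faces is estimated twice.

From above (`sum_badFaces_le`): the three kinds are controlled by skeleton expansion of the vertex
links, of the no-intersection hypergraph and of the 1-skeleton. Smallness of b makes the heavy
vertices few, and the total is at most a constant times E'ε'‖b‖.

From below: on a support edge without heavy vertices, expansion of the edge link yields many 2-faces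
over it; since db = 0, each carries a second support edge and is therefore bad. At a heavy vertex v,
local minimality keeps the restriction of b far from the coboundaries of the link
(`starWeight_le_of_locallyMinimal`). Expansion in degree 0 then yields many 2-faces carrying a
support edge through v and one avoiding v, and these are bad too. So ε'‖b‖ is at most a constant
times the bad weight. For the listed E' the two estimates together give ‖b‖ ≤ θ‖b‖ with θ < 1, so b
= 0.

The algorithm reaches this situation: each move at u lowers ‖df‖ by more than q·w(u) and changes f
by at most w(u). It stops, ‖df‖ stays small, and the total displacement is at most ‖df‖/q. This
gives cosystolic expansion when ‖df‖ is small; otherwise dist(f, Z⁰) ≤ 1 suffices. The cocycle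
distance is a simpler use of the same idea, one dimension lower: each support vertex of a 0-cocycle
has many edges to other support vertices, while skeleton expansion bounds such edges.

All comparisons between w and link weights are identities for lower-regular X; in general each costs
a power of the irregularity Λ. The argument runs for any constants satisfying
`Constants.Admissible`, and the listed tuples are checked separately. -/

set_option linter.unusedSectionVars false

/-! ### Face counts of small cubes -/

section Cube

/-- The coordinates in which a face of the cube is the whole interval. -/
def fullCoords {n : ℕ} (s : Fin n → {s : Finset Bool // s.Nonempty}) : Finset (Fin n) :=
  Finset.univ.filter fun k => (s k).1 = Finset.univ

/-- The dimension of a face of the cube. -/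
def cubeDim {n : ℕ} : CubeFaces n → ℤ :=
  WithBot.recBotCoe (-1) fun s => ((fullCoords s).card : ℤ)

/-- The number of `j`-dimensional faces of the `n`-cube. -/
def cubeCount (n : ℕ) (j : ℤ) : ℕ :=
  (Finset.univ.filter fun c : CubeFaces n => cubeDim c = j).card

theorem cubeCount_one_zero : cubeCount 1 0 = 2 := by decide

theorem cubeCount_two_zero : cubeCount 2 0 = 4 := by decide

theorem cubeCount_two_one : cubeCount 2 1 = 4 := by decide

end Cube

open scoped Classical NNReal ENNReal

/-! ### Counting faces in intervals of a graded poset -/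

section Counting

variable {X : Type u} [PartialOrder X] [Fintype X] [GradeOrder ℤ X]

theorem dim_mono {x y : X} (h : x ≤ y) : dim x ≤ dim y := grade_mono h

theorem eq_of_le_of_dim_eq {x y : X} (h : x ≤ y) (hd : dim x = dim y) : x = y := by
  by_contra hne
  have : dim x < dim y := grade_strictMono (lt_of_le_of_ne h hne)
  omega

theorem exists_dim_eq_between (n : ℕ) :
    ∀ {x z : X}, x ≤ z → dim x + n ≤ dim z → ∃ y, x ≤ y ∧ y ≤ z ∧ dim y = dim x + n := by
  induction n with
  | zero => intro x z h _; exact ⟨x, le_rfl, h, by simp⟩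
  | succ n ih =>
    intro x z h hd
    push_cast at hd
    have hlt : x < z := lt_of_le_of_ne h (by rintro rfl; omega)
    obtain ⟨y, hy, hyz⟩ := exists_covBy_le_of_lt hlt
    have h1 : dim x + 1 = dim y := Order.succ_eq_of_covBy (hy.grade ℤ)
    obtain ⟨t, ht, htz, hdt⟩ := ih hyz (by omega)
    exact ⟨t, hy.le.trans ht, htz, by push_cast; omega⟩

theorem exists_between {x z : X} (h : x ≤ z) {j : ℤ} (h1 : dim x ≤ j) (h2 : j ≤ dim z) :
    ∃ y, x ≤ y ∧ y ≤ z ∧ dim y = j := by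
  obtain ⟨y, a, b, c⟩ := exists_dim_eq_between (j - dim x).toNat h (by omega)
  exact ⟨y, a, b, by omega⟩

theorem numBetween_pos {x z : X} (h : x ≤ z) {j : ℤ} (h1 : dim x ≤ j) (h2 : j ≤ dim z) :
    0 < numBetween x z j := by
  obtain ⟨y, a, b, c⟩ := exists_between h h1 h2
  exact Finset.card_pos.2 ⟨y, by simp [a, b, c]⟩

theorem numBetween_le_Fmax {x z : X} (h : x ≤ z) {i j k : ℤ} (hi : dim x = i) (hk : dim z = k) :
    numBetween x z j ≤ Fmax X i j k := by
  refine le_csSup ⟨Fintype.card X, ?_⟩ ⟨x, z, hi, hk, h, rfl⟩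
  rintro n ⟨a, b, -, -, -, rfl⟩
  exact Finset.card_le_univ _

theorem Fmin_le_numBetween {x z : X} (h : x ≤ z) {i j k : ℤ} (hi : dim x = i) (hk : dim z = k) :
    Fmin X i j k ≤ numBetween x z j :=
  Nat.sInf_le ⟨x, z, hi, hk, h, rfl⟩

theorem Fmax_le {i j k : ℤ} {N : ℕ}
    (h : ∀ x z : X, dim x = i → dim z = k → x ≤ z → numBetween x z j ≤ N) : Fmax X i j k ≤ N := by
  by_cases hne : {n : ℕ | ∃ x z : X, dim x = i ∧ dim z = k ∧ x ≤ z ∧ n = numBetween x z j}.Nonempty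
  · refine csSup_le hne ?_
    rintro n ⟨x, z, hx, hz, hxz, rfl⟩
    exact h x z hx hz hxz
  · rw [Set.not_nonempty_iff_eq_empty] at hne
    rw [Fmax, hne, csSup_empty]
    exact Nat.zero_le N

theorem Fmin_pos {x z : X} (h : x ≤ z) {i j k : ℤ} (hi : dim x = i) (hk : dim z = k)
    (hij : i ≤ j) (hjk : j ≤ k) : 0 < Fmin X i j k := by
  obtain ⟨a, b, ha, hb, hab, he⟩ := Nat.sInf_mem
    (s := {n : ℕ | ∃ x z : X, dim x = i ∧ dim z = k ∧ x ≤ z ∧ n = numBetween x z j})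
    ⟨_, x, z, hi, hk, h, rfl⟩
  unfold Fmin
  rw [he]
  exact numBetween_pos hab (by omega) (by omega)

theorem isLowerRegular_of_numBetween_eq {N : ℤ → ℤ → ℤ → ℕ}
    (h : ∀ (x z : X) (j : ℤ), x ≤ z → dim x ≤ j → j ≤ dim z →
      numBetween x z j = N (dim x) j (dim z)) : IsLowerRegular X := by
  intro i j k hij hjk
  by_cases hne : ∃ x z : X, dim x = i ∧ dim z = k ∧ x ≤ z
  · obtain ⟨x, z, hx, hz, hxz⟩ := hne
    have : {n : ℕ | ∃ x z : X, dim x = i ∧ dim z = k ∧ x ≤ z ∧ n = numBetween x z j}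
        = {N i j k} := by
      ext n
      constructor
      · rintro ⟨a, b, rfl, rfl, hab, rfl⟩
        exact h a b j hab hij hjk
      · rintro rfl
        exact ⟨x, z, hx, hz, hxz, by rw [h x z j hxz (by omega) (by omega), hx, hz]⟩
    rw [Fmax, Fmin, this, csSup_singleton, csInf_singleton]
  -- Without such a pair both the supremum and the infimum of the empty set of naturals are 0.
  · have : {n : ℕ | ∃ x z : X, dim x = i ∧ dim z = k ∧ x ≤ z ∧ n = numBetween x z j} = ∅ := by
      ext n
      simp only [Set.mem_ofPred_eq, Set.mem_empty_iff_false, iff_false]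
      rintro ⟨a, b, ha, hb, hab, -⟩
      exact hne ⟨a, b, ha, hb, hab⟩
    rw [Fmax, Fmin, this, csSup_empty, Nat.sInf_empty]
    rfl

theorem card_face_between (x z : X) (j : ℤ) :
    (Finset.univ.filter fun y : Face X j => x ≤ y.1 ∧ y.1 ≤ z).card = numBetween x z j := by
  refine Finset.card_bij (fun y _ => y.1) ?_ ?_ ?_
  · intro y hy
    simpa [y.2] using hy
  · intro a _ b _ h
    exact Subtype.ext h
  · intro y hy
    obtain ⟨h1, h2, h3⟩ : dim y = j ∧ x ≤ y ∧ y ≤ z := by simpa using hy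
    exact ⟨⟨y, h1⟩, by simp [h2, h3], rfl⟩

theorem numBetween_self_left {x z : X} (h : x ≤ z) : numBetween x z (dim x) = 1 := by
  rw [numBetween, Finset.card_eq_one]
  refine ⟨x, ?_⟩
  ext y
  simp only [Finset.mem_filter, Finset.mem_univ, true_and, Finset.mem_singleton]
  constructor
  · rintro ⟨h1, h2, -⟩
    exact (eq_of_le_of_dim_eq h2 h1.symm).symm
  · rintro rfl
    exact ⟨rfl, le_rfl, h⟩

variable [OrderBot X]

theorem card_face_le (z : X) (j : ℤ) :
    (Finset.univ.filter fun y : Face X j => y.1 ≤ z).card = numBetween ⊥ z j := by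
  rw [← card_face_between]; simp

/-- Both sides count the pairs x ≤ y ≤ z with dim x = i and dim y = j. -/
theorem sum_numBetween (z : X) (i j : ℤ) :
    ∑ x ∈ Finset.univ.filter (fun x : Face X i => x.1 ≤ z), numBetween x.1 z j =
      ∑ y ∈ Finset.univ.filter (fun y : Face X j => y.1 ≤ z), numBetween ⊥ y.1 i := by
  simp_rw [← card_face_between, Finset.card_eq_sum_ones]
  refine Finset.sum_comm' ?_
  intro x y
  simp only [Finset.mem_filter, Finset.mem_univ, true_and, bot_le]
  constructor
  · rintro ⟨_, h2, h3⟩; exact ⟨h2, h3⟩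
  · rintro ⟨h2, h3⟩; exact ⟨h2.trans h3, h2, h3⟩

end Counting

/-! ### Lower irregularity and approximate flag counts -/

/-- The lower irregularity is at most `Λ`, with the quotients cleared. -/
def IrregularityLE (X : Type u) [PartialOrder X] [Fintype X] [GradeOrder ℤ X] (d : ℕ) (Λ : ℝ) :
    Prop :=
  1 ≤ Λ ∧ ∀ i j k : ℤ, -1 ≤ i → i ≤ j → j ≤ k → k ≤ d → (Fmax X i j k : ℝ) ≤ Λ * Fmin X i j k

section Irregularity

variable {X : Type u} [PartialOrder X] [OrderBot X] [Fintype X] [GradeOrder ℤ X] {d : ℕ}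

theorem IsDPoset.neg_one_le_dim (hX : IsDPoset X d) (x : X) : -1 ≤ dim x :=
  hX.dim_bot ▸ dim_mono bot_le

theorem IsDPoset.dim_le (hX : IsDPoset X d) (x : X) : dim x ≤ d := by
  obtain ⟨y, hy, hxy⟩ := hX.pure x
  exact hy ▸ dim_mono hxy

theorem IsDPoset.Fmin_pos (hX : IsDPoset X d) {i j k : ℤ} (hi : -1 ≤ i) (hij : i ≤ j) (hjk : j ≤ k)
    (hk : k ≤ d) : 0 < Fmin X i j k := by
  obtain ⟨z, hz, -⟩ := hX.pure ⊥
  obtain ⟨y, -, -, hy⟩ := exists_between (bot_le : ⊥ ≤ z) (j := k) (by rw [hX.dim_bot]; omega)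
    (by omega)
  obtain ⟨x, -, hxy, hx⟩ := exists_between (bot_le : ⊥ ≤ y) (j := i) (by rw [hX.dim_bot]; omega)
    (by omega)
  exact CosystolicExpansion.Fmin_pos hxy hx hy hij hjk

theorem IsDPoset.Fmin_le_Fmax (hX : IsDPoset X d) {i j k : ℤ} (hi : -1 ≤ i) (hij : i ≤ j)
    (hjk : j ≤ k) (hk : k ≤ d) : Fmin X i j k ≤ Fmax X i j k := by
  obtain ⟨z, hz, -⟩ := hX.pure ⊥
  obtain ⟨y, -, -, hy⟩ := exists_between (bot_le : ⊥ ≤ z) (j := k) (by rw [hX.dim_bot]; omega)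
    (by omega)
  obtain ⟨x, -, hxy, hx⟩ := exists_between (bot_le : ⊥ ≤ y) (j := i) (by rw [hX.dim_bot]; omega)
    (by omega)
  exact (Fmin_le_numBetween hxy hx hy).trans (numBetween_le_Fmax hxy hx hy)

theorem IsDPoset.irregularityLE (hX : IsDPoset X d) {Λ : ℝ} (hΛ : 1 ≤ Λ)
    (h : lowerIrregularity X d ≤ Λ) : IrregularityLE X d Λ := by
  refine ⟨hΛ, fun i j k hi hij hjk hk => ?_⟩
  have hpos : (0 : ℝ) < Fmin X i j k := by exact_mod_cast hX.Fmin_pos hi hij hjk hk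
  rw [← div_le_iff₀ hpos]
  unfold lowerIrregularity at h
  refine le_trans ?_ h
  apply le_csSup
  swap
  · exact ⟨i, j, k, hi, hij, hjk, hk, rfl⟩
  -- A real supremum is informative only over a bounded set; here only finitely many index triples
  -- occur.
  refine Set.Finite.bddAbove ?_
  refine Set.Finite.subset (Set.Finite.image
    (fun p : ℤ × ℤ × ℤ => (Fmax X p.1 p.2.1 p.2.2 : ℝ) / (Fmin X p.1 p.2.1 p.2.2 : ℝ))
    ((Set.finite_Icc (-1 : ℤ) d).prod ((Set.finite_Icc (-1 : ℤ) d).prod (Set.finite_Icc (-1 : ℤ) d))))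
    ?_
  rintro r ⟨i, j, k, hi, hij, hjk, hk, rfl⟩
  refine ⟨(i, j, k), ?_, rfl⟩
  simp only [Set.mem_prod, Set.mem_Icc]
  omega

theorem IsLowerRegular.irregularityLE (h : IsLowerRegular X) (d : ℕ) : IrregularityLE X d 1 :=
  ⟨le_rfl, fun i j k _ hij hjk _ => by rw [h i j k hij hjk, one_mul]⟩

/-- Count the flags x ≤ y ≤ z via `sum_numBetween`, bounding the inner count below on one side and
above on the other. The primed version exchanges the two bounds. -/
theorem numBetween_mul_Fmin_le (z : X) {i j k : ℤ} (hk : dim z = k) (hb : dim (⊥ : X) = -1) :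
    numBetween ⊥ z i * Fmin X i j k ≤ numBetween ⊥ z j * Fmax X (-1) i j := by
  calc numBetween ⊥ z i * Fmin X i j k
      = ∑ x ∈ Finset.univ.filter (fun x : Face X i => x.1 ≤ z), Fmin X i j k := by
        rw [Finset.sum_const, card_face_le, smul_eq_mul]
    _ ≤ ∑ x ∈ Finset.univ.filter (fun x : Face X i => x.1 ≤ z), numBetween x.1 z j :=
        Finset.sum_le_sum fun x hx => Fmin_le_numBetween (Finset.mem_filter.1 hx).2 x.2 hk
    _ ≤ ∑ y ∈ Finset.univ.filter (fun y : Face X j => y.1 ≤ z), Fmax X (-1) i j := by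
        rw [sum_numBetween]
        exact Finset.sum_le_sum fun y _ => numBetween_le_Fmax bot_le hb y.2
    _ = _ := by rw [Finset.sum_const, card_face_le, smul_eq_mul]

theorem numBetween_mul_Fmin_le' (z : X) {i j k : ℤ} (hk : dim z = k) (hb : dim (⊥ : X) = -1) :
    numBetween ⊥ z j * Fmin X (-1) i j ≤ numBetween ⊥ z i * Fmax X i j k := by
  calc numBetween ⊥ z j * Fmin X (-1) i j
      = ∑ y ∈ Finset.univ.filter (fun y : Face X j => y.1 ≤ z), Fmin X (-1) i j := by
        rw [Finset.sum_const, card_face_le, smul_eq_mul]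
    _ ≤ ∑ x ∈ Finset.univ.filter (fun x : Face X i => x.1 ≤ z), numBetween x.1 z j := by
        rw [sum_numBetween]
        exact Finset.sum_le_sum fun y _ => Fmin_le_numBetween bot_le hb y.2
    _ ≤ ∑ x ∈ Finset.univ.filter (fun x : Face X i => x.1 ≤ z), Fmax X i j k :=
        Finset.sum_le_sum fun x hx => numBetween_le_Fmax (Finset.mem_filter.1 hx).2 x.2 hk
    _ = _ := by rw [Finset.sum_const, card_face_le, smul_eq_mul]

/-- For lower-regular X this is the flag-count identity with Λ = 1. The single factor Λ replaces the
count in [x, z] by its minimum. -/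
theorem IsDPoset.numBetween_mul_le (hX : IsDPoset X d) {Λ : ℝ} (hΛ : IrregularityLE X d Λ)
    {x z : X} (hxz : x ≤ z) {j : ℤ} (hxj : dim x ≤ j) (hjz : j ≤ dim z) :
    (numBetween x z j : ℝ) * numBetween ⊥ z (dim x) ≤
      Λ * Fmax X (-1) (dim x) j * numBetween ⊥ z j := by
  have h1 : (numBetween x z j : ℝ) ≤ Λ * Fmin X (dim x) j (dim z) :=
    le_trans (by exact_mod_cast numBetween_le_Fmax hxz rfl rfl)
      (hΛ.2 _ _ _ (hX.neg_one_le_dim x) hxj hjz (hX.dim_le z))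
  have h2 : (numBetween ⊥ z (dim x) : ℝ) * Fmin X (dim x) j (dim z) ≤
      numBetween ⊥ z j * Fmax X (-1) (dim x) j := by
    exact_mod_cast numBetween_mul_Fmin_le z rfl hX.dim_bot
  have h3 := mul_le_mul_of_nonneg_right h1 (Nat.cast_nonneg (α := ℝ) (numBetween ⊥ z (dim x)))
  have h4 := mul_le_mul_of_nonneg_left h2 (zero_le_one.trans hΛ.1)
  linarith

/-- The reverse of `numBetween_mul_le`. It costs Λ twice: once to pass from maximum to minimum in
intervals below dimension j, once in intervals above dim x. -/
theorem IsDPoset.le_numBetween_mul (hX : IsDPoset X d) {Λ : ℝ} (hΛ : IrregularityLE X d Λ)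
    {x z : X} (hxz : x ≤ z) {j : ℤ} (hxj : dim x ≤ j) (hjz : j ≤ dim z) :
    (Fmax X (-1) (dim x) j : ℝ) * numBetween ⊥ z j ≤
      Λ ^ 2 * numBetween x z j * numBetween ⊥ z (dim x) := by
  have hΛ0 : 0 ≤ Λ := zero_le_one.trans hΛ.1
  have h1 := hΛ.2 (-1) (dim x) j le_rfl (hX.neg_one_le_dim x) hxj (hjz.trans (hX.dim_le z))
  have h2 : (numBetween ⊥ z j : ℝ) * Fmin X (-1) (dim x) j ≤
      numBetween ⊥ z (dim x) * Fmax X (dim x) j (dim z) := by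
    exact_mod_cast numBetween_mul_Fmin_le' z rfl hX.dim_bot
  have h3 := hΛ.2 (dim x) j (dim z) (hX.neg_one_le_dim x) hxj hjz (hX.dim_le z)
  have h4 : (Fmin X (dim x) j (dim z) : ℝ) ≤ numBetween x z j := by
    exact_mod_cast Fmin_le_numBetween hxz rfl rfl
  calc (Fmax X (-1) (dim x) j : ℝ) * numBetween ⊥ z j
      ≤ (Λ * Fmin X (-1) (dim x) j) * numBetween ⊥ z j := by gcongr
    _ = Λ * (numBetween ⊥ z j * Fmin X (-1) (dim x) j) := by ring
    _ ≤ Λ * (numBetween ⊥ z (dim x) * (Λ * numBetween x z j)) := by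
        refine mul_le_mul_of_nonneg_left (h2.trans ?_) hΛ0
        refine mul_le_mul_of_nonneg_left (h3.trans ?_) (Nat.cast_nonneg _)
        gcongr
    _ = _ := by ring

end Irregularity

/-! ### Proper weights and their comparison with link weights -/

section Weights

variable {X : Type u} [PartialOrder X] [OrderBot X] [Fintype X] [GradeOrder ℤ X] {d : ℕ} {w : X → ℝ}

/-- The `d`-faces containing `x`. -/
noncomputable def topFaces (d : ℕ) (x : X) : Finset X :=
  Finset.univ.filter fun y : X => dim y = d ∧ x ≤ y

theorem mem_topFaces {x y : X} : y ∈ topFaces d x ↔ dim y = d ∧ x ≤ y := by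
  simp [topFaces]

theorem IsProperWeight.eq_sum_topFaces (hw : IsProperWeight d w) (x : X) :
    w x = ∑ y ∈ topFaces d x, w y / (numBetween ⊥ y (dim x) : ℝ) := by
  rw [hw.eq_sum x]
  simp [topFaces, numBetween]

theorem linkWeight_eq (z : X) (x : Link z) :
    linkWeight d w z x = (∑ y ∈ topFaces d z, w y)⁻¹ *
      ∑ y ∈ topFaces d x.1, w y / (numBetween z y (dim x.1) : ℝ) := rfl

/-- Expand every w(y) over the top faces above it and exchange the sums: a top face z above x is
reached from each j-face between x and z. -/
theorem IsProperWeight.sum_above_eq (hw : IsProperWeight d w) (x : X) (j : ℤ) :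
    ∑ y ∈ Finset.univ.filter (fun y : Face X j => x ≤ y.1), w y.1 =
      ∑ z ∈ topFaces d x, numBetween x z j * (w z / (numBetween ⊥ z j : ℝ)) := by
  have h : ∀ y : Face X j, w y.1 = ∑ z ∈ topFaces d y.1, w z / (numBetween ⊥ z j : ℝ) := by
    intro y
    rw [hw.eq_sum_topFaces y.1, y.2]
  rw [Finset.sum_congr rfl fun y _ => h y,
    Finset.sum_comm' (t' := topFaces d x)
      (s' := fun z => Finset.univ.filter fun y : Face X j => x ≤ y.1 ∧ y.1 ≤ z)]
  · refine Finset.sum_congr rfl fun z _ => ?_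
    rw [Finset.sum_const, card_face_between, nsmul_eq_mul]
  · intro y z
    simp only [mem_topFaces, Finset.mem_filter, Finset.mem_univ, true_and]
    constructor
    · rintro ⟨a, b, c⟩; exact ⟨⟨a, c⟩, b, a.trans c⟩
    · rintro ⟨⟨a, c⟩, b, e⟩; exact ⟨a, b, c⟩

theorem numBetween_bot_pos (hX : IsDPoset X d) {y : X} {j : ℤ} (hj : -1 ≤ j) (hjy : j ≤ dim y) :
    (0 : ℝ) < numBetween ⊥ y j := by
  exact_mod_cast numBetween_pos bot_le (by rw [hX.dim_bot]; exact hj) hjy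

theorem IsProperWeight.sum_face (hw : IsProperWeight d w) (hX : IsDPoset X d) {j : ℤ} (hj : -1 ≤ j)
    (hjd : j ≤ d) : ∑ y : Face X j, w y.1 = 1 := by
  have h := hw.sum_above_eq ⊥ j
  simp only [bot_le, Finset.filter_true] at h
  rw [h, ← hw.sum_top]
  have : topFaces d (⊥ : X) = Finset.univ.filter fun y : X => dim y = d := by simp [topFaces]
  rw [this]
  refine Finset.sum_congr rfl fun z hz => ?_
  have := numBetween_bot_pos hX hj (y := z) (by rw [(Finset.mem_filter.1 hz).2]; exact hjd)
  field_simp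

theorem IsProperWeight.sum_above_le (hw : IsProperWeight d w) (hX : IsDPoset X d) {Λ : ℝ}
    (hΛ : IrregularityLE X d Λ) (x : X) {i j : ℤ} (hi : dim x = i) (hij : i ≤ j) (hjd : j ≤ d) :
    ∑ y ∈ Finset.univ.filter (fun y : Face X j => x ≤ y.1), w y.1 ≤ Λ * Fmax X (-1) i j * w x := by
  subst hi
  rw [hw.sum_above_eq, hw.eq_sum_topFaces x, Finset.mul_sum]
  refine Finset.sum_le_sum fun z hz => ?_
  obtain ⟨hz, hxz⟩ := mem_topFaces.1 hz
  have h1 := hX.numBetween_mul_le hΛ hxz hij (by omega)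
  have h2 := numBetween_bot_pos hX (y := z) (hX.neg_one_le_dim x) (dim_mono hxz)
  have h3 := numBetween_bot_pos hX (y := z) ((hX.neg_one_le_dim x).trans hij) (by omega)
  have h4 := hw.pos z
  rw [mul_div_assoc', mul_div_assoc', div_le_div_iff₀ h3 h2]
  nlinarith

theorem IsProperWeight.sum_topFaces_pos (hw : IsProperWeight d w) (hX : IsDPoset X d) (x : X) :
    0 < ∑ y ∈ topFaces d x, w y := by
  obtain ⟨y, hy, hxy⟩ := hX.pure x
  exact Finset.sum_pos (fun y _ => hw.pos y) ⟨y, mem_topFaces.2 ⟨hy, hxy⟩⟩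

theorem IsProperWeight.mul_Fmin_le (hw : IsProperWeight d w) (hX : IsDPoset X d) (x : X) {i : ℤ}
    (hi : dim x = i) : w x * Fmin X (-1) i d ≤ ∑ y ∈ topFaces d x, w y := by
  subst hi
  rw [hw.eq_sum_topFaces x, Finset.sum_mul]
  refine Finset.sum_le_sum fun z hz => ?_
  obtain ⟨hz, hxz⟩ := mem_topFaces.1 hz
  have h2 := numBetween_bot_pos hX (y := z) (hX.neg_one_le_dim x) (dim_mono hxz)
  have h4 := hw.pos z
  have h3 : (Fmin X (-1) (dim x) d : ℝ) ≤ numBetween ⊥ z (dim x) := by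
    exact_mod_cast Fmin_le_numBetween bot_le hX.dim_bot hz
  rw [div_mul_eq_mul_div, div_le_iff₀ h2]
  gcongr

theorem IsProperWeight.le_mul_Fmax (hw : IsProperWeight d w) (hX : IsDPoset X d) (x : X) {i : ℤ}
    (hi : dim x = i) : ∑ y ∈ topFaces d x, w y ≤ w x * Fmax X (-1) i d := by
  subst hi
  rw [hw.eq_sum_topFaces x, Finset.sum_mul]
  refine Finset.sum_le_sum fun z hz => ?_
  obtain ⟨hz, hxz⟩ := mem_topFaces.1 hz
  have h2 := numBetween_bot_pos hX (y := z) (hX.neg_one_le_dim x) (dim_mono hxz)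
  have h4 := hw.pos z
  have h3 : (numBetween ⊥ z (dim x) : ℝ) ≤ Fmax X (-1) (dim x) d := by
    exact_mod_cast numBetween_le_Fmax bot_le hX.dim_bot hz
  rw [div_mul_eq_mul_div, le_div_iff₀ h2]
  gcongr

/-- In the lower-regular case w(x) = F(−1,i,j)·w(z)·w_z(x). Here Λ² comes from `le_numBetween_mul`
on each top face and one more Λ from normalising by the total weight of the top faces over z. -/
theorem IsProperWeight.linkWeight_upper (hw : IsProperWeight d w) (hX : IsDPoset X d) {Λ : ℝ}
    (hΛ : IrregularityLE X d Λ) (z : X) (x : Link z) {i j : ℤ} (hi : dim z = i) (hj : dim x.1 = j) :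
    Fmax X (-1) i j * w z * linkWeight d w z x ≤ Λ ^ 3 * w x.1 := by
  subst hi hj
  have hzx : dim z ≤ dim x.1 := dim_mono x.2
  have hΛ0 : 0 < Λ := zero_lt_one.trans_le hΛ.1
  set W := ∑ y ∈ topFaces d z, w y with hW
  have hWpos : 0 < W := hw.sum_topFaces_pos hX z
  have h1 : w z * Fmin X (-1) (dim z) d ≤ W := hw.mul_Fmin_le hX z rfl
  have h2 := hΛ.2 (-1) (dim z) d le_rfl (hX.neg_one_le_dim z) (hX.dim_le z) le_rfl
  have h3 : (Fmax X (-1) (dim z) (dim x.1) : ℝ) *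
      ∑ y ∈ topFaces d x.1, w y / (numBetween z y (dim x.1) : ℝ) ≤
      Λ ^ 2 * Fmax X (-1) (dim z) d * w x.1 := by
    rw [hw.eq_sum_topFaces x.1, Finset.mul_sum, Finset.mul_sum]
    refine Finset.sum_le_sum fun y hy => ?_
    obtain ⟨hy, hxy⟩ := mem_topFaces.1 hy
    have hzy : z ≤ y := le_trans x.2 hxy
    have g1 := hX.le_numBetween_mul hΛ hzy hzx (dim_mono hxy)
    have g2 := numBetween_bot_pos hX (y := y) (hX.neg_one_le_dim x.1) (dim_mono hxy)
    have g3 : (0 : ℝ) < numBetween z y (dim x.1) := by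
      exact_mod_cast numBetween_pos hzy hzx (dim_mono hxy)
    have g4 : (numBetween ⊥ y (dim z) : ℝ) ≤ Fmax X (-1) (dim z) d := by
      exact_mod_cast numBetween_le_Fmax bot_le hX.dim_bot hy
    have g5 := hw.pos y
    rw [mul_div_assoc', mul_div_assoc', div_le_div_iff₀ g3 g2]
    calc (Fmax X (-1) (dim z) (dim x.1) : ℝ) * w y * numBetween ⊥ y (dim x.1)
        = w y * (Fmax X (-1) (dim z) (dim x.1) * numBetween ⊥ y (dim x.1)) := by ring
      _ ≤ w y * (Λ ^ 2 * numBetween z y (dim x.1) * Fmax X (-1) (dim z) d) := by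
          refine mul_le_mul_of_nonneg_left (g1.trans ?_) g5.le
          gcongr
      _ = _ := by ring
  rw [linkWeight_eq, ← hW]
  have hwz := hw.pos z
  have hwx := hw.pos x.1
  calc Fmax X (-1) (dim z) (dim x.1) * w z *
        (W⁻¹ * ∑ y ∈ topFaces d x.1, w y / (numBetween z y (dim x.1) : ℝ))
      = w z * W⁻¹ * (Fmax X (-1) (dim z) (dim x.1) *
        ∑ y ∈ topFaces d x.1, w y / (numBetween z y (dim x.1) : ℝ)) := by ring
    _ ≤ w z * W⁻¹ * (Λ ^ 2 * (Λ * Fmin X (-1) (dim z) d) * w x.1) := by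
        refine mul_le_mul_of_nonneg_left (h3.trans ?_) (by positivity)
        gcongr
    _ = (w z * Fmin X (-1) (dim z) d) * W⁻¹ * (Λ ^ 3 * w x.1) := by ring
    _ ≤ W * W⁻¹ * (Λ ^ 3 * w x.1) := by gcongr
    _ = Λ ^ 3 * w x.1 := by rw [mul_inv_cancel₀ hWpos.ne', one_mul]

/-- The opposite comparison: one Λ from `numBetween_mul_le` on each top face, one from the
normalisation. -/
theorem IsProperWeight.linkWeight_lower (hw : IsProperWeight d w) (hX : IsDPoset X d) {Λ : ℝ}
    (hΛ : IrregularityLE X d Λ) (z : X) (x : Link z) {i j : ℤ} (hi : dim z = i) (hj : dim x.1 = j) :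
    w x.1 ≤ Λ ^ 2 * (Fmax X (-1) i j * w z * linkWeight d w z x) := by
  subst hi hj
  have hzx : dim z ≤ dim x.1 := dim_mono x.2
  have hΛ0 : 0 < Λ := zero_lt_one.trans_le hΛ.1
  set W := ∑ y ∈ topFaces d z, w y with hW
  have hWpos : 0 < W := hw.sum_topFaces_pos hX z
  have h1 : W ≤ w z * Fmax X (-1) (dim z) d := hw.le_mul_Fmax hX z rfl
  have h2 := hΛ.2 (-1) (dim z) d le_rfl (hX.neg_one_le_dim z) (hX.dim_le z) le_rfl
  have h3 : Fmin X (-1) (dim z) d * w x.1 ≤ Λ * ((Fmax X (-1) (dim z) (dim x.1) : ℝ) *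
      ∑ y ∈ topFaces d x.1, w y / (numBetween z y (dim x.1) : ℝ)) := by
    rw [hw.eq_sum_topFaces x.1, Finset.mul_sum, Finset.mul_sum, Finset.mul_sum]
    refine Finset.sum_le_sum fun y hy => ?_
    obtain ⟨hy, hxy⟩ := mem_topFaces.1 hy
    have hzy : z ≤ y := le_trans x.2 hxy
    have g1 := hX.numBetween_mul_le hΛ hzy hzx (dim_mono hxy)
    have g2 := numBetween_bot_pos hX (y := y) (hX.neg_one_le_dim x.1) (dim_mono hxy)
    have g3 : (0 : ℝ) < numBetween z y (dim x.1) := by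
      exact_mod_cast numBetween_pos hzy hzx (dim_mono hxy)
    have g4 : (Fmin X (-1) (dim z) d : ℝ) ≤ numBetween ⊥ y (dim z) := by
      exact_mod_cast Fmin_le_numBetween bot_le hX.dim_bot hy
    have g5 := hw.pos y
    rw [mul_div_assoc', mul_div_assoc', mul_div_assoc', div_le_div_iff₀ g2 g3]
    calc (Fmin X (-1) (dim z) d : ℝ) * w y * numBetween z y (dim x.1)
        ≤ numBetween ⊥ y (dim z) * w y * numBetween z y (dim x.1) := by gcongr
      _ = w y * (numBetween z y (dim x.1) * numBetween ⊥ y (dim z)) := by ring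
      _ ≤ w y * (Λ * Fmax X (-1) (dim z) (dim x.1) * numBetween ⊥ y (dim x.1)) := by gcongr
      _ = _ := by ring
  rw [linkWeight_eq, ← hW]
  have hwz := hw.pos z
  have hwx := hw.pos x.1
  calc w x.1 = W⁻¹ * W * w x.1 := by rw [inv_mul_cancel₀ hWpos.ne', one_mul]
    _ ≤ W⁻¹ * (w z * (Λ * Fmin X (-1) (dim z) d)) * w x.1 := by
        gcongr
        exact h1.trans (by gcongr)
    _ = Λ * (W⁻¹ * w z) * (Fmin X (-1) (dim z) d * w x.1) := by ring
    _ ≤ Λ * (W⁻¹ * w z) * (Λ * ((Fmax X (-1) (dim z) (dim x.1) : ℝ) *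
      ∑ y ∈ topFaces d x.1, w y / (numBetween z y (dim x.1) : ℝ))) := by gcongr
    _ = _ := by ring

theorem IsProperWeight.linkWeight_nonneg (hw : IsProperWeight d w) (z : X) (x : Link z) :
    0 ≤ linkWeight d w z x := by
  rw [linkWeight_eq]
  have := fun y => (hw.pos y).le
  exact mul_nonneg (inv_nonneg.2 (Finset.sum_nonneg fun y _ => this y))
    (Finset.sum_nonneg fun y _ => div_nonneg (this y) (Nat.cast_nonneg _))

theorem IsProperWeight.linkWeight_self (hw : IsProperWeight d w) (hX : IsDPoset X d) (z : X)
    (x : Link z) (hx : x.1 = z) : linkWeight d w z x = 1 := by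
  rw [linkWeight_eq, hx]
  have : ∑ y ∈ topFaces d z, w y / (numBetween z y (dim z) : ℝ) = ∑ y ∈ topFaces d z, w y := by
    refine Finset.sum_congr rfl fun y hy => ?_
    rw [numBetween_self_left (mem_topFaces.1 hy).2, Nat.cast_one, div_one]
  rw [this, inv_mul_cancel₀ (hw.sum_topFaces_pos hX z).ne']

end Weights

/-! ### Norms, distances and expansion constants -/

section Norms

variable {R : Type v} [CommRing R] {X : Type u} [PartialOrder X] [Fintype X] [GradeOrder ℤ X]
  {S : PosetSheaf.{u, v, v'} R X} {w : X → ℝ} {i : ℤ}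

theorem wnorm_nonneg (hw : ∀ x, 0 ≤ w x) (f : Cochain S i) : 0 ≤ wnorm w f :=
  Finset.sum_nonneg fun x _ => hw x.1

theorem wnorm_zero : wnorm w (0 : Cochain S i) = 0 := by
  simp [wnorm]

theorem eq_zero_of_wnorm_nonpos (hw : ∀ x, 0 < w x) {f : Cochain S i} (h : wnorm w f ≤ 0) :
    f = 0 := by
  have h0 := le_antisymm h (wnorm_nonneg (fun x => (hw x).le) f)
  rw [wnorm, Finset.sum_eq_zero_iff_of_nonneg fun x _ => (hw x.1).le] at h0
  funext x
  by_contra hx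
  exact (hw x.1).ne' (h0 x (by simpa using hx))

theorem wnorm_le_sum (hw : ∀ x, 0 ≤ w x) {f : Cochain S i} {A : Finset (Face X i)}
    (h : ∀ x, f x ≠ 0 → x ∈ A) : wnorm w f ≤ ∑ x ∈ A, w x.1 :=
  Finset.sum_le_sum_of_subset_of_nonneg (fun x hx => h x (Finset.mem_filter.1 hx).2)
    fun x _ _ => hw x.1

theorem wnorm_add_le (hw : ∀ x, 0 ≤ w x) (f g : Cochain S i) :
    wnorm w (f + g) ≤ wnorm w f + wnorm w g := by
  refine (wnorm_le_sum hw (A := Finset.univ.filter (fun x => f x ≠ 0) ∪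
    Finset.univ.filter (fun x => g x ≠ 0)) ?_).trans ?_
  · intro x hx
    by_contra hn
    simp only [Finset.mem_union, Finset.mem_filter, Finset.mem_univ, true_and, not_or,
      not_not] at hn
    exact hx (by rw [Pi.add_apply, hn.1, hn.2, add_zero])
  · have h := Finset.sum_union_inter (s₁ := Finset.univ.filter (fun x => f x ≠ 0))
      (s₂ := Finset.univ.filter (fun x => g x ≠ 0)) (f := fun x : Face X i => w x.1)
    unfold wnorm
    rw [← h]
    exact le_add_of_nonneg_right (Finset.sum_nonneg fun x _ => hw x.1)

theorem wnorm_neg (f : Cochain S i) : wnorm w (-f) = wnorm w f := by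
  simp [wnorm]

theorem wdist_le (hw : ∀ x, 0 ≤ w x) (f : Cochain S i) {A : Submodule R (Cochain S i)}
    {g : Cochain S i} (hg : g ∈ A) : wdist w f A ≤ wnorm w (f - g) :=
  ciInf_le (f := fun g : A => wnorm w (f - g.1))
    ⟨0, by rintro _ ⟨g, rfl⟩; exact wnorm_nonneg hw _⟩ ⟨g, hg⟩

theorem le_wdist {f : Cochain S i} {A : Submodule R (Cochain S i)} {c : ℝ}
    (h : ∀ g ∈ A, c ≤ wnorm w (f - g)) : c ≤ wdist w f A :=
  le_ciInf fun g => h g.1 g.2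

theorem wdist_nonneg (hw : ∀ x, 0 ≤ w x) (f : Cochain S i) (A : Submodule R (Cochain S i)) :
    0 ≤ wdist w f A :=
  le_wdist fun _ _ => wnorm_nonneg hw _

theorem mul_wdist_le_of_le_cbe (hw : ∀ x, 0 ≤ w x) {O : PosetOrientation R X} {ε : ℝ}
    (h : ENNReal.ofReal ε ≤ cbe O w S i) (f : Cochain S i) :
    ε * wdist w f (coboundaries O S i) ≤ wnorm w (coboundary O S i (i + 1) f) := by
  have h0 := wdist_nonneg hw f (coboundaries O S i)
  rcases h0.eq_or_lt with h1 | h1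
  · rw [← h1, mul_zero]
    exact wnorm_nonneg hw _
  · rw [← le_div_iff₀ h1]
    -- Every a < ε lies below some admissible μ of the supremum, so the bound for ε follows without
    -- knowing that the supremum is attained.
    refine le_of_forall_lt fun a ha => ?_
    rcases lt_or_ge a 0 with ha0 | ha0
    · exact ha0.trans_le (div_nonneg (wnorm_nonneg hw _) h0)
    · have h2 : ENNReal.ofReal a < cbe O w S i :=
        ((ENNReal.ofReal_lt_ofReal_iff (ha0.trans_lt ha)).2 ha).trans_le h
      rw [cbe, lt_iSup_iff] at h2
      obtain ⟨μ, h2⟩ := h2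
      rw [lt_iSup_iff] at h2
      obtain ⟨hμ, h2⟩ := h2
      have h3 : a < μ := by
        rw [← ENNReal.ofReal_coe_nnreal] at h2
        exact (ENNReal.ofReal_lt_ofReal_iff_of_nonneg ha0).1 h2
      refine h3.trans_le ?_
      rw [le_div_iff₀ h1]
      exact hμ f

theorem ofReal_le_cse {O : PosetOrientation R X} {μ : ℝ} (hμ : 0 ≤ μ)
    (h : ∀ f : Cochain S i, μ * wdist w f (cocycles O S i) ≤
      wnorm w (coboundary O S i (i + 1) f)) : ENNReal.ofReal μ ≤ cse O w S i := by
  refine le_iSup₂_of_le (f := fun (μ : ℝ≥0) (_ : μ ∈ {μ : ℝ≥0 | ∀ f : Cochain S i,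
    (μ : ℝ) * wdist w f (cocycles O S i) ≤ wnorm w (coboundary O S i (i + 1) f)}) => (μ : ℝ≥0∞))
    ⟨μ, hμ⟩ h ?_
  rw [ENNReal.ofReal_eq_coe_nnreal hμ]
  exact le_rfl

/-- The support of a cochain. -/
noncomputable def supp (b : Cochain S i) : Finset (Face X i) :=
  Finset.univ.filter fun e => b e ≠ 0

theorem mem_supp {b : Cochain S i} {e : Face X i} : e ∈ supp b ↔ b e ≠ 0 := by
  simp [supp]

theorem wnorm_eq_sum_supp (b : Cochain S i) : wnorm w b = ∑ e ∈ supp b, w e.1 := rfl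

end Norms

/-! ### The coboundary map -/

section Coboundary

variable {R : Type v} [CommRing R] {X : Type u} [PartialOrder X] [Fintype X] [GradeOrder ℤ X]
  {O : PosetOrientation R X} {S : PosetSheaf.{u, v, v'} R X}

theorem coboundary_apply {i j : ℤ} (f : Cochain S i) (y : Face X j) :
    coboundary O S i j f y = ∑ x : Face X i,
      if h : x.1 ≤ y.1 then (O.coeff y.1 x.1 : R) • S.res h (f x) else 0 := rfl

theorem coboundary_single_apply {i j : ℤ} (u : Face X i) (s : S.obj u.1) (y : Face X j) :
    coboundary O S i j (Pi.single u s) y =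
      if h : u.1 ≤ y.1 then (O.coeff y.1 u.1 : R) • S.res h s else 0 := by
  rw [coboundary_apply, Finset.sum_eq_single u]
  · simp
  · intro x _ hx
    simp [Pi.single_eq_of_ne hx]
  · simp

/-- After exchanging sums, the restriction of f(x) to z is multiplied by the sum of [z:y][y:x] over
intermediate y, which an orientation makes 0. -/
theorem coboundary_coboundary {i j k : ℤ} (hj : j = i + 1) (hk : k = i + 2) (f : Cochain S i) :
    coboundary O S j k (coboundary O S i j f) = 0 := by
  funext z
  have h : ∀ (y : Face X j), (if h : y.1 ≤ z.1 then
      (O.coeff z.1 y.1 : R) • S.res h (coboundary O S i j f y) else 0) =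
      ∑ x : Face X i, if h : x.1 ≤ y.1 ∧ y.1 ≤ z.1 then
        ((O.coeff z.1 y.1 : R) * (O.coeff y.1 x.1 : R)) • S.res (h.1.trans h.2) (f x) else 0 := by
    intro y
    by_cases hy : y.1 ≤ z.1
    · rw [dif_pos hy, coboundary_apply, map_sum, Finset.smul_sum]
      refine Finset.sum_congr rfl fun x _ => ?_
      by_cases hx : x.1 ≤ y.1
      · simp [hx, hy, S.res_res, smul_smul]
      · simp [hx]
    · simp [hy]
  rw [coboundary_apply, Finset.sum_congr rfl fun y _ => h y, Finset.sum_comm, Pi.zero_apply]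
  refine Finset.sum_eq_zero fun x _ => ?_
  by_cases hxz : x.1 ≤ z.1
  · have h1 := O.sum_eq_zero x.1 z.1 hxz (by rw [x.2, z.2, hk])
    have h2 : ∀ y : Face X j, (if h : x.1 ≤ y.1 ∧ y.1 ≤ z.1 then
        ((O.coeff z.1 y.1 : R) * (O.coeff y.1 x.1 : R)) • S.res (h.1.trans h.2) (f x) else 0) =
        (if x.1 ≤ y.1 ∧ y.1 ≤ z.1 then (O.coeff z.1 y.1 : R) * (O.coeff y.1 x.1 : R) else 0) •
          S.res hxz (f x) := by
      intro y
      by_cases h : x.1 ≤ y.1 ∧ y.1 ≤ z.1 <;> simp [h]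
    rw [Finset.sum_congr rfl fun y _ => h2 y, ← Finset.sum_smul, ← Finset.sum_filter]
    convert zero_smul R _
    rw [← h1]
    refine Finset.sum_bij (fun y _ => y.1) ?_ ?_ ?_ ?_
    · intro y hy
      obtain ⟨a, b⟩ := (Finset.mem_filter.1 hy).2
      have hx := x.2
      have hz := z.2
      have hy := y.2
      refine Finset.mem_filter.2 ⟨Finset.mem_univ _, lt_of_le_of_ne a ?_, lt_of_le_of_ne b ?_⟩
      · intro e; rw [e] at hx; omega
      · intro e; rw [e] at hy; omega
    · intro a _ b _ h
      exact Subtype.ext h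
    · intro y hy
      obtain ⟨a, b⟩ := (Finset.mem_filter.1 hy).2
      have ha : dim x.1 < dim y := grade_strictMono a
      have hb : dim y < dim z.1 := grade_strictMono b
      have hx := x.2
      have hz := z.2
      exact ⟨⟨y, by omega⟩, by simp [a.le, b.le], rfl⟩
    · intro y _
      rfl
  · refine Finset.sum_eq_zero fun y _ => ?_
    rw [dif_neg fun h => hxz (h.1.trans h.2)]

end Coboundary

/-! ### Restricting cochains to links -/

section Links

variable {R : Type v} [CommRing R] {X : Type u} [PartialOrder X] [Fintype X] [GradeOrder ℤ X]
  {O : PosetOrientation R X} {S : PosetSheaf.{u, v, v'} R X}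

/-- A face of the link of `z`, as a face of the poset. -/
def linkFace (z : X) {j k : ℤ} (h : k = j + dim z + 1) (x : Face (Link z) j) : Face X k :=
  ⟨x.1.1, by have : dim x.1.1 - dim z - 1 = j := x.2; omega⟩

theorem linkFace_injective (z : X) {j k : ℤ} (h : k = j + dim z + 1) :
    Function.Injective (linkFace z h) := by
  intro x y hxy
  exact Subtype.ext (Subtype.ext (congrArg (fun t : Face X k => t.1) hxy))

theorem exists_linkFace_eq (z : X) {j k : ℤ} (h : k = j + dim z + 1) (y : Face X k) (hy : z ≤ y.1) :
    ∃ x, linkFace z h x = y :=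
  ⟨⟨⟨y.1, hy⟩, show dim y.1 - dim z - 1 = j by rw [y.2]; omega⟩, rfl⟩

theorem sum_linkFace {M : Type*} [AddCommMonoid M] (z : X) {j k : ℤ} (h : k = j + dim z + 1)
    (g : Face X k → M) : ∑ x : Face (Link z) j, g (linkFace z h x) =
      ∑ y ∈ Finset.univ.filter (fun y : Face X k => z ≤ y.1), g y := by
  refine Finset.sum_bij (fun x _ => linkFace z h x) ?_ ?_ ?_ ?_
  · intro x _
    exact Finset.mem_filter.2 ⟨Finset.mem_univ _, x.1.2⟩
  · intro a _ b _ e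
    exact linkFace_injective z h e
  · intro y hy
    obtain ⟨x, hx⟩ := exists_linkFace_eq z h y (Finset.mem_filter.1 hy).2
    exact ⟨x, Finset.mem_univ _, hx⟩
  · intro x _
    rfl

/-- The restriction of a cochain to the link of `z`. -/
def restrictLink (z : X) {j k : ℤ} (h : k = j + dim z + 1) (b : Cochain S k) :
    Cochain (S.link z) j := fun x => b (linkFace z h x)

theorem coboundary_restrictLink (z : X) {j k j' k' : ℤ} (h : k = j + dim z + 1)
    (h' : k' = j' + dim z + 1) (b : Cochain S k) (t : Face (Link z) j') :
    coboundary (O.link z) (S.link z) j j' (restrictLink z h b) t =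
      ∑ e ∈ Finset.univ.filter (fun e : Face X k => z ≤ e.1),
        if he : e.1 ≤ (linkFace z h' t).1 then
          (O.coeff (linkFace z h' t).1 e.1 : R) • S.res he (b e) else 0 := by
  rw [← sum_linkFace z h]
  rfl

/-- The coboundary in the link keeps only those summands of db(t) whose face contains z. As db(t) =
0, the remaining summands give its negative, so if one part is nonzero then so is the other. -/
theorem exists_of_coboundary_restrictLink_ne_zero (z : X) {j k j' k' : ℤ} (h : k = j + dim z + 1)
    (h' : k' = j' + dim z + 1) {b : Cochain S k} (hb : coboundary O S k k' b = 0)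
    {t : Face (Link z) j'}
    (ht : coboundary (O.link z) (S.link z) j j' (restrictLink z h b) t ≠ 0) :
    (∃ e : Face X k, z ≤ e.1 ∧ e.1 ≤ t.1.1 ∧ b e ≠ 0) ∧
      ∃ e : Face X k, ¬ z ≤ e.1 ∧ e.1 ≤ t.1.1 ∧ b e ≠ 0 := by
  rw [coboundary_restrictLink z h h'] at ht
  have h0 := congrFun hb (linkFace z h' t)
  rw [coboundary_apply, Pi.zero_apply, ← Finset.sum_filter_add_sum_filter_not _
    (fun e : Face X k => z ≤ e.1)] at h0
  constructor
  · obtain ⟨e, he, hne⟩ := Finset.exists_ne_zero_of_sum_ne_zero ht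
    refine ⟨e, (Finset.mem_filter.1 he).2, ?_⟩
    by_cases hle : e.1 ≤ (linkFace z h' t).1
    · refine ⟨hle, fun hz => hne ?_⟩
      rw [dif_pos hle, hz, map_zero, smul_zero]
      rfl
    · exact absurd (dif_neg hle) hne
  · have h1 : ∑ e ∈ Finset.univ.filter (fun e : Face X k => ¬ z ≤ e.1),
        (if he : e.1 ≤ (linkFace z h' t).1 then
          (O.coeff (linkFace z h' t).1 e.1 : R) • S.res he (b e) else 0) ≠ 0 := by
      intro h1
      rw [h1, add_zero] at h0
      exact ht h0
    obtain ⟨e, he, hne⟩ := Finset.exists_ne_zero_of_sum_ne_zero h1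
    refine ⟨e, (Finset.mem_filter.1 he).2, ?_⟩
    by_cases hle : e.1 ≤ (linkFace z h' t).1
    · refine ⟨hle, fun hz => hne ?_⟩
      rw [dif_pos hle, hz, map_zero, smul_zero]
    · exact absurd (dif_neg hle) hne

theorem Face.link_val_eq (z : X) {j : ℤ} (hj : j = -1) (x : Face (Link z) j) : x.1.1 = z := by
  have h : dim x.1.1 - dim z - 1 = j := x.2
  exact (eq_of_le_of_dim_eq x.1.2 (by omega)).symm

/-- A link has no faces of dimension −2, so B^{-1} = 0 there. -/
theorem eq_zero_of_mem_coboundaries_link (z : X) {g : Cochain (S.link z) (-1)}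
    (hg : g ∈ coboundaries (O.link z) (S.link z) (-1)) : g = 0 := by
  obtain ⟨f, rfl⟩ := hg
  funext t
  rw [coboundary_apply]
  refine Finset.sum_eq_zero fun x _ => ?_
  have h1 : dim x.1.1 - dim z - 1 = -1 - 1 := x.2
  have h2 : dim z ≤ dim x.1.1 := dim_mono x.1.2
  omega

/-- The only (−1)-face of the link is z itself, so a 0-coboundary of the link is determined by one
section over z. This is what lets moves of the algorithm at z explore all of B⁰ of the link. -/
theorem exists_of_mem_coboundaries_link {i k : ℤ} (z : Face X i) (hk : k = 0 + dim z.1 + 1)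
    {g : Cochain (S.link z.1) 0} (hg : g ∈ coboundaries (O.link z.1) (S.link z.1) 0) :
    ∃ s : S.obj z.1, g = restrictLink z.1 hk (coboundary O S i k (Pi.single z s)) := by
  obtain ⟨f, rfl⟩ := hg
  let p : Face (Link z.1) (0 - 1) := ⟨⟨z.1, le_rfl⟩, show dim z.1 - dim z.1 - 1 = 0 - 1 by omega⟩
  refine ⟨f p, ?_⟩
  funext t
  have hp : ∀ x : Face (Link z.1) (0 - 1), x = p := fun x =>
    Subtype.ext (Subtype.ext (Face.link_val_eq z.1 (by norm_num) x))
  rw [coboundary_apply, Finset.sum_eq_single p (fun x _ hx => absurd (hp x) hx) (by simp)]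
  refine (dif_pos (show p.1 ≤ t.1 from t.1.2)).trans ?_
  have h1 : z.1 ≤ (linkFace z.1 hk t).1 := t.1.2
  rw [restrictLink, coboundary_single_apply, dif_pos h1]
  rfl

theorem mem_supp_restrictLink {z : X} {j k : ℤ} {h : k = j + dim z + 1} {b : Cochain S k}
    {x : Face (Link z) j} : x ∈ supp (restrictLink z h b) ↔ linkFace z h x ∈ supp b := by
  rw [mem_supp, mem_supp]
  exact Iff.rfl

end Links

/-! ### Sums of link weights and double counting -/

section LinkWeights

variable {X : Type u} [PartialOrder X] [OrderBot X] [Fintype X] [GradeOrder ℤ X] {d : ℕ} {w : X → ℝ}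

theorem IsProperWeight.link_sum_upper (hw : IsProperWeight d w) (hX : IsDPoset X d) {Λ : ℝ}
    (hΛ : IrregularityLE X d Λ) (z : X) {i j k : ℤ} (hi : dim z = i) (h : k = j + dim z + 1)
    (B : Finset (Face (Link z) j)) (C : Finset (Face X k)) (hBC : ∀ x ∈ B, linkFace z h x ∈ C) :
    Fmax X (-1) i k * w z * ∑ x ∈ B, linkWeight d w z x.1 ≤ Λ ^ 3 * ∑ y ∈ C, w y.1 := by
  have hΛ0 : 0 < Λ := zero_lt_one.trans_le hΛ.1
  calc Fmax X (-1) i k * w z * ∑ x ∈ B, linkWeight d w z x.1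
      ≤ ∑ x ∈ B, Λ ^ 3 * w (linkFace z h x).1 := by
        rw [Finset.mul_sum]
        exact Finset.sum_le_sum fun x _ =>
          hw.linkWeight_upper hX hΛ z x.1 hi (linkFace z h x).2
    _ = Λ ^ 3 * ∑ y ∈ B.image (linkFace z h), w y.1 := by
        rw [← Finset.mul_sum, Finset.sum_image fun a _ b _ e => linkFace_injective z h e]
    _ ≤ Λ ^ 3 * ∑ y ∈ C, w y.1 := by
        refine mul_le_mul_of_nonneg_left ?_ (by positivity)
        refine Finset.sum_le_sum_of_subset_of_nonneg ?_ fun x _ _ => (hw.pos x.1).le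
        exact Finset.image_subset_iff.2 hBC

theorem IsProperWeight.link_sum_lower (hw : IsProperWeight d w) (hX : IsDPoset X d) {Λ : ℝ}
    (hΛ : IrregularityLE X d Λ) (z : X) {i j k : ℤ} (hi : dim z = i) (h : k = j + dim z + 1)
    (B : Finset (Face (Link z) j)) (C : Finset (Face X k)) (hC : ∀ y ∈ C, z ≤ y.1)
    (hBC : ∀ x, linkFace z h x ∈ C → x ∈ B) :
    ∑ y ∈ C, w y.1 ≤ Λ ^ 2 * (Fmax X (-1) i k * w z * ∑ x ∈ B, linkWeight d w z x.1) := by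
  have hwz := hw.pos z
  calc ∑ y ∈ C, w y.1 ≤ ∑ y ∈ B.image (linkFace z h), w y.1 := by
        refine Finset.sum_le_sum_of_subset_of_nonneg ?_ fun x _ _ => (hw.pos x.1).le
        intro y hy
        obtain ⟨x, rfl⟩ := exists_linkFace_eq z h y (hC y hy)
        exact Finset.mem_image_of_mem _ (hBC x hy)
    _ = ∑ x ∈ B, w (linkFace z h x).1 :=
        Finset.sum_image fun a _ b _ e => linkFace_injective z h e
    _ ≤ ∑ x ∈ B, Λ ^ 2 * (Fmax X (-1) i k * w z * linkWeight d w z x.1) :=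
        Finset.sum_le_sum fun x _ => hw.linkWeight_lower hX hΛ z x.1 hi (linkFace z h x).2
    _ = _ := by rw [Finset.mul_sum, Finset.mul_sum]

/-- Each face t is counted once per i-face of A below it, hence at most F^max times. This turns
local estimates at vertices or edges into global ones. -/
theorem IsProperWeight.sum_sum_le (hw : IsProperWeight d w) (hX : IsDPoset X d) {i k : ℤ}
    (A : Finset (Face X i)) (T : Finset (Face X k)) :
    ∑ z ∈ A, ∑ t ∈ T.filter (fun t => z.1 ≤ t.1), w t.1 ≤ Fmax X (-1) i k * ∑ t ∈ T, w t.1 := by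
  rw [Finset.sum_comm' (t' := T) (s' := fun t => A.filter fun z => z.1 ≤ t.1)]
  · rw [Finset.mul_sum]
    refine Finset.sum_le_sum fun t _ => ?_
    rw [Finset.sum_const, nsmul_eq_mul]
    refine mul_le_mul_of_nonneg_right ?_ (hw.pos t.1).le
    have h1 : (A.filter fun z => z.1 ≤ t.1).card ≤ numBetween ⊥ t.1 i := by
      rw [← card_face_le]
      exact Finset.card_le_card (Finset.filter_subset_filter _ (Finset.subset_univ _))
    exact_mod_cast h1.trans (numBetween_le_Fmax bot_le hX.dim_bot t.2)
  · intro z t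
    simp only [Finset.mem_filter]
    tauto

end LinkWeights

/-! ### Skeleton expansion of the underlying hypergraph -/

section Hypergraphs

variable {X : Type u} [PartialOrder X] [Fintype X] [GradeOrder ℤ X] {w : X → ℝ}

theorem RelatedHypergraph.mem_edges₂ {V : Type u} {E : Type v} [Fintype E]
    {H : RelatedHypergraph V E} {A : Finset V} {e : E} : e ∈ H.edges₂ A ↔
      ∃ x ∈ A, ∃ y ∈ A, x ≠ y ∧ H.inc x e ∧ H.inc y e ∧ H.rel x y := by
  unfold RelatedHypergraph.edges₂
  exact ⟨fun h => (Finset.mem_filter.1 h).2, fun h => Finset.mem_filter.2 ⟨Finset.mem_univ _, h⟩⟩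

theorem mem_edges₂_ugr {A : Finset (Face X 0)} {t : Face X 1} :
    t ∈ (ugr w).edges₂ A ↔ ∃ x ∈ A, ∃ y ∈ A, x ≠ y ∧ x.1 ≤ t.1 ∧ y.1 ≤ t.1 := by
  rw [RelatedHypergraph.mem_edges₂]
  constructor
  · rintro ⟨x, hx, y, hy, hne, h1, h2, -⟩
    exact ⟨x, hx, y, hy, hne, h1, h2⟩
  · rintro ⟨x, hx, y, hy, hne, h1, h2⟩
    exact ⟨x, hx, y, hy, hne, h1, h2, hne, t, h1, h2⟩

theorem sum_edges₂_ugr_le {α β : ℝ} (h : (ugr w).IsSkeletonExpander α β) (A : Finset (Face X 0)) :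
    ∑ t ∈ (ugr w).edges₂ A, w t.1 ≤ α * (∑ x ∈ A, w x.1) + β * (∑ x ∈ A, w x.1) ^ 2 :=
  h A

end Hypergraphs

/-! ### Local expansion estimates at vertices and edges -/

section Expansion

variable {R : Type v} [CommRing R] {X : Type u} [PartialOrder X] [OrderBot X] [Fintype X]
  [GradeOrder ℤ X] {O : PosetOrientation R X} {S : PosetSheaf.{u, v, v'} R X} {d : ℕ} {w : X → ℝ}
  {Λ : ℝ}

theorem Fmax_pos (hX : IsDPoset X d) {i k : ℤ} (hi : -1 ≤ i) (hik : i ≤ k) (hk : k ≤ d) :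
    (0 : ℝ) < Fmax X (-1) i k := by
  exact_mod_cast (hX.Fmin_pos le_rfl hi hik hk).trans_le (hX.Fmin_le_Fmax le_rfl hi hik hk)

/-- Restricted to its own link, b is the single nonzero value b(z) on a face of weight 1, and B^{-1}
= 0, so its coboundary there has norm at least ε. Since db = 0, each face supporting that coboundary
also carries a support face other than z. Used for vertices (i = 0) and for edges (i = 1). -/
theorem IsProperWeight.mul_le_of_le_cbe_neg_one (hw : IsProperWeight d w) (hX : IsDPoset X d)
    (hΛ : IrregularityLE X d Λ) {i k : ℤ} (hk : k = i + 1) (z : Face X i) {b : Cochain S i}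
    (hb : coboundary O S i k b = 0) (hz : b z ≠ 0) {ε : ℝ} (hε : 0 ≤ ε)
    (h : ENNReal.ofReal ε ≤ cbe (O.link z.1) (linkWeight d w z.1) (S.link z.1) (-1))
    (T : Finset (Face X k))
    (hT : ∀ t : Face X k, z.1 ≤ t.1 → (∃ e : Face X i, e ≠ z ∧ e.1 ≤ t.1 ∧ b e ≠ 0) → t ∈ T) :
    Fmax X (-1) i k * w z.1 * ε ≤ Λ ^ 3 * ∑ t ∈ T.filter (fun t => z.1 ≤ t.1), w t.1 := by
  have hnn := hw.linkWeight_nonneg z.1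
  have hi : i = -1 + dim z.1 + 1 := by rw [z.2]; omega
  have hk' : k = -1 + 1 + dim z.1 + 1 := by rw [z.2]; omega
  have h1 := mul_wdist_le_of_le_cbe hnn h (restrictLink z.1 hi b)
  have h2 : 1 ≤ wdist (linkWeight d w z.1) (restrictLink z.1 hi b)
      (coboundaries (O.link z.1) (S.link z.1) (-1)) := by
    refine le_wdist fun g hg => ?_
    rw [eq_zero_of_mem_coboundaries_link z.1 hg, sub_zero]
    let p : Face (Link z.1) (-1) :=
      ⟨⟨z.1, le_rfl⟩, show dim z.1 - dim z.1 - 1 = -1 by omega⟩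
    rw [← hw.linkWeight_self hX z.1 p.1 rfl]
    exact Finset.single_le_sum (f := fun x : Face (Link z.1) (-1) => linkWeight d w z.1 x.1)
      (fun x _ => hnn x.1) (Finset.mem_filter.2 ⟨Finset.mem_univ p, hz⟩)
  have h3 : ε ≤ wnorm (linkWeight d w z.1)
      (coboundary (O.link z.1) (S.link z.1) (-1) (-1 + 1) (restrictLink z.1 hi b)) :=
    le_trans (by nlinarith) h1
  have hf : (0 : ℝ) ≤ Fmax X (-1) i k * w z.1 := mul_nonneg (Nat.cast_nonneg _) (hw.pos z.1).le
  refine (mul_le_mul_of_nonneg_left h3 hf).trans ?_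
  refine hw.link_sum_upper hX hΛ z.1 z.2 hk' _ _ fun x hx => ?_
  obtain ⟨-, e, he, het, hbe⟩ :=
    exists_of_coboundary_restrictLink_ne_zero z.1 hi hk' hb (Finset.mem_filter.1 hx).2
  exact Finset.mem_filter.2 ⟨hT _ x.1.2 ⟨e, by rintro rfl; exact he le_rfl, het, hbe⟩, x.1.2⟩

/-- Skeleton expansion bounds the norm of a nonzero `0`-cocycle from below. -/
theorem IsProperWeight.mul_wnorm_le_of_cocycle (hw : IsProperWeight d w) (hX : IsDPoset X d)
    (hd : 2 ≤ d) (hΛ : IrregularityLE X d Λ) {ε α β : ℝ} (hε : 0 ≤ ε)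
    (h1a : ∀ x : X, dim x = 0 →
      ENNReal.ofReal ε ≤ cbe (O.link x) (linkWeight d w x) (S.link x) (-1))
    (h2b : (ugr w).IsSkeletonExpander α β) {f : Cochain S 0} (hf : coboundary O S 0 1 f = 0) :
    ε * wnorm w f ≤ Λ ^ 3 * (α * wnorm w f + β * wnorm w f ^ 2) := by
  have hΛ0 : 0 < Λ := zero_lt_one.trans_le hΛ.1
  have hF := Fmax_pos hX (i := 0) (k := 1) (by norm_num) (by norm_num) (by omega)
  set T := (ugr w).edges₂ (supp f) with hT
  -- Over each support vertex lie many edges leading to another support vertex, and all of them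
  -- belong to E₂(supp f).
  have h1 : ∀ z ∈ supp f, (Fmax X (-1) 0 1 * w z.1 * ε : ℝ) ≤
      Λ ^ 3 * ∑ t ∈ T.filter (fun t => z.1 ≤ t.1), w t.1 := by
    intro z hz
    refine hw.mul_le_of_le_cbe_neg_one hX hΛ (by norm_num) z hf (mem_supp.1 hz) hε
      (h1a z.1 z.2) T ?_
    rintro t hzt ⟨e, he, het, hbe⟩
    exact mem_edges₂_ugr.2 ⟨e, mem_supp.2 hbe, z, hz, he, het, hzt⟩
  have h2 := Finset.sum_le_sum h1
  rw [← Finset.mul_sum, ← Finset.sum_mul, ← Finset.mul_sum, ← wnorm_eq_sum_supp] at h2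
  have h3 := hw.sum_sum_le hX (supp f) T
  have h4 : ∑ t ∈ T, w t.1 ≤ α * wnorm w f + β * wnorm w f ^ 2 :=
    sum_edges₂_ugr_le h2b (supp f)
  have h5 : (Fmax X (-1) 0 1 : ℝ) * (ε * wnorm w f) ≤
      Fmax X (-1) 0 1 * (Λ ^ 3 * (α * wnorm w f + β * wnorm w f ^ 2)) := by
    calc (Fmax X (-1) 0 1 : ℝ) * (ε * wnorm w f) = Fmax X (-1) 0 1 * wnorm w f * ε := by ring
      _ ≤ _ := h2
      _ ≤ Λ ^ 3 * (Fmax X (-1) 0 1 * ∑ t ∈ T, w t.1) := by gcongr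
      _ ≤ Λ ^ 3 * (Fmax X (-1) 0 1 * (α * wnorm w f + β * wnorm w f ^ 2)) := by gcongr
      _ = _ := by ring
  exact le_of_mul_le_mul_left h5 hF

/-- The norm of the restriction of a `1`-cochain to the link of a vertex. -/
noncomputable def linkNorm (d : ℕ) (w : X → ℝ) (b : Cochain S 1) (v : Face X 0) : ℝ :=
  wnorm (linkWeight d w v.1)
    (restrictLink v.1 (j := 0) (k := 1) (by have := v.2; omega) b : Cochain (S.link v.1) 0)

/-- The total weight of the edges at the vertex `v` in the support of `b`. -/
noncomputable def starWeight (w : X → ℝ) (b : Cochain S 1) (v : Face X 0) : ℝ :=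
  ∑ e ∈ (supp b).filter (fun e => v.1 ≤ e.1), w e.1

theorem IsProperWeight.linkNorm_nonneg (hw : IsProperWeight d w) (b : Cochain S 1) (v : Face X 0) :
    0 ≤ linkNorm d w b v :=
  wnorm_nonneg (hw.linkWeight_nonneg v.1) _

theorem IsProperWeight.linkNorm_le_starWeight (hw : IsProperWeight d w) (hX : IsDPoset X d)
    (hΛ : IrregularityLE X d Λ) (b : Cochain S 1) (v : Face X 0) :
    Fmax X (-1) 0 1 * w v.1 * linkNorm d w b v ≤ Λ ^ 3 * starWeight w b v :=
  hw.link_sum_upper hX hΛ v.1 v.2 _ _ _ fun x hx =>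
    Finset.mem_filter.2 ⟨mem_supp.2 (Finset.mem_filter.1 hx).2, x.1.2⟩

/-- The `2`-faces containing two different edges of the support of `b` which meet at `v`. -/
noncomputable def cornerFaces (b : Cochain S 1) (v : Face X 0) : Finset (Face X 2) :=
  Finset.univ.filter fun t => ∃ e ∈ supp b, ∃ e' ∈ supp b, e ≠ e' ∧ v.1 ≤ e.1 ∧ v.1 ≤ e'.1 ∧
    e.1 ≤ t.1 ∧ e'.1 ≤ t.1

/-- In the link of v the support edges at v become vertices and the corner faces become edges
joining two of them, so skeleton expansion of the link applies. Lightness of v makes the quadratic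
term linear. -/
theorem IsProperWeight.sum_cornerFaces_le (hw : IsProperWeight d w) (hX : IsDPoset X d)
    (hΛ : IrregularityLE X d Λ) (b : Cochain S 1) (v : Face X 0)
    {α β h₀ : ℝ} (hβ : 0 ≤ β) (hα : 0 ≤ α) (hh : 0 < h₀)
    (h2a : (ugr (linkWeight d w v.1)).IsSkeletonExpander α β) (hv : linkNorm d w b v ≤ h₀) :
    Fmax X (-1) 0 1 * ∑ t ∈ cornerFaces b v, w t.1 ≤
      Λ ^ 5 * Fmax X (-1) 0 2 * (α + β * h₀) * starWeight w b v := by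
  have hΛ0 : 0 < Λ := zero_lt_one.trans_le hΛ.1
  have hn := hw.linkNorm_nonneg b v
  have hwv := hw.pos v.1
  have e0 : (1 : ℤ) = 0 + dim v.1 + 1 := by rw [v.2]; norm_num
  have e1 : (2 : ℤ) = 1 + dim v.1 + 1 := by rw [v.2]; norm_num
  set A := supp (restrictLink v.1 e0 b : Cochain (S.link v.1) 0) with hA
  have h1 : ∑ t ∈ (ugr (linkWeight d w v.1)).edges₂ A, linkWeight d w v.1 t.1 ≤
      α * linkNorm d w b v + β * linkNorm d w b v ^ 2 :=
    sum_edges₂_ugr_le h2a A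
  have h2 : ∑ t ∈ cornerFaces b v, w t.1 ≤ Λ ^ 2 * (Fmax X (-1) 0 2 * w v.1 *
      ∑ t ∈ (ugr (linkWeight d w v.1)).edges₂ A, linkWeight d w v.1 t.1) := by
    refine hw.link_sum_lower hX hΛ v.1 v.2 e1 _ _ ?_ ?_
    · intro t ht
      obtain ⟨e, -, e', -, -, hv, -, he, -⟩ := (Finset.mem_filter.1 ht).2
      exact hv.trans he
    · intro t ht
      obtain ⟨e, he, e', he', hne, hve, hve', het, het'⟩ := (Finset.mem_filter.1 ht).2
      obtain ⟨x, rfl⟩ := exists_linkFace_eq v.1 e0 e hve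
      obtain ⟨x', rfl⟩ := exists_linkFace_eq v.1 e0 e' hve'
      have hxx : x ≠ x' := fun h => hne (by rw [h])
      exact mem_edges₂_ugr.2 ⟨x, mem_supp_restrictLink.2 he, x', mem_supp_restrictLink.2 he',
        hxx, het, het'⟩
  have h3 : α * linkNorm d w b v + β * linkNorm d w b v ^ 2 ≤ (α + β * h₀) * linkNorm d w b v := by
    nlinarith [mul_le_mul_of_nonneg_left hv (mul_nonneg hβ hn)]
  have h4 := hw.linkNorm_le_starWeight hX hΛ b v
  have hab : 0 ≤ α + β * h₀ := by positivity
  calc (Fmax X (-1) 0 1 : ℝ) * ∑ t ∈ cornerFaces b v, w t.1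
      ≤ Fmax X (-1) 0 1 * (Λ ^ 2 * (Fmax X (-1) 0 2 * w v.1 * ((α + β * h₀) * linkNorm d w b v))) :=
        mul_le_mul_of_nonneg_left (h2.trans (by gcongr; exact h1.trans h3)) (Nat.cast_nonneg _)
    _ = Λ ^ 2 * Fmax X (-1) 0 2 * (α + β * h₀) * (Fmax X (-1) 0 1 * w v.1 * linkNorm d w b v) := by
        ring
    _ ≤ Λ ^ 2 * Fmax X (-1) 0 2 * (α + β * h₀) * (Λ ^ 3 * starWeight w b v) := by gcongr
    _ = _ := by ring

/-- A vertex with a large link norm is surrounded by many `2`-faces on which the restriction of `b`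
to the link is not a cocycle. -/
theorem IsProperWeight.starWeight_le_of_locallyMinimal (hw : IsProperWeight d w)
    (hX : IsDPoset X d) (hd : 2 ≤ d)
    (hΛ : IrregularityLE X d Λ) {b : Cochain S 1} (hb : coboundary O S 1 2 b = 0) (v : Face X 0)
    {ε h₀ Q κ : ℝ} (hε : 0 ≤ ε) (hQ0 : 0 ≤ Q) (hQ : Λ ^ 3 * Q ≤ (1 - κ) * Fmax X (-1) 0 1)
    (h1c : ENNReal.ofReal ε ≤ cbe (O.link v.1) (linkWeight d w v.1) (S.link v.1) 0)
    (hmin : ∀ s : S.obj v.1, wnorm w b - Q * h₀ * w v.1 ≤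
      wnorm w (b + coboundary O S 0 1 (Pi.single v s)))
    (hv : h₀ ≤ linkNorm d w b v) (T : Finset (Face X 2))
    (hT : ∀ t : Face X 2, v.1 ≤ t.1 → (∃ e ∈ supp b, v.1 ≤ e.1 ∧ e.1 ≤ t.1) →
      (∃ e ∈ supp b, ¬ v.1 ≤ e.1 ∧ e.1 ≤ t.1) → t ∈ T) :
    Fmax X (-1) 0 2 * ε * κ * starWeight w b v ≤
      Λ ^ 5 * Fmax X (-1) 0 1 * ∑ t ∈ T.filter (fun t => v.1 ≤ t.1), w t.1 := by
  have hΛ0 : 0 < Λ := zero_lt_one.trans_le hΛ.1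
  have hnn := hw.linkWeight_nonneg v.1
  have hwv := hw.pos v.1
  have hF := Fmax_pos hX (i := 0) (k := 1) (by norm_num) (by norm_num) (by omega)
  have e0 : (1 : ℤ) = 0 + dim v.1 + 1 := by rw [v.2]; norm_num
  have e1 : (2 : ℤ) = 0 + 1 + dim v.1 + 1 := by rw [v.2]; norm_num
  set D := wdist (linkWeight d w v.1) (restrictLink v.1 e0 b)
      (coboundaries (O.link v.1) (S.link v.1) 0) with hD
  have h1 := mul_wdist_le_of_le_cbe hnn h1c (restrictLink v.1 e0 b)
  -- The 2-faces where the restricted b fails to be closed all contain a support edge through v and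
  -- one avoiding v, hence lie in T.
  have h2 : Fmax X (-1) 0 2 * w v.1 * wnorm (linkWeight d w v.1)
      (coboundary (O.link v.1) (S.link v.1) 0 (0 + 1) (restrictLink v.1 e0 b)) ≤
      Λ ^ 3 * ∑ t ∈ T.filter (fun t => v.1 ≤ t.1), w t.1 := by
    refine hw.link_sum_upper hX hΛ v.1 v.2 e1 _ _ fun x hx => ?_
    obtain ⟨⟨e, he, het, hbe⟩, e', he', het', hbe'⟩ :=
      exists_of_coboundary_restrictLink_ne_zero v.1 e0 e1 hb (Finset.mem_filter.1 hx).2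
    exact Finset.mem_filter.2 ⟨hT _ x.1.2 ⟨e, mem_supp.2 hbe, he, het⟩
      ⟨e', mem_supp.2 hbe', he', het'⟩, x.1.2⟩
  -- Local minimality bounds the distance to B⁰ of the link from below: subtracting any coboundary
  -- leaves at least the star weight minus the tolerance Q·h₀·w(v).
  have h3 : starWeight w b v - Q * h₀ * w v.1 ≤ Λ ^ 2 * (Fmax X (-1) 0 1 * w v.1 * D) := by
    have hpos : 0 < Λ ^ 2 * (Fmax X (-1) 0 1 * w v.1) := by positivity
    rw [← mul_assoc, ← div_le_iff₀' hpos]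
    refine le_wdist fun g hg => ?_
    obtain ⟨s, rfl⟩ := exists_of_mem_coboundaries_link v e0 hg
    rw [div_le_iff₀' hpos, mul_assoc (Λ ^ 2)]
    set c := b + coboundary O S 0 1 (Pi.single v (-s)) with hc
    have hcs : c = b - coboundary O S 0 1 (Pi.single v s) := by
      rw [hc, Pi.single_neg, map_neg, sub_eq_add_neg]
    have h4 : ∑ e ∈ (supp c).filter (fun e => v.1 ≤ e.1), w e.1 ≤
        Λ ^ 2 * (Fmax X (-1) 0 1 * w v.1 * wnorm (linkWeight d w v.1)
          (restrictLink v.1 e0 b - restrictLink v.1 e0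
            (coboundary O S 0 1 (Pi.single v s)))) := by
      refine hw.link_sum_lower hX hΛ v.1 v.2 e0 _ _ (fun y hy => (Finset.mem_filter.1 hy).2) ?_
      intro x hx
      have h5 := mem_supp.1 (Finset.mem_filter.1 hx).1
      rw [hcs] at h5
      exact Finset.mem_filter.2 ⟨Finset.mem_univ _, h5⟩
    refine le_trans ?_ h4
    have h6 := hmin (-s)
    rw [← hc, wnorm_eq_sum_supp, wnorm_eq_sum_supp,
      ← Finset.sum_filter_add_sum_filter_not (supp b) (fun e => v.1 ≤ e.1),
      ← Finset.sum_filter_add_sum_filter_not (supp c) (fun e => v.1 ≤ e.1)] at h6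
    -- A section supported at v changes b only on edges through v, so the rest of the norm cancels
    -- in the minimality inequality.
    have h7 : (supp c).filter (fun e => ¬ v.1 ≤ e.1) = (supp b).filter (fun e => ¬ v.1 ≤ e.1) := by
      ext e
      simp only [Finset.mem_filter, mem_supp]
      refine and_congr_left fun he => ?_
      rw [hc, Pi.add_apply, coboundary_single_apply, dif_neg he, add_zero]
    rw [h7] at h6
    unfold starWeight
    linarith
  have h4 := hw.linkNorm_le_starWeight hX hΛ b v
  -- Heaviness enters here: the tolerance is at most the fraction 1 − κ of the star weight, so the
  -- fraction κ survives.
  have h5 : κ * starWeight w b v ≤ Λ ^ 2 * (Fmax X (-1) 0 1 * w v.1 * D) := by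
    refine le_trans ?_ h3
    have h6 : (Fmax X (-1) 0 1 : ℝ) * (Q * h₀ * w v.1) ≤
        Fmax X (-1) 0 1 * ((1 - κ) * starWeight w b v) := by
      have hs : 0 ≤ starWeight w b v := Finset.sum_nonneg fun e _ => (hw.pos e.1).le
      calc (Fmax X (-1) 0 1 : ℝ) * (Q * h₀ * w v.1) = Q * (Fmax X (-1) 0 1 * w v.1 * h₀) := by ring
        _ ≤ Q * (Fmax X (-1) 0 1 * w v.1 * linkNorm d w b v) := by gcongr
        _ ≤ Q * (Λ ^ 3 * starWeight w b v) := by gcongr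
        _ = Λ ^ 3 * Q * starWeight w b v := by ring
        _ ≤ (1 - κ) * Fmax X (-1) 0 1 * starWeight w b v := by gcongr
        _ = _ := by ring
    have h7 := le_of_mul_le_mul_left h6 hF
    linarith
  calc Fmax X (-1) 0 2 * ε * κ * starWeight w b v
      = Fmax X (-1) 0 2 * ε * (κ * starWeight w b v) := by ring
    _ ≤ Fmax X (-1) 0 2 * ε * (Λ ^ 2 * (Fmax X (-1) 0 1 * w v.1 * D)) := by gcongr
    _ = Λ ^ 2 * Fmax X (-1) 0 1 * (Fmax X (-1) 0 2 * w v.1 * (ε * D)) := by ring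
    _ ≤ Λ ^ 2 * Fmax X (-1) 0 1 * (Λ ^ 3 * ∑ t ∈ T.filter (fun t => v.1 ≤ t.1), w t.1) := by
        refine mul_le_mul_of_nonneg_left (le_trans ?_ h2) (by positivity)
        exact mul_le_mul_of_nonneg_left h1 (by positivity)
    _ = _ := by ring

end Expansion

/-! ### Disjoint edges and the no-intersection hypergraph -/

section NoIntersection

variable {X : Type u} [PartialOrder X] [OrderBot X] [Fintype X] [GradeOrder ℤ X] {d : ℕ} {w : X → ℝ}

/-- A nonempty common lower bound of two distinct edges has dimension 0 or 1, and dimension 1 would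
make the edges equal. -/
theorem infs_eq_singleton_bot_or_exists (hb : dim (⊥ : X) = -1) {e e' : Face X 1} (hne : e ≠ e') :
    infs e.1 e'.1 = {⊥} ∨ ∃ u : Face X 0, u.1 ≤ e.1 ∧ u.1 ≤ e'.1 := by
  by_cases h : ∃ u : X, u ≠ ⊥ ∧ u ≤ e.1 ∧ u ≤ e'.1
  · obtain ⟨u, hu, h1, h2⟩ := h
    right
    have h3 : dim (⊥ : X) < dim u := grade_strictMono (bot_lt_iff_ne_bot.2 hu)
    have h4 := dim_mono h1
    have he := e.2
    have he' := e'.2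
    have h5 : dim u ≠ 1 := fun h5 => hne (Subtype.ext
      ((eq_of_le_of_dim_eq h1 (by omega)).symm.trans (eq_of_le_of_dim_eq h2 (by omega))))
    exact ⟨⟨u, by omega⟩, h1, h2⟩
  · left
    push Not at h
    have h' : ∀ u : X, u ≤ e.1 → u ≤ e'.1 → u = ⊥ := fun u h1 h2 => by
      by_contra hu
      exact h u hu h1 h2
    ext z
    rw [Set.mem_singleton_iff]
    constructor
    · intro hz
      have hz : Maximal (fun t => t ≤ e.1 ∧ t ≤ e'.1) z := hz
      exact h' z hz.prop.1 hz.prop.2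
    · rintro rfl
      exact ⟨⟨bot_le, bot_le⟩, fun y hy _ => (h' y hy.1 hy.2).le⟩

theorem sum_noIntersection_le (hw : ∀ x, 0 ≤ w x) {α β : ℝ}
    (h : (noIntersection w 1 1 2).IsSkeletonExpander α β) (A : Finset (Face X 1))
    (T : Finset (Face X 2)) (hT : ∀ t ∈ T, ∃ e ∈ A, ∃ e' ∈ A, e ≠ e' ∧ e.1 ≤ t.1 ∧ e'.1 ≤ t.1 ∧
      infs e.1 e'.1 = {⊥}) :
    ∑ t ∈ T, w t.1 ≤ α * (∑ e ∈ A, w e.1) + β * (∑ e ∈ A, w e.1) ^ 2 := by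
  -- For i = j = 1 the vertex type is a redundant disjunction and the vertex weight is w itself,
  -- without the factor 1/2.
  let φ : Face X 1 → {x : X // dim x = 1 ∨ dim x = 1} := fun e => ⟨e.1, Or.inl e.2⟩
  have hφ : Function.Injective φ := fun a b hab =>
    Subtype.ext (congrArg (fun t : {x : X // dim x = 1 ∨ dim x = 1} => t.1) hab)
  have h1 : ∑ t ∈ (noIntersection w 1 1 2).edges₂ (A.image φ), w t.1 ≤
      α * (∑ x ∈ A.image φ, (if (1 : ℤ) = 1 then w x.1 else w x.1 / 2)) +
        β * (∑ x ∈ A.image φ, (if (1 : ℤ) = 1 then w x.1 else w x.1 / 2)) ^ 2 := h (A.image φ)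
  have h2 : ∑ x ∈ A.image φ, (if (1 : ℤ) = 1 then w x.1 else w x.1 / 2) = ∑ e ∈ A, w e.1 := by
    rw [Finset.sum_image fun a _ b _ hab => hφ hab]
    simp [φ]
  rw [h2] at h1
  refine le_trans (Finset.sum_le_sum_of_subset_of_nonneg ?_ fun t _ _ => hw t.1) h1
  intro t ht
  obtain ⟨e, he, e', he', hne, het, het', hinf⟩ := hT t ht
  exact RelatedHypergraph.mem_edges₂.2 ⟨φ e, Finset.mem_image_of_mem _ he, φ e',
    Finset.mem_image_of_mem _ he', hφ.ne hne, het, het', ⟨t, het, het'⟩, hinf,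
    Or.inl ⟨e.2, e'.2⟩⟩

end NoIntersection

/-! ### Bad 2-faces and the vanishing of small locally minimal cocycles -/

section Expansion

variable {R : Type v} [CommRing R] {X : Type u} [PartialOrder X] [OrderBot X] [Fintype X]
  [GradeOrder ℤ X] {O : PosetOrientation R X} {S : PosetSheaf.{u, v, v'} R X} {d : ℕ} {w : X → ℝ}
  {Λ : ℝ}

/-- The vertices at which the restriction of `b` to the link has norm at least `h`. -/
noncomputable def heavyVertices (d : ℕ) (w : X → ℝ) (b : Cochain S 1) (h : ℝ) :
    Finset (Face X 0) :=
  Finset.univ.filter fun v => h ≤ linkNorm d w b v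

theorem mem_heavyVertices {b : Cochain S 1} {h : ℝ} {v : Face X 0} :
    v ∈ heavyVertices d w b h ↔ h ≤ linkNorm d w b v := by
  simp [heavyVertices]

/-- Markov's inequality for the link norms, whose weighted sum is controlled by ‖b‖ because an edge
has at most F(−1,0,1) vertices. -/
theorem IsProperWeight.mul_sum_heavyVertices_le (hw : IsProperWeight d w) (hX : IsDPoset X d)
    (hd : 2 ≤ d) (hΛ : IrregularityLE X d Λ) (b : Cochain S 1) (h : ℝ) :
    h * ∑ v ∈ heavyVertices d w b h, w v.1 ≤ Λ ^ 3 * wnorm w b := by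
  have hΛ0 : 0 < Λ := zero_lt_one.trans_le hΛ.1
  have hF := Fmax_pos hX (i := 0) (k := 1) (by norm_num) (by norm_num) (by omega)
  have h1 : ∀ v ∈ heavyVertices d w b h, Fmax X (-1) 0 1 * h * w v.1 ≤
      Λ ^ 3 * starWeight w b v := by
    intro v hv
    refine le_trans ?_ (hw.linkNorm_le_starWeight hX hΛ b v)
    have := mul_le_mul_of_nonneg_left (mem_heavyVertices.1 hv) (mul_pos hF (hw.pos v.1)).le
    linarith
  have h2 := Finset.sum_le_sum h1
  rw [← Finset.mul_sum, ← Finset.mul_sum] at h2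
  have h3 : ∑ v ∈ heavyVertices d w b h, starWeight w b v ≤ Fmax X (-1) 0 1 * wnorm w b :=
    hw.sum_sum_le hX _ _
  refine le_of_mul_le_mul_left (a := (Fmax X (-1) 0 1 : ℝ)) ?_ hF
  calc (Fmax X (-1) 0 1 : ℝ) * (h * ∑ v ∈ heavyVertices d w b h, w v.1)
      = Fmax X (-1) 0 1 * h * ∑ v ∈ heavyVertices d w b h, w v.1 := by ring
    _ ≤ _ := h2
    _ ≤ Λ ^ 3 * (Fmax X (-1) 0 1 * wnorm w b) := by gcongr
    _ = _ := by ring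

/-- The `2`-faces above an edge with two vertices in `H`. -/
noncomputable def facesAboveEdges (w : X → ℝ) (H : Finset (Face X 0)) : Finset (Face X 2) :=
  Finset.univ.filter fun t => ∃ e ∈ (ugr w).edges₂ H, e.1 ≤ t.1

/-- The `2`-faces containing two disjoint edges of the support of `b`. -/
noncomputable def disjointFaces (b : Cochain S 1) : Finset (Face X 2) :=
  Finset.univ.filter fun t => ∃ e ∈ supp b, ∃ e' ∈ supp b, e ≠ e' ∧ e.1 ≤ t.1 ∧ e'.1 ≤ t.1 ∧
      infs e.1 e'.1 = {⊥}

/-- The `2`-faces that witness that the support of a `1`-cochain fails to expand. -/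
noncomputable def badFaces (d : ℕ) (w : X → ℝ) (b : Cochain S 1) (h : ℝ) : Finset (Face X 2) :=
  ((Finset.univ.filter fun v => v ∉ heavyVertices d w b h).biUnion (cornerFaces b) ∪
    disjointFaces b) ∪ facesAboveEdges w (heavyVertices d w b h)

/-- Disjoint edges give the second kind of bad face and a light common vertex the first. If the
common vertex is heavy, the last hypothesis provides another heavy vertex on e, so t lies above an
edge joining two heavy vertices. -/
theorem mem_badFaces_of_le (hb : dim (⊥ : X) = -1) {b : Cochain S 1} {h : ℝ} {t : Face X 2}
    {e e' : Face X 1} (he : e ∈ supp b) (he' : e' ∈ supp b) (hne : e ≠ e') (het : e.1 ≤ t.1)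
    (het' : e'.1 ≤ t.1)
    (hu : ∀ u ∈ heavyVertices d w b h, u.1 ≤ e.1 → u.1 ≤ e'.1 →
      ∃ v ∈ heavyVertices d w b h, v ≠ u ∧ v.1 ≤ e.1) : t ∈ badFaces d w b h := by
  rcases infs_eq_singleton_bot_or_exists hb hne with h1 | ⟨u, h1, h2⟩
  · exact Finset.mem_union_left _ (Finset.mem_union_right _ (Finset.mem_filter.2
      ⟨Finset.mem_univ _, e, he, e', he', hne, het, het', h1⟩))
  · by_cases huH : u ∈ heavyVertices d w b h
    · obtain ⟨v, hv, hvu, hve⟩ := hu u huH h1 h2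
      exact Finset.mem_union_right _ (Finset.mem_filter.2 ⟨Finset.mem_univ _, e,
        mem_edges₂_ugr.2 ⟨v, hv, u, huH, hvu, hve, h1⟩, het⟩)
    · refine Finset.mem_union_left _ (Finset.mem_union_left _ (Finset.mem_biUnion.2 ⟨u,
        Finset.mem_filter.2 ⟨Finset.mem_univ _, huH⟩, Finset.mem_filter.2 ⟨Finset.mem_univ _,
        e, he, e', he', hne, h1, h2, het, het'⟩⟩))

theorem sum_union_le' {ι : Type*} [DecidableEq ι] {f : ι → ℝ} (hf : ∀ i, 0 ≤ f i) (s t : Finset ι) :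
    ∑ i ∈ s ∪ t, f i ≤ ∑ i ∈ s, f i + ∑ i ∈ t, f i := by
  rw [← Finset.sum_union_inter]
  exact le_add_of_nonneg_right (Finset.sum_nonneg fun i _ => hf i)

theorem sum_biUnion_le' {ι κ : Type*} [DecidableEq ι] {f : ι → ℝ} (hf : ∀ i, 0 ≤ f i) (s : Finset κ)
    (g : κ → Finset ι) : ∑ i ∈ s.biUnion g, f i ≤ ∑ k ∈ s, ∑ i ∈ g k, f i := by
  induction s using Finset.induction_on with
  | empty => simp
  | insert a s ha ih =>
    rw [Finset.biUnion_insert, Finset.sum_insert ha]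
    exact (sum_union_le' hf _ _).trans (add_le_add_right ih _)

/-- Each of the three kinds is bounded by the matching skeleton expansion. The smallness hypotheses
give ‖b‖ ≤ hp and, by the Markov bound, heavy weight at most hm, which linearises the quadratic
terms. -/
theorem IsProperWeight.sum_badFaces_le (hw : IsProperWeight d w) (hX : IsDPoset X d) (hd : 2 ≤ d)
    (hΛ : IrregularityLE X d Λ) (b : Cochain S 1) {M α₀ β₀ αm βm αp βp h₀ hm hp : ℝ}
    (hα₀ : 0 ≤ α₀) (hβ₀ : 0 ≤ β₀) (hαm : 0 ≤ αm) (hβm : 0 ≤ βm) (hαp : 0 ≤ αp) (hβp : 0 ≤ βp)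
    (hh₀ : 0 < h₀) (hM : 1 ≤ M) (hM₀ : (Fmax X (-1) 0 2 : ℝ) ≤ M) (hM₁ : (Fmax X (-1) 1 2 : ℝ) ≤ M)
    (h2a : ∀ x : X, dim x = 0 → (ugr (linkWeight d w x)).IsSkeletonExpander α₀ β₀)
    (h2b : (ugr w).IsSkeletonExpander αm βm)
    (h2c : (noIntersection w 1 1 2).IsSkeletonExpander αp βp)
    (hbm : Λ ^ 3 * wnorm w b ≤ h₀ * hm) (hbp : wnorm w b ≤ hp) (hhm : 0 ≤ hm) :
    ∑ t ∈ badFaces d w b h₀, w t.1 ≤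
      Λ ^ 5 * M * ((α₀ + β₀ * h₀) + (αp + βp * hp) + (αm + βm * hm) / h₀) * wnorm w b := by
  have hΛ1 := hΛ.1
  have hΛ0 : 0 < Λ := zero_lt_one.trans_le hΛ.1
  have hw0 : ∀ x, 0 ≤ w x := fun x => (hw.pos x).le
  have hF := Fmax_pos hX (i := 0) (k := 1) (by norm_num) (by norm_num) (by omega)
  have hA : 0 ≤ wnorm w b := wnorm_nonneg hw0 b
  set H := heavyVertices d w b h₀ with hH
  set L := Finset.univ.filter fun v => v ∉ H with hL
  have hhp : 0 ≤ hp := hA.trans hbp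
  -- corners at light vertices
  have c0 : ∑ t ∈ L.biUnion (cornerFaces b), w t.1 ≤ Λ ^ 5 * M * (α₀ + β₀ * h₀) * wnorm w b := by
    have g1 : (Fmax X (-1) 0 1 : ℝ) * ∑ v ∈ L, ∑ t ∈ cornerFaces b v, w t.1 ≤
        Λ ^ 5 * Fmax X (-1) 0 2 * (α₀ + β₀ * h₀) * ∑ v ∈ L, starWeight w b v := by
      rw [Finset.mul_sum, Finset.mul_sum]
      refine Finset.sum_le_sum fun v hv => ?_
      have hv' : v ∉ H := (Finset.mem_filter.1 hv).2
      rw [hH, mem_heavyVertices, not_le] at hv'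
      exact hw.sum_cornerFaces_le hX hΛ b v hβ₀ hα₀ hh₀ (h2a v.1 v.2) hv'.le
    have g2 : ∑ v ∈ L, starWeight w b v ≤ Fmax X (-1) 0 1 * wnorm w b := hw.sum_sum_le hX _ _
    have g3 : 0 ≤ ∑ v ∈ L, starWeight w b v :=
      Finset.sum_nonneg fun v _ => Finset.sum_nonneg fun e _ => hw0 e.1
    refine (sum_biUnion_le' (fun t : Face X 2 => hw0 t.1) L (cornerFaces b)).trans ?_
    refine le_of_mul_le_mul_left (a := (Fmax X (-1) 0 1 : ℝ)) ?_ hF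
    calc (Fmax X (-1) 0 1 : ℝ) * ∑ v ∈ L, ∑ t ∈ cornerFaces b v, w t.1 ≤ _ := g1
      _ ≤ Λ ^ 5 * M * (α₀ + β₀ * h₀) * (Fmax X (-1) 0 1 * wnorm w b) := by gcongr
      _ = _ := by ring
  have hΛ5 : 1 ≤ Λ ^ 5 := one_le_pow₀ hΛ1
  have c1 : ∑ t ∈ disjointFaces b, w t.1 ≤ Λ ^ 5 * M * (αp + βp * hp) * wnorm w b := by
    refine (sum_noIntersection_le hw0 h2c (supp b) _ fun t ht => (Finset.mem_filter.1 ht).2).trans ?_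
    rw [← wnorm_eq_sum_supp]
    have g1 : αp * wnorm w b + βp * wnorm w b ^ 2 ≤ (αp + βp * hp) * wnorm w b := by
      nlinarith [mul_le_mul_of_nonneg_left hbp (mul_nonneg hβp hA)]
    refine g1.trans ?_
    have g2 : 0 ≤ (αp + βp * hp) * wnorm w b := by positivity
    have g3 : 1 ≤ Λ ^ 5 * M := one_le_mul_of_one_le_of_one_le hΛ5 hM
    nlinarith [mul_le_mul_of_nonneg_right g3 g2]
  -- Skeleton expansion bounds the edges joining heavy vertices by a multiple of w(H); the Markov
  -- bound w(H) ≤ Λ³‖b‖/h₀ is the source of the division by h₀. Passing from edges to the 2-faces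
  -- above them costs Λ·F(−1,1,2).
  have c2 : ∑ t ∈ facesAboveEdges w H, w t.1 ≤
      Λ ^ 5 * M * ((αm + βm * hm) / h₀) * wnorm w b := by
    have g0 : h₀ * ∑ v ∈ H, w v.1 ≤ Λ ^ 3 * wnorm w b := hw.mul_sum_heavyVertices_le hX hd hΛ b h₀
    have g00 : 0 ≤ ∑ v ∈ H, w v.1 := Finset.sum_nonneg fun v _ => hw0 v.1
    have g1 : ∑ v ∈ H, w v.1 ≤ hm := le_of_mul_le_mul_left (g0.trans hbm) hh₀
    have g2 : ∑ e ∈ (ugr w).edges₂ H, w e.1 ≤ (αm + βm * hm) * ∑ v ∈ H, w v.1 := by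
      refine (sum_edges₂_ugr_le h2b H).trans ?_
      nlinarith [mul_le_mul_of_nonneg_left g1 (mul_nonneg hβm g00)]
    have g3 : ∑ v ∈ H, w v.1 ≤ Λ ^ 3 * wnorm w b / h₀ := by rwa [le_div_iff₀' hh₀]
    have g4 : facesAboveEdges w H ⊆ ((ugr w).edges₂ H).biUnion
        fun e => Finset.univ.filter fun t : Face X 2 => e.1 ≤ t.1 := by
      intro t ht
      obtain ⟨e, he, het⟩ := (Finset.mem_filter.1 ht).2
      exact Finset.mem_biUnion.2 ⟨e, he, by simpa using het⟩
    have g5 : ∑ t ∈ facesAboveEdges w H, w t.1 ≤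
        ∑ e ∈ (ugr w).edges₂ H, Λ * Fmax X (-1) 1 2 * w e.1 := by
      refine (Finset.sum_le_sum_of_subset_of_nonneg g4 fun t _ _ => hw0 t.1).trans ?_
      refine (sum_biUnion_le' (fun t : Face X 2 => hw0 t.1) _ _).trans ?_
      refine Finset.sum_le_sum fun e _ => ?_
      exact hw.sum_above_le hX hΛ e.1 (i := 1) e.2 (by norm_num) (by omega)
    rw [← Finset.mul_sum] at g5
    calc ∑ t ∈ facesAboveEdges w H, w t.1
        ≤ Λ * Fmax X (-1) 1 2 * ∑ e ∈ (ugr w).edges₂ H, w e.1 := g5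
      _ ≤ Λ * M * ((αm + βm * hm) * (Λ ^ 3 * wnorm w b / h₀)) := by
          refine mul_le_mul (by gcongr) (g2.trans (by gcongr)) ?_ (by positivity)
          exact Finset.sum_nonneg fun e _ => hw0 e.1
      _ = Λ ^ 4 * (M * ((αm + βm * hm) / h₀) * wnorm w b) := by ring
      _ ≤ Λ ^ 5 * (M * ((αm + βm * hm) / h₀) * wnorm w b) := by
          refine mul_le_mul_of_nonneg_right (pow_le_pow_right₀ hΛ1 (by norm_num)) (by positivity)
      _ = _ := by ring
  calc ∑ t ∈ badFaces d w b h₀, w t.1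
      ≤ (∑ t ∈ L.biUnion (cornerFaces b), w t.1 + ∑ t ∈ disjointFaces b, w t.1) +
          ∑ t ∈ facesAboveEdges w H, w t.1 :=
        (sum_union_le' (fun t : Face X 2 => hw0 t.1) _ _).trans
          (add_le_add_left (sum_union_le' (fun t : Face X 2 => hw0 t.1) _ _) _)
    _ ≤ _ := by linarith

/-- A small locally minimal `1`-cocycle vanishes. -/
theorem IsProperWeight.eq_zero_of_locallyMinimal (hw : IsProperWeight d w) (hX : IsDPoset X d)
    (hd : 2 ≤ d) (hΛ : IrregularityLE X d Λ) {b : Cochain S 1} (hb : coboundary O S 1 2 b = 0)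
    {M E' ε' α₀ β₀ αm βm αp βp h₀ hm hp Q κ : ℝ}
    (hα₀ : 0 ≤ α₀) (hβ₀ : 0 ≤ β₀) (hαm : 0 ≤ αm) (hβm : 0 ≤ βm) (hαp : 0 ≤ αp) (hβp : 0 ≤ βp)
    (hε' : 0 < ε') (hh₀ : 0 < h₀) (hhm : 0 ≤ hm)
    (hM : 1 ≤ M) (hM₀ : (Fmax X (-1) 0 2 : ℝ) ≤ M) (hM₁ : (Fmax X (-1) 1 2 : ℝ) ≤ M)
    (h1b : ∀ e : X, dim e = 1 →
      ENNReal.ofReal ε' ≤ cbe (O.link e) (linkWeight d w e) (S.link e) (-1))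
    (h1c : ∀ x : X, dim x = 0 →
      ENNReal.ofReal ε' ≤ cbe (O.link x) (linkWeight d w x) (S.link x) 0)
    (h2a : ∀ x : X, dim x = 0 → (ugr (linkWeight d w x)).IsSkeletonExpander α₀ β₀)
    (h2b : (ugr w).IsSkeletonExpander αm βm)
    (h2c : (noIntersection w 1 1 2).IsSkeletonExpander αp βp)
    (hineq : (α₀ + β₀ * h₀) + (αp + βp * hp) + (αm + βm * hm) / h₀ ≤ E' * ε')
    (hκ : 0 < κ) (hQ0 : 0 ≤ Q) (hQ : Λ ^ 3 * Q ≤ (1 - κ) * Fmax X (-1) 0 1)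
    (hE' : Λ ^ 10 * M * E' * (1 + Fmax X (-1) 0 1 / κ) < 1)
    (hbm : Λ ^ 3 * wnorm w b ≤ h₀ * hm) (hbp : wnorm w b ≤ hp)
    (hmin : ∀ (v : Face X 0) (s : S.obj v.1), wnorm w b - Q * h₀ * w v.1 ≤
      wnorm w (b + coboundary O S 0 1 (Pi.single v s))) : b = 0 := by
  have hΛ1 := hΛ.1
  have hΛ0 : 0 < Λ := zero_lt_one.trans_le hΛ.1
  have hw0 : ∀ x, 0 ≤ w x := fun x => (hw.pos x).le
  have hF01 := Fmax_pos hX (i := 0) (k := 1) (by norm_num) (by norm_num) (by omega)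
  have hF02 := Fmax_pos hX (i := 0) (k := 2) (by norm_num) (by norm_num) (by omega)
  have hF12 := Fmax_pos hX (i := 1) (k := 2) (by norm_num) (by norm_num) (by omega)
  have hA : 0 ≤ wnorm w b := wnorm_nonneg hw0 b
  set H := heavyVertices d w b h₀ with hH
  set T := badFaces d w b h₀ with hT
  set W := ∑ t ∈ T, w t.1 with hW
  have hWle : W ≤ Λ ^ 5 * M * (E' * ε') * wnorm w b := by
    refine (hw.sum_badFaces_le hX hd hΛ b hα₀ hβ₀ hαm hβm hαp hβp hh₀ hM hM₀ hM₁ h2a h2b h2c hbm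
      hbp hhm).trans ?_
    gcongr
  -- edges at heavy vertices
  have heavy : ε' * κ * ∑ v ∈ H, starWeight w b v ≤ Λ ^ 5 * Fmax X (-1) 0 1 * W := by
    have g1 : ∀ v ∈ H, Fmax X (-1) 0 2 * ε' * κ * starWeight w b v ≤
        Λ ^ 5 * Fmax X (-1) 0 1 * ∑ t ∈ T.filter (fun t => v.1 ≤ t.1), w t.1 := by
      intro v hv
      refine hw.starWeight_le_of_locallyMinimal hX hd hΛ hb v hε'.le hQ0 hQ (h1c v.1 v.2) (hmin v)
        (mem_heavyVertices.1 hv) T ?_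
      rintro t hvt ⟨e, he, hve, het⟩ ⟨e', he', hve', het'⟩
      -- A heavy common vertex u of e and e' differs from v, because v is not on e'; so e joins the
      -- two heavy vertices u and v.
      refine mem_badFaces_of_le hX.dim_bot he he' (by rintro rfl; exact hve' hve) het het' ?_
      intro u hu hue hue'
      exact ⟨v, hv, by rintro rfl; exact hve' hue', hve⟩
    have g2 := Finset.sum_le_sum g1
    rw [← Finset.mul_sum, ← Finset.mul_sum] at g2
    have g3 := hw.sum_sum_le hX H T
    refine le_of_mul_le_mul_left (a := (Fmax X (-1) 0 2 : ℝ)) ?_ hF02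
    calc (Fmax X (-1) 0 2 : ℝ) * (ε' * κ * ∑ v ∈ H, starWeight w b v)
        = Fmax X (-1) 0 2 * ε' * κ * ∑ v ∈ H, starWeight w b v := by ring
      _ ≤ _ := g2
      _ ≤ Λ ^ 5 * Fmax X (-1) 0 1 * (Fmax X (-1) 0 2 * W) := by gcongr
      _ = _ := by ring
  -- edges without heavy vertices
  set AL := (supp b).filter (fun e => ∀ v ∈ H, ¬ v.1 ≤ e.1) with hAL
  have light : ε' * ∑ e ∈ AL, w e.1 ≤ Λ ^ 3 * W := by
    have g1 : ∀ e ∈ AL, Fmax X (-1) 1 2 * w e.1 * ε' ≤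
        Λ ^ 3 * ∑ t ∈ T.filter (fun t => e.1 ≤ t.1), w t.1 := by
      intro e he
      obtain ⟨he, hlight⟩ := Finset.mem_filter.1 he
      refine hw.mul_le_of_le_cbe_neg_one hX hΛ (by norm_num) e hb (mem_supp.1 he) hε'.le
        (h1b e.1 e.2) T ?_
      rintro t het ⟨e', hne, het', hbe'⟩
      -- A heavy common vertex is impossible since e has none.
      exact mem_badFaces_of_le hX.dim_bot he (mem_supp.2 hbe') hne.symm het het'
        fun u hu hue _ => absurd hue (hlight u hu)
    have g2 := Finset.sum_le_sum g1
    rw [← Finset.mul_sum, ← Finset.sum_mul, ← Finset.mul_sum] at g2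
    have g3 := hw.sum_sum_le hX AL T
    refine le_of_mul_le_mul_left (a := (Fmax X (-1) 1 2 : ℝ)) ?_ hF12
    calc (Fmax X (-1) 1 2 : ℝ) * (ε' * ∑ e ∈ AL, w e.1)
        = Fmax X (-1) 1 2 * (∑ e ∈ AL, w e.1) * ε' := by ring
      _ ≤ _ := g2
      _ ≤ Λ ^ 3 * (Fmax X (-1) 1 2 * W) := by gcongr
      _ = _ := by ring
  have hsplit : wnorm w b ≤ ∑ v ∈ H, starWeight w b v + ∑ e ∈ AL, w e.1 := by
    have g1 : supp b ⊆ H.biUnion (fun v => (supp b).filter fun e => v.1 ≤ e.1) ∪ AL := by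
      intro e he
      by_cases h : ∃ v ∈ H, v.1 ≤ e.1
      · obtain ⟨v, hv, hve⟩ := h
        exact Finset.mem_union_left _
          (Finset.mem_biUnion.2 ⟨v, hv, Finset.mem_filter.2 ⟨he, hve⟩⟩)
      · push Not at h
        exact Finset.mem_union_right _ (Finset.mem_filter.2 ⟨he, h⟩)
    rw [wnorm_eq_sum_supp]
    refine (Finset.sum_le_sum_of_subset_of_nonneg g1 fun t _ _ => hw0 t.1).trans ?_
    refine (sum_union_le' (fun t : Face X 1 => hw0 t.1) _ _).trans (add_le_add_left ?_ _)
    exact sum_biUnion_le' (fun t : Face X 1 => hw0 t.1) _ _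
  have hW0 : 0 ≤ W := Finset.sum_nonneg fun t _ => hw0 t.1
  -- Combining the lower and upper estimates of W; ε' cancels and the remaining factor is the one
  -- assumed to be less than 1.
  have hfin : ε' * wnorm w b ≤
      ε' * (Λ ^ 10 * M * E' * (1 + Fmax X (-1) 0 1 / κ) * wnorm w b) := by
    have g1 : ε' * ∑ v ∈ H, starWeight w b v ≤ Λ ^ 5 * (Fmax X (-1) 0 1 / κ) * W := by
      rw [show Λ ^ 5 * ((Fmax X (-1) 0 1 : ℝ) / κ) * W = (Λ ^ 5 * Fmax X (-1) 0 1 * W) / κ by ring,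
        le_div_iff₀ hκ]
      linarith
    have g2 : Λ ^ 3 * W ≤ Λ ^ 5 * W :=
      mul_le_mul_of_nonneg_right (pow_le_pow_right₀ hΛ1 (by norm_num)) hW0
    calc ε' * wnorm w b ≤ ε' * (∑ v ∈ H, starWeight w b v + ∑ e ∈ AL, w e.1) := by gcongr
      _ ≤ Λ ^ 5 * (1 + Fmax X (-1) 0 1 / κ) * W := by linarith
      _ ≤ Λ ^ 5 * (1 + Fmax X (-1) 0 1 / κ) * (Λ ^ 5 * M * (E' * ε') * wnorm w b) := by gcongr
      _ = _ := by ring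
  have hlast := le_of_mul_le_mul_left hfin hε'
  refine eq_zero_of_wnorm_nonpos hw.pos ?_
  by_contra hpos
  push Not at hpos
  nlinarith

end Expansion

/-! ### The correction algorithm in degree 0 -/

section Correction

variable {R : Type v} [CommRing R] {X : Type u} [PartialOrder X] [Fintype X]
  [GradeOrder ℤ X] {O : PosetOrientation R X} {S : PosetSheaf.{u, v, v'} R X} {w : X → ℝ}

theorem extendByZero_eq_single (u : Face X 0) (g : Cochain (S.link u.1) (0 - dim u.1 - 1)) :
    extendByZero u.1 0 g =
      Pi.single u (g ⟨⟨u.1, le_rfl⟩, by show dim u.1 - dim u.1 - 1 = 0 - dim u.1 - 1; rw [u.2]⟩) := by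
  funext x
  by_cases h : u = x
  · subst h
    rw [Pi.single_eq_same]
    exact dif_pos le_rfl
  · rw [Pi.single_eq_of_ne (Ne.symm h)]
    refine dif_neg fun hle => h (Subtype.ext (eq_of_le_of_dim_eq hle ?_))
    rw [u.2, x.2]

/-- In degree 0 the face u must be a vertex, and a cochain of degree −1 on its link is one section
over u. -/
theorem correctionStep_zero_iff {q : ℝ} {f f' : Cochain S 0} :
    CorrectionStep O w S 0 q f f' ↔ ∃ (u : Face X 0) (s : S.obj u.1),
      wnorm w (coboundary O S 0 1 f + coboundary O S 0 1 (Pi.single u s)) <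
        wnorm w (coboundary O S 0 1 f) - q * w u.1 ∧ f' = f + Pi.single u s := by
  constructor
  · rintro ⟨u, h0, h1, g, hlt, rfl⟩
    rw [extendByZero_eq_single ⟨u, le_antisymm h1 h0⟩ g] at hlt
    exact ⟨⟨u, le_antisymm h1 h0⟩, _, hlt, by rw [extendByZero_eq_single ⟨u, le_antisymm h1 h0⟩ g]⟩
  · rintro ⟨u, s, hlt, rfl⟩
    let g : Cochain (S.link u.1) (0 - dim u.1 - 1) := fun x => S.res x.1.2 s
    have hg : extendByZero u.1 0 g = Pi.single u s := by
      rw [extendByZero_eq_single]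
      congr 1
      exact S.res_refl u.1 s
    refine ⟨u.1, u.2.ge, u.2.le, g, ?_, ?_⟩
    · rw [hg]
      exact hlt
    · rw [hg]

/-- A potential argument: a move at u pays more than q·w(u) out of ‖df‖ and moves f by at most w(u).
-/
theorem wnorm_coboundary_add_le_of_reflTransGen (hw : ∀ x, 0 ≤ w x) {q : ℝ} (hq : 0 ≤ q)
    {f f' : Cochain S 0} (h : Relation.ReflTransGen (CorrectionStep O w S 0 q) f f') :
    wnorm w (coboundary O S 0 1 f') + q * wnorm w (f - f') ≤ wnorm w (coboundary O S 0 1 f) := by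
  induction h with
  | refl => rw [sub_self, wnorm_zero, mul_zero, add_zero]
  | @tail g g' _ hstep ih =>
    obtain ⟨u, s, hlt, rfl⟩ := correctionStep_zero_iff.1 hstep
    rw [map_add]
    have h1 : wnorm w (-Pi.single u s : Cochain S 0) ≤ w u.1 := by
      rw [wnorm_neg]
      refine (wnorm_le_sum hw (A := {u}) fun x hx => ?_).trans (by simp)
      rw [Finset.mem_singleton]
      by_contra hne
      exact hx (by simp [Pi.single_eq_of_ne hne])
    have h2 : wnorm w (f - (g + Pi.single u s)) ≤ wnorm w (f - g) + w u.1 := by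
      have h3 := wnorm_add_le hw (f - g) (-Pi.single u s)
      rw [show f - (g + Pi.single u s) = (f - g) + -Pi.single u s by abel]
      linarith
    have h3 := mul_le_mul_of_nonneg_left h2 hq
    linarith

/-- The norm ‖df‖ strictly decreases and is the weight of one of finitely many sets of edges. -/
theorem correctionHalts (hw : ∀ x, 0 ≤ w x) {q : ℝ} (hq : 0 ≤ q) (f : Cochain S 0) :
    CorrectionHalts O w S 0 q f := by
  let r : Finset (Face X 1) → Finset (Face X 1) → Prop := fun s t =>
    ∑ x ∈ s, w x.1 < ∑ x ∈ t, w x.1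
  have hr : WellFounded r := by
    have : IsTrans _ r := ⟨fun _ _ _ h1 h2 => lt_trans h1 h2⟩
    have : Std.Irrefl r := ⟨fun _ => lt_irrefl _⟩
    exact Finite.wellFounded_of_trans_of_irrefl r
  have hlt : ∀ f f' : Cochain S 0, CorrectionStep O w S 0 q f f' →
      r (supp (coboundary O S 0 1 f')) (supp (coboundary O S 0 1 f)) := by
    intro f f' hstep
    obtain ⟨u, s, hlt, rfl⟩ := correctionStep_zero_iff.1 hstep
    rw [← map_add, wnorm_eq_sum_supp, wnorm_eq_sum_supp] at hlt
    exact hlt.trans_le (sub_le_self _ (mul_nonneg hq (hw u.1)))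
  exact Subrelation.accessible (fun {f' f} h => hlt f f' h)
    ((InvImage.wf (fun f : Cochain S 0 => supp (coboundary O S 0 1 f)) hr).apply f)

theorem exists_correctionReturns {q : ℝ} {f : Cochain S 0} (h : CorrectionHalts O w S 0 q f) :
    ∃ f', CorrectionReturns O w S 0 q f f' := by
  induction h with
  | intro f _ ih =>
    by_cases hex : ∃ f', CorrectionStep O w S 0 q f f'
    · obtain ⟨f', hf'⟩ := hex
      obtain ⟨f'', h1, h2⟩ := ih f' hf'
      exact ⟨f'', Relation.ReflTransGen.head hf' h1, h2⟩
    · push Not at hex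
      exact ⟨f, Relation.ReflTransGen.refl, hex⟩

end Correction

/-! ### The criterion for admissible constants -/

/-- The inequalities between the constants, the lower irregularity `Λ`, the maximal number `N` of
vertices of an edge and the maximal number `M` of vertices or edges of a `2`-face that the proof of
the expansion criterion needs. -/
structure Constants.Admissible (c : Constants) (Λ N M κ : ℝ) : Prop where
  -- κ is the fraction of the star weight at a heavy vertex that local minimality protects: a larger
  -- κ relaxes the condition on E' and tightens those on E'' and D'.
  κ_pos : 0 < κ
  E''_pos : 0 < c.E''
  E'''_le_one : c.E''' ≤ 1
  D'_pos : 0 < c.D'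
  D''_pos : 0 < c.D''
  E_le : c.E * Λ ^ 3 ≤ 1
  E'_lt : Λ ^ 10 * M * c.E' * (1 + N / κ) < 1
  E''_le : Λ ^ 3 * c.E'' ≤ (1 - κ) * N
  D'_le : Λ ^ 3 * c.D' ≤ (1 - κ) * N
  E''_le_one : c.E'' * Λ ^ 3 ≤ 1
  D_le : c.D * N * Λ ^ 4 ≤ 1
  D''_le : c.D'' * N * Λ ≤ c.D'

section Criterion

variable {R : Type v} [CommRing R] {X : Type u} [PartialOrder X] [OrderBot X] [Fintype X]
  [GradeOrder ℤ X] {O : PosetOrientation R X} {S : PosetSheaf.{u, v, v'} R X} {d : ℕ} {w : X → ℝ}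
  {Λ : ℝ}

/-- The support of df consists of edges containing a support vertex of f. -/
theorem IsProperWeight.wnorm_coboundary_le (hw : IsProperWeight d w) (hX : IsDPoset X d)
    (hd : 2 ≤ d) (hΛ : IrregularityLE X d Λ) (f : Cochain S 0) :
    wnorm w (coboundary O S 0 1 f) ≤ Λ * Fmax X (-1) 0 1 * wnorm w f := by
  have hw0 : ∀ x, 0 ≤ w x := fun x => (hw.pos x).le
  refine (wnorm_le_sum hw0 (A := (supp f).biUnion
    fun v => Finset.univ.filter fun e : Face X 1 => v.1 ≤ e.1) fun e he => ?_).trans ?_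
  · rw [coboundary_apply] at he
    obtain ⟨v, -, hv⟩ := Finset.exists_ne_zero_of_sum_ne_zero he
    have hve : v.1 ≤ e.1 := by
      by_contra h
      exact hv (dif_neg h)
    refine Finset.mem_biUnion.2 ⟨v, mem_supp.2 fun h0 => hv ?_, by simpa using hve⟩
    rw [dif_pos hve, h0, map_zero, smul_zero]
  · refine (sum_biUnion_le' (fun t : Face X 1 => hw0 t.1) _ _).trans ?_
    rw [wnorm_eq_sum_supp, Finset.mul_sum]
    refine Finset.sum_le_sum fun v _ => ?_
    exact hw.sum_above_le hX hΛ v.1 (i := 0) v.2 (by norm_num) (by omega)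

/-- The criterion for `0`-cosystolic expansion, with constants subject only to the inequalities
that the proof needs. -/
theorem IsProperWeight.expansion_of_admissible (hw : IsProperWeight d w) (hX : IsDPoset X d)
    (hd : 2 ≤ d) (hΛ : IrregularityLE X d Λ) (c : Constants) {M κ : ℝ}
    (hc : c.Admissible Λ (Fmax X (-1) 0 1) M κ)
    (hM : 1 ≤ M) (hM₀ : (Fmax X (-1) 0 2 : ℝ) ≤ M) (hM₁ : (Fmax X (-1) 1 2 : ℝ) ≤ M)
    {ε ε' α₀ β₀ αm βm αp βp h₀ hm hp : ℝ} (hε : 0 < ε) (hε' : 0 < ε')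
    (hα₀ : 0 ≤ α₀) (hβ₀ : 0 ≤ β₀) (hαm : 0 ≤ αm) (hβm : 0 ≤ βm) (hαp : 0 ≤ αp) (hβp : 0 ≤ βp)
    (h1a : ∀ x : X, dim x = 0 →
      ENNReal.ofReal ε ≤ cbe (O.link x) (linkWeight d w x) (S.link x) (-1))
    (h1b : ∀ e : X, dim e = 1 →
      ENNReal.ofReal ε' ≤ cbe (O.link e) (linkWeight d w e) (S.link e) (-1))
    (h1c : ∀ x : X, dim x = 0 →
      ENNReal.ofReal ε' ≤ cbe (O.link x) (linkWeight d w x) (S.link x) 0)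
    (h2a : ∀ x : X, dim x = 0 → (ugr (linkWeight d w x)).IsSkeletonExpander α₀ β₀)
    (h2b : (ugr w).IsSkeletonExpander αm βm)
    (h2c : (noIntersection w 1 1 2).IsSkeletonExpander αp βp)
    (hαε : αm < c.E * ε)
    (hh₀ : 0 < h₀) (hhm : 0 < hm) (hhm1 : hm ≤ 1) (hhp : 0 < hp)
    (hineq : (α₀ + β₀ * h₀) + (αp + βp * hp) + (αm + βm * hm) / h₀ ≤ c.E' * ε') :
    ENNReal.ofReal (c.E'' / (h₀⁻¹ * hm⁻¹ + hp⁻¹)) ≤ cse O w S 0 ∧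
    ENNReal.ofReal (c.E''' * (c.E * ε - αm)) / ENNReal.ofReal βm ≤ ccd O w S 0 ∧
    ∀ f : Cochain S 0,
      wdist w f (cocycles O S 0) < c.D / (h₀⁻¹ * hm⁻¹ + hp⁻¹) →
      CorrectionHalts O w S 0 (c.D' * h₀) f ∧
      ∀ f' : Cochain S 0, CorrectionReturns O w S 0 (c.D' * h₀) f f' →
        f' ∈ cocycles O S 0 ∧
        wnorm w (f - f') ≤ 1 / (c.D'' * h₀) * wdist w f (cocycles O S 0) := by
  have hΛ1 := hΛ.1
  have hΛ0 : 0 < Λ := zero_lt_one.trans_le hΛ.1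
  have hw0 : ∀ x, 0 ≤ w x := fun x => (hw.pos x).le
  have hF := Fmax_pos hX (i := 0) (k := 1) (by norm_num) (by norm_num) (by omega)
  have mem_cocycles : ∀ f : Cochain S 0, f ∈ cocycles O S 0 ↔ coboundary O S 0 1 f = 0 :=
    fun f => LinearMap.mem_ker
  set K := h₀⁻¹ * hm⁻¹ + hp⁻¹ with hK
  have hK0 : 0 < K := by positivity
  -- The threshold 1/K lies below both smallness bounds required by `eq_zero_of_locallyMinimal`.
  have hK1 : 1 / K ≤ h₀ * hm := by
    rw [div_le_iff₀ hK0, hK, mul_add, mul_mul_mul_comm, mul_inv_cancel₀ hh₀.ne',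
      mul_inv_cancel₀ hhm.ne', one_mul]
    have : 0 ≤ h₀ * hm * hp⁻¹ := by positivity
    linarith
  have hK2 : 1 / K ≤ hp := by
    rw [div_le_iff₀ hK0, hK, mul_add, mul_inv_cancel₀ hhp.ne']
    have : 0 ≤ hp * (h₀⁻¹ * hm⁻¹) := by positivity
    linarith
  have hK3 : 1 / K ≤ h₀ := hK1.trans (mul_le_of_le_one_right hh₀.le hhm1)
  -- The tolerance is left free: Q = E'' serves for cosystolic expansion, Q = D' for the algorithm
  -- in the statement.
  have run : ∀ {Q : ℝ}, 0 < Q → Λ ^ 3 * Q ≤ (1 - κ) * Fmax X (-1) 0 1 → ∀ {f f' : Cochain S 0},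
      Λ ^ 3 * wnorm w (coboundary O S 0 1 f) ≤ 1 / K →
      CorrectionReturns O w S 0 (Q * h₀) f f' →
      f' ∈ cocycles O S 0 ∧ Q * h₀ * wnorm w (f - f') ≤ wnorm w (coboundary O S 0 1 f) := by
    intro Q hQ0 hQ f f' hsmall hret
    have hq : 0 ≤ Q * h₀ := by positivity
    have h1 := wnorm_coboundary_add_le_of_reflTransGen hw0 hq hret.1
    have h2 := mul_nonneg hq (wnorm_nonneg hw0 (f - f'))
    have h3 := wnorm_nonneg hw0 (coboundary O S 0 1 f')
    have h4 : wnorm w (coboundary O S 0 1 f') ≤ wnorm w (coboundary O S 0 1 f) := by linarith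
    have h5 : Λ ^ 3 * wnorm w (coboundary O S 0 1 f') ≤ 1 / K :=
      (mul_le_mul_of_nonneg_left h4 (by positivity)).trans hsmall
    refine ⟨?_, by linarith⟩
    rw [mem_cocycles]
    refine hw.eq_zero_of_locallyMinimal hX hd hΛ (coboundary_coboundary (by norm_num) (by norm_num) f')
      hα₀ hβ₀ hαm hβm hαp hβp hε' hh₀ hhm.le hM hM₀ hM₁ h1b h1c h2a h2b h2c hineq hc.κ_pos hQ0.le
      hQ hc.E'_lt (h5.trans hK1) ?_ ?_
    · exact (le_mul_of_one_le_left h3 (one_le_pow₀ hΛ1)).trans (h5.trans hK2)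
    · intro v s
      by_contra hlt
      push Not at hlt
      exact hret.2 _ (correctionStep_zero_iff.2 ⟨v, s, hlt, rfl⟩)
  refine ⟨?_, ?_, ?_⟩
  · have hE'' := hc.E''_pos
    refine ofReal_le_cse (by positivity) fun f => ?_
    change c.E'' / K * wdist w f (cocycles O S 0) ≤ wnorm w (coboundary O S 0 1 f)
    have hd0 := wdist_nonneg hw0 f (cocycles O S 0)
    by_cases hsmall : Λ ^ 3 * wnorm w (coboundary O S 0 1 f) ≤ 1 / K
    · obtain ⟨f', hf'⟩ := exists_correctionReturns
        (correctionHalts (O := O) hw0 (mul_nonneg hE''.le hh₀.le) f)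
      obtain ⟨h1, h2⟩ := run hE'' hc.E''_le hsmall hf'
      refine le_trans ?_ h2
      have h3 := wdist_le hw0 f h1
      calc c.E'' / K * wdist w f (cocycles O S 0)
          = c.E'' * (1 / K) * wdist w f (cocycles O S 0) := by ring
        _ ≤ c.E'' * h₀ * wnorm w (f - f') := by gcongr
    -- For large ‖df‖ the trivial bound dist(f, Z⁰) ≤ w(X(0)) = 1 suffices.
    · push Not at hsmall
      have h1 : wdist w f (cocycles O S 0) ≤ 1 := by
        refine (wdist_le hw0 f (Submodule.zero_mem _)).trans ?_
        rw [sub_zero]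
        refine (wnorm_le_sum hw0 (A := Finset.univ) fun _ _ => Finset.mem_univ _).trans ?_
        exact (hw.sum_face hX (by norm_num) (by omega)).le
      refine le_of_mul_le_mul_left (a := Λ ^ 3) (le_trans ?_ hsmall.le) (by positivity)
      calc Λ ^ 3 * (c.E'' / K * wdist w f (cocycles O S 0))
          = c.E'' * Λ ^ 3 * (1 / K * wdist w f (cocycles O S 0)) := by ring
        _ ≤ 1 * (1 / K * 1) := by
            have := hc.E''_le_one
            gcongr
        _ = 1 / K := by ring
  · refine le_iInf₂ fun f hf => ?_
    obtain ⟨hf1, hf2⟩ := hf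
    have hne : f ≠ 0 := fun h => hf2 (h ▸ Submodule.zero_mem _)
    have hpos : 0 < wnorm w f := by
      by_contra h
      push Not at h
      exact hne (eq_zero_of_wnorm_nonpos hw.pos h)
    have h1 := hw.mul_wnorm_le_of_cocycle hX hd hΛ hε.le h1a h2b ((mem_cocycles f).1 hf1)
    have h2 : ε ≤ Λ ^ 3 * (αm + βm * wnorm w f) := by
      refine le_of_mul_le_mul_right (h1.trans_eq ?_) hpos
      ring
    have h3 : c.E * ε ≤ αm + βm * wnorm w f := by
      refine le_of_mul_le_mul_left (a := Λ ^ 3) (le_trans ?_ h2) (by positivity)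
      have := mul_le_mul_of_nonneg_right hc.E_le hε.le
      linarith
    -- With βm = 0 the previous inequality would contradict αm < E·ε, so no nonzero cocycle exists
    -- and the infimum is ∞.
    have hβ : 0 < βm := by
      rcases hβm.eq_or_lt with h | h
      · rw [← h] at h3
        linarith
      · exact h
    rw [← ENNReal.ofReal_div_of_pos hβ]
    refine ENNReal.ofReal_le_ofReal ?_
    rw [div_le_iff₀ hβ]
    have h4 := mul_le_mul_of_nonneg_right hc.E'''_le_one (sub_nonneg.2 hαε.le)
    linarith
  · intro f hf
    refine ⟨correctionHalts hw0 (mul_nonneg hc.D'_pos.le hh₀.le) f, fun f' hret => ?_⟩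
    -- Subtracting a cocycle g does not change df, so the norm of d is controlled by the distance to
    -- Z⁰.
    have hdist : wnorm w (coboundary O S 0 1 f) ≤
        Λ * Fmax X (-1) 0 1 * wdist w f (cocycles O S 0) := by
      rw [← div_le_iff₀' (by positivity)]
      refine le_wdist fun g hg => ?_
      rw [div_le_iff₀' (by positivity)]
      have h1 := hw.wnorm_coboundary_le hX hd hΛ (O := O) (f - g)
      rwa [map_sub, (mem_cocycles g).1 hg, sub_zero] at h1
    have hsmall : Λ ^ 3 * wnorm w (coboundary O S 0 1 f) ≤ 1 / K := by
      calc Λ ^ 3 * wnorm w (coboundary O S 0 1 f)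
          ≤ Λ ^ 3 * (Λ * Fmax X (-1) 0 1 * (c.D / K)) := by
            gcongr
            exact hdist.trans (by gcongr)
        _ = c.D * Fmax X (-1) 0 1 * Λ ^ 4 * (1 / K) := by ring
        _ ≤ 1 * (1 / K) := by
            have := hc.D_le
            gcongr
        _ = 1 / K := one_mul _
    obtain ⟨h1, h2⟩ := run hc.D'_pos hc.D'_le hsmall hret
    refine ⟨h1, ?_⟩
    have hD'' := hc.D''_pos
    have hD' := hc.D'_pos
    have hd0 := wdist_nonneg hw0 f (cocycles O S 0)
    rw [one_div_mul_eq_div, le_div_iff₀ (by positivity)]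
    refine le_of_mul_le_mul_left (a := Λ * Fmax X (-1) 0 1) ?_ (by positivity)
    calc Λ * Fmax X (-1) 0 1 * (wnorm w (f - f') * (c.D'' * h₀))
        = c.D'' * Fmax X (-1) 0 1 * Λ * (h₀ * wnorm w (f - f')) := by ring
      _ ≤ c.D' * (h₀ * wnorm w (f - f')) := by
          have h3 := wnorm_nonneg hw0 (f - f')
          have := hc.D''_le
          gcongr
      _ = c.D' * h₀ * wnorm w (f - f') := by ring
      _ ≤ _ := h2.trans hdist

end Criterion

/-! ### Combinatorics of the cube -/

section Cube

variable {n : ℕ}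

theorem mem_fullCoords {s : Fin n → {s : Finset Bool // s.Nonempty}} {k : Fin n} :
    k ∈ fullCoords s ↔ (s k).1 = Finset.univ := by
  rw [fullCoords, Finset.mem_filter, and_iff_right (Finset.mem_univ k)]

/-- The smallest face above `s` that contains the directions in `U`. -/
noncomputable def fillCoords (s : Fin n → {s : Finset Bool // s.Nonempty}) (U : Finset (Fin n)) :
    Fin n → {s : Finset Bool // s.Nonempty} :=
  fun k => if k ∈ U then ⟨Finset.univ, Finset.univ_nonempty⟩ else s k

theorem le_fillCoords (s : Fin n → {s : Finset Bool // s.Nonempty}) (U : Finset (Fin n)) :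
    s ≤ fillCoords s U := by
  intro k
  unfold fillCoords
  split_ifs
  · exact Finset.subset_univ _
  · exact le_rfl

theorem fullCoords_fillCoords (s : Fin n → {s : Finset Bool // s.Nonempty}) (U : Finset (Fin n)) :
    fullCoords (fillCoords s U) = fullCoords s ∪ U := by
  ext k
  rw [Finset.mem_union, mem_fullCoords, mem_fullCoords]
  by_cases h : k ∈ U <;> simp [fillCoords, h]

theorem fullCoords_mono {s t : Fin n → {s : Finset Bool // s.Nonempty}} (h : s ≤ t) :
    fullCoords s ⊆ fullCoords t := by
  intro k hk
  rw [mem_fullCoords] at hk ⊢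
  have h1 : (s k).1 ⊆ (t k).1 := h k
  rw [hk] at h1
  exact Finset.univ_subset_iff.1 h1

/-- A coordinate of t that is not the whole interval is a single endpoint, hence already equals that
of s. So the faces above a nonempty face are determined by their full coordinates. -/
theorem eq_fillCoords {s t : Fin n → {s : Finset Bool // s.Nonempty}} (h : s ≤ t) :
    t = fillCoords s (fullCoords t) := by
  have key : ∀ a b : Finset Bool, a.Nonempty → a ⊆ b → b ≠ Finset.univ → b = a := by decide
  funext k
  unfold fillCoords
  split_ifs with hk
  · exact Subtype.ext (mem_fullCoords.1 hk)
  · rw [mem_fullCoords] at hk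
    exact Subtype.ext (key _ _ (s k).2 (h k) hk)

/-- Shrinking one full coordinate to an endpoint strictly lowers the face, so g drops by at least 1
each time and stays nonnegative above ⊥. -/
theorem card_le_of_strictMono {g : CubeFaces n → ℤ} (hg : StrictMono g) (hbot : g ⊥ = -1) (m : ℕ) :
    ∀ s : Fin n → {s : Finset Bool // s.Nonempty}, (fullCoords s).card = m → (m : ℤ) ≤ g s := by
  induction m with
  | zero =>
    intro s _
    have h := hg (WithBot.bot_lt_coe s)
    push_cast
    omega
  | succ m ih =>
    intro s hs
    obtain ⟨k, hk⟩ := Finset.card_pos.1 (by omega : 0 < (fullCoords s).card)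
    set t : Fin n → {s : Finset Bool // s.Nonempty} :=
      Function.update s k ⟨{true}, Finset.singleton_nonempty _⟩ with ht
    have hne : ({true} : Finset Bool) ≠ Finset.univ := by decide
    have hle : t ≤ s := by
      intro i
      by_cases hi : i = k
      · subst hi
        show (t i).1 ⊆ (s i).1
        rw [mem_fullCoords.1 hk]
        exact Finset.subset_univ _
      · rw [ht, Function.update_of_ne hi]
    have hfull : fullCoords t = (fullCoords s).erase k := by
      ext i
      rw [Finset.mem_erase, mem_fullCoords, mem_fullCoords]
      by_cases hi : i = k
      · subst hi
        rw [ht, Function.update_self]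
        exact iff_of_false hne fun h => h.1 rfl
      · rw [ht, Function.update_of_ne hi]
        simp [hi]
    have hlt : t < s := lt_of_le_of_ne hle fun h => by
      rw [← h, hfull] at hk
      exact (Finset.notMem_erase k _) hk
    have h1 := ih t (by rw [hfull, Finset.card_erase_of_mem hk]; omega)
    have h2 := hg (WithBot.coe_lt_coe.2 hlt)
    push_cast
    omega

/-- The lower bound is `card_le_of_strictMono`. For the upper bound, filling the remaining
coordinates one by one raises g by at least 1 each time, and g never exceeds n. -/
theorem eq_cubeDim_of_strictMono {g : CubeFaces n → ℤ} (hg : StrictMono g) (hbot : g ⊥ = -1)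
    (htop : ∀ c, g c ≤ n) (c : CubeFaces n) : g c = cubeDim c := by
  have upper : ∀ (m : ℕ) (s : Fin n → {s : Finset Bool // s.Nonempty}),
      (fullCoords s)ᶜ.card = m → g s + m ≤ n := by
    intro m
    induction m with
    | zero =>
      intro s _
      have := htop s
      push_cast
      omega
    | succ m ih =>
      intro s hs
      obtain ⟨k, hk⟩ := Finset.card_pos.1 (by omega : 0 < (fullCoords s)ᶜ.card)
      have hfull := fullCoords_fillCoords s {k}
      have hc : (fullCoords (fillCoords s {k}))ᶜ = (fullCoords s)ᶜ.erase k := by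
        rw [hfull]
        ext i
        simp
      have hlt : s < fillCoords s {k} := lt_of_le_of_ne (le_fillCoords _ _) fun h => by
        rw [← h] at hfull
        rw [Finset.mem_compl, hfull] at hk
        simp at hk
      have h1 := ih _ (by rw [hc, Finset.card_erase_of_mem hk]; omega)
      have h2 := hg (WithBot.coe_lt_coe.2 hlt)
      push_cast
      omega
  induction c using WithBot.recBotCoe with
  | bot => exact hbot
  | coe s =>
    have h1 := card_le_of_strictMono hg hbot _ s rfl
    have h2 := upper _ s rfl
    have h3 : (fullCoords s).card + (fullCoords s)ᶜ.card = n := by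
      rw [Finset.card_add_card_compl, Fintype.card_fin]
    show g s = ((fullCoords s).card : ℤ)
    omega

end Cube

/-! ### Lower regularity of simplicial and cube complexes -/

section Boolean

variable {X : Type u} [PartialOrder X] [Fintype X] [GradeOrder ℤ X]

/-- The number of faces of a given dimension in an interval that is a Boolean lattice. -/
theorem numBetween_eq_choose {V : Type*} {x z : X} (hxz : x ≤ z) {j : ℤ} (hj : dim x ≤ j)
    (φ : X → Finset V) (c : ℤ)
    (hsub : ∀ y, x ≤ y → y ≤ z → φ x ⊆ φ y ∧ φ y ⊆ φ z)
    (hcard : ∀ y, x ≤ y → y ≤ z → ((φ y).card : ℤ) = dim y + c)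
    (hinj : ∀ y y', x ≤ y → y ≤ z → x ≤ y' → y' ≤ z → φ y = φ y' → y = y')
    (hsurj : ∀ U, φ x ⊆ U → U ⊆ φ z → ∃ y, x ≤ y ∧ y ≤ z ∧ φ y = U) :
    numBetween x z j = (dim z - dim x).toNat.choose (j - dim x).toNat := by
  have hx := hcard x le_rfl hxz
  have hz := hcard z hxz le_rfl
  have h1 : (φ z \ φ x).card = (dim z - dim x).toNat := by
    rw [Finset.card_sdiff_of_subset (hsub z hxz le_rfl).1]
    omega
  rw [← h1, ← Finset.card_powersetCard]
  refine Finset.card_bij (fun y _ => φ y \ φ x) ?_ ?_ ?_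
  · intro y hy
    obtain ⟨hd, hxy, hyz⟩ := (Finset.mem_filter.1 hy).2
    have h2 := hsub y hxy hyz
    have h3 := hcard y hxy hyz
    refine Finset.mem_powersetCard.2 ⟨Finset.sdiff_subset_sdiff h2.2 le_rfl, ?_⟩
    rw [Finset.card_sdiff_of_subset h2.1]
    omega
  · intro y hy y' hy' h
    obtain ⟨-, hxy, hyz⟩ := (Finset.mem_filter.1 hy).2
    obtain ⟨-, hxy', hyz'⟩ := (Finset.mem_filter.1 hy').2
    refine hinj y y' hxy hyz hxy' hyz' ?_
    rw [← Finset.union_sdiff_of_subset (hsub y hxy hyz).1,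
      ← Finset.union_sdiff_of_subset (hsub y' hxy' hyz').1, h]
  · intro U hU
    obtain ⟨hU1, hU2⟩ := Finset.mem_powersetCard.1 hU
    have hdisj : Disjoint U (φ x) := Finset.disjoint_of_subset_left hU1 Finset.sdiff_disjoint
    obtain ⟨y, hxy, hyz, hy⟩ := hsurj (φ x ∪ U) Finset.subset_union_left
      (Finset.union_subset (hsub z hxz le_rfl).1 (hU1.trans Finset.sdiff_subset))
    have h3 := hcard y hxy hyz
    rw [hy, Finset.card_union_of_disjoint hdisj.symm] at h3
    refine ⟨y, Finset.mem_filter.2 ⟨Finset.mem_univ _, ?_, hxy, hyz⟩, ?_⟩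
    · push_cast at h3
      omega
    · rw [hy, Finset.union_sdiff_cancel_left hdisj.symm]

theorem IsSimplicialComplex.numBetween_eq (h : IsSimplicialComplex X) {x z : X} (hxz : x ≤ z) {j : ℤ}
    (hj : dim x ≤ j) : numBetween x z j = (dim z - dim x).toNat.choose (j - dim x).toNat := by
  obtain ⟨V, Δ, φ, hΔ, hdim⟩ := h
  have hmono : ∀ {a b : X}, a ≤ b → (φ a : Finset V) ⊆ φ b := fun hab => φ.monotone hab
  refine numBetween_eq_choose hxz hj (fun y => (φ y : Finset V)) 1
    (fun y hxy hyz => ⟨hmono hxy, hmono hyz⟩) (fun y _ _ => ?_) ?_ ?_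
  · rw [hdim y]
    omega
  · intro y y' _ _ _ _ h
    exact φ.injective (Subtype.ext h)
  · intro U hxU hUz
    refine ⟨φ.symm ⟨U, hΔ hUz (φ z).2⟩, ?_, ?_, by simp⟩
    · rw [φ.le_symm_apply]
      exact hxU
    · rw [φ.symm_apply_le]
      exact hUz

variable [OrderBot X]

/-- The order isomorphism in `IsCubeComplex` is not assumed to respect dimensions; rigidity of
gradings of the cube forces it. -/
theorem exists_cubeDim_eq (hb : dim (⊥ : X) = -1) (h : IsCubeComplex X) {z : X} {n : ℕ}
    (hz : dim z = n) : ∃ ψ : Set.Iic z ≃o CubeFaces n, ∀ y : Set.Iic z, dim y.1 = cubeDim (ψ y) := by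
  obtain ⟨ψ⟩ := h n z hz
  refine ⟨ψ, fun y => ?_⟩
  have hg : StrictMono fun c => dim (ψ.symm c).1 := fun a b hab =>
    grade_strictMono (show (ψ.symm a).1 < (ψ.symm b).1 from ψ.symm.strictMono hab)
  have h1 := eq_cubeDim_of_strictMono hg ?_ ?_ (ψ y)
  · rw [← h1]
    simp
  · show dim (ψ.symm ⊥).1 = -1
    rw [map_bot, ← hb]
    rfl
  · intro c
    rw [← hz]
    exact dim_mono (ψ.symm c).2

theorem IsCubeComplex.numBetween_bot_eq (hb : dim (⊥ : X) = -1) (h : IsCubeComplex X) {z : X} {n : ℕ}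
    (hz : dim z = n) (j : ℤ) : numBetween ⊥ z j = cubeCount n j := by
  obtain ⟨ψ, hψ⟩ := exists_cubeDim_eq hb h hz
  unfold numBetween cubeCount
  refine Finset.card_bij (fun y hy => ψ ⟨y, (Finset.mem_filter.1 hy).2.2.2⟩) ?_ ?_ ?_
  · intro y hy
    have h1 := (Finset.mem_filter.1 hy).2
    exact Finset.mem_filter.2 ⟨Finset.mem_univ _, by rw [← hψ]; exact h1.1⟩
  · intro y hy y' hy' e
    exact congrArg Subtype.val (ψ.injective e)
  · intro c hc
    refine ⟨(ψ.symm c).1, Finset.mem_filter.2 ⟨Finset.mem_univ _, ?_, bot_le, (ψ.symm c).2⟩, ?_⟩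
    · rw [hψ, ψ.apply_symm_apply]
      exact (Finset.mem_filter.1 hc).2
    · exact ψ.apply_symm_apply c

/-- Above a nonempty face x the interval is Boolean: its faces correspond to sets of full
coordinates containing those of x. For x = ⊥ this fails, and `cubeCount` is used instead. -/
theorem IsCubeComplex.numBetween_eq (hb : dim (⊥ : X) = -1) (h : IsCubeComplex X) {x z : X}
    (hx : x ≠ ⊥) (hxz : x ≤ z) {j : ℤ} (hj : dim x ≤ j) :
    numBetween x z j = (dim z - dim x).toNat.choose (j - dim x).toNat := by
  have h0 : dim (⊥ : X) < dim x := grade_strictMono (bot_lt_iff_ne_bot.2 hx)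
  have h1 := dim_mono hxz
  obtain ⟨n, hn⟩ := Int.eq_ofNat_of_zero_le (a := dim z) (by omega)
  obtain ⟨ψ, hψ⟩ := exists_cubeDim_eq hb h hn
  have hcoe : ∀ y (hxy : x ≤ y) (hyz : y ≤ z),
      ∃ s : Fin n → {s : Finset Bool // s.Nonempty}, ψ ⟨y, hyz⟩ = s := by
    intro y hxy hyz
    have : ψ ⟨y, hyz⟩ ≠ ⊥ := by
      intro e
      rw [map_eq_bot_iff] at e
      have : y = ⊥ := congrArg Subtype.val e
      exact hx (le_bot_iff.1 (this ▸ hxy))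
    obtain ⟨s, hs⟩ := WithBot.ne_bot_iff_exists.1 this
    exact ⟨s, hs.symm⟩
  let F : CubeFaces n → Finset (Fin n) := WithBot.recBotCoe ∅ fullCoords
  let φ : X → Finset (Fin n) := fun y => if hy : y ≤ z then F (ψ ⟨y, hy⟩) else ∅
  have hφ : ∀ y (hyz : y ≤ z) (s : Fin n → {s : Finset Bool // s.Nonempty}), ψ ⟨y, hyz⟩ = s →
      φ y = fullCoords s := by
    intro y hyz s hs
    show (if hy : y ≤ z then F (ψ ⟨y, hy⟩) else ∅) = _
    rw [dif_pos hyz, hs]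
    rfl
  have hle : ∀ y y' (hyz : y ≤ z) (hyz' : y' ≤ z) (s s' : Fin n → {s : Finset Bool // s.Nonempty}),
      ψ ⟨y, hyz⟩ = s → ψ ⟨y', hyz'⟩ = s' → y ≤ y' → s ≤ s' := by
    intro y y' hyz hyz' s s' hs hs' hyy
    rw [← WithBot.coe_le_coe, ← hs, ← hs']
    exact ψ.monotone hyy
  obtain ⟨sx, hsx⟩ := hcoe x le_rfl hxz
  obtain ⟨sz, hsz⟩ := hcoe z hxz le_rfl
  refine numBetween_eq_choose hxz hj φ 0 ?_ ?_ ?_ ?_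
  · intro y hxy hyz
    obtain ⟨s, hs⟩ := hcoe y hxy hyz
    rw [hφ x hxz sx hsx, hφ y hyz s hs, hφ z le_rfl sz hsz]
    exact ⟨fullCoords_mono (hle _ _ _ _ _ _ hsx hs hxy),
      fullCoords_mono (hle _ _ _ _ _ _ hs hsz hyz)⟩
  · intro y hxy hyz
    obtain ⟨s, hs⟩ := hcoe y hxy hyz
    rw [hφ y hyz s hs, add_zero, hψ ⟨y, hyz⟩, hs]
    rfl
  · intro y y' hxy hyz hxy' hyz' e
    obtain ⟨s, hs⟩ := hcoe y hxy hyz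
    obtain ⟨s', hs'⟩ := hcoe y' hxy' hyz'
    rw [hφ y hyz s hs, hφ y' hyz' s' hs'] at e
    have h2 : s = s' := by
      rw [eq_fillCoords (hle _ _ _ _ _ _ hsx hs hxy), e,
        ← eq_fillCoords (hle _ _ _ _ _ _ hsx hs' hxy')]
    rw [h2, ← hs'] at hs
    exact congrArg Subtype.val (ψ.injective hs)
  · intro U hxU hUz
    rw [hφ x hxz sx hsx] at hxU
    set y := ψ.symm (fillCoords sx U : Fin n → {s : Finset Bool // s.Nonempty}) with hy
    have hψy : ψ ⟨y.1, y.2⟩ = (fillCoords sx U : Fin n → {s : Finset Bool // s.Nonempty}) :=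
      ψ.apply_symm_apply _
    refine ⟨y.1, ?_, y.2, ?_⟩
    · have h2 : (⟨x, hxz⟩ : Set.Iic z) ≤ y := by
        rw [hy, ψ.le_symm_apply, hsx]
        exact WithBot.coe_le_coe.2 (le_fillCoords sx U)
      exact h2
    · rw [hφ y.1 y.2 _ hψy, fullCoords_fillCoords, Finset.union_eq_right.2 hxU]

theorem IsSimplicialComplex.isLowerRegular (h : IsSimplicialComplex X) : IsLowerRegular X :=
  isLowerRegular_of_numBetween_eq (N := fun i j k => (k - i).toNat.choose (j - i).toNat)
    fun _ _ _ hxz hj _ => h.numBetween_eq hxz hj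

theorem IsCubeComplex.isLowerRegular (hb : dim (⊥ : X) = -1) (h : IsCubeComplex X) :
    IsLowerRegular X := by
  refine isLowerRegular_of_numBetween_eq (N := fun i j k =>
    if i = -1 then if k = -1 then 1 else cubeCount k.toNat j
    else (k - i).toNat.choose (j - i).toNat) fun x z j hxz hj hjz => ?_
  by_cases hx : x = ⊥
  · subst hx
    have hz := dim_mono hxz
    rw [if_pos hb]
    split_ifs with hk
    · rw [show j = dim (⊥ : X) by omega]
      exact numBetween_self_left hxz
    · exact h.numBetween_bot_eq hb (by omega) j
  · have h0 : dim (⊥ : X) < dim x := grade_strictMono (bot_lt_iff_ne_bot.2 hx)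
    rw [if_neg (by omega)]
    exact h.numBetween_eq hb hx hxz hj

end Boolean

/-! ### Vertex and edge counts in low dimension -/

section Counts

variable {X : Type u} [PartialOrder X] [OrderBot X] [Fintype X] [GradeOrder ℤ X] {d : ℕ}

theorem Fmax_neg_one_le (hb : dim (⊥ : X) = -1) {j k : ℤ} {N : ℕ}
    (h : ∀ z : X, dim z = k → numBetween ⊥ z j ≤ N) : Fmax X (-1) j k ≤ N :=
  Fmax_le fun x z hx hz _ => by
    rw [← eq_of_le_of_dim_eq bot_le (hb.trans hx.symm)]
    exact h z hz

theorem IsDPoset.Fmax_zero_one_eq (hX : IsDPoset X d) (hd : 2 ≤ d) {N : ℕ}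
    (h : ∀ e : X, dim e = 1 → numBetween ⊥ e 0 = N) : Fmax X (-1) 0 1 = N := by
  refine le_antisymm (Fmax_neg_one_le hX.dim_bot fun z hz => (h z hz).le) ?_
  obtain ⟨z, hz, -⟩ := hX.pure ⊥
  obtain ⟨e, -, -, he⟩ := exists_between (bot_le : ⊥ ≤ z) (j := 1) (by rw [hX.dim_bot]; omega)
    (by omega)
  rw [← h e he]
  exact numBetween_le_Fmax bot_le hX.dim_bot he

/-- Purity and d ≥ 2 put each edge inside a 2-face, which contains its vertices. -/
theorem IsDPoset.Fmax_zero_one_le (hX : IsDPoset X d) (hd : 2 ≤ d) :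
    Fmax X (-1) 0 1 ≤ Fmax X (-1) 0 2 := by
  refine Fmax_neg_one_le hX.dim_bot fun e he => ?_
  obtain ⟨z, hz, hez⟩ := hX.pure e
  obtain ⟨t, het, -, ht⟩ := exists_between hez (j := 2) (by omega) (by omega)
  refine le_trans (Finset.card_le_card fun y hy => ?_) (numBetween_le_Fmax bot_le hX.dim_bot ht)
  obtain ⟨-, h1, h2, h3⟩ := Finset.mem_filter.1 hy
  exact Finset.mem_filter.2 ⟨Finset.mem_univ _, h1, h2, h3.trans het⟩

theorem IsGonComplex.numBetween_le {m : ℕ} (h : IsGonComplex X m) {z : X} (hz : dim z = 2) :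
    numBetween ⊥ z 0 ≤ m ∧ numBetween ⊥ z 1 ≤ m := by
  obtain ⟨hm, h⟩ := h
  have : NeZero m := ⟨by omega⟩
  obtain ⟨p, e, -, -, hp, he, -⟩ := h z hz
  have key : ∀ (f : ZMod m → X) (j : ℤ), (∀ y : X, (dim y = j ∧ y ≤ z) ↔ y ∈ Set.range f) →
      numBetween ⊥ z j ≤ m := by
    intro f j hf
    calc numBetween ⊥ z j ≤ (Finset.univ.image f).card := by
          refine Finset.card_le_card fun y hy => ?_
          obtain ⟨-, h1, -, h3⟩ := Finset.mem_filter.1 hy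
          obtain ⟨i, hi⟩ := (hf y).1 ⟨h1, h3⟩
          exact Finset.mem_image.2 ⟨i, Finset.mem_univ _, hi⟩
      _ ≤ (Finset.univ : Finset (ZMod m)).card := Finset.card_image_le
      _ = m := by rw [Finset.card_univ, ZMod.card]
  exact ⟨key p 0 hp, key e 1 he⟩

/-- The edge lies in some m-gon and has the vertices i and i + 1 there, which differ because m ≥ 2.
-/
theorem IsGonComplex.numBetween_edge {m : ℕ} (hX : IsDPoset X d) (hd : 2 ≤ d)
    (h : IsGonComplex X m) {e : X} (he : dim e = 1) : numBetween ⊥ e 0 = 2 := by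
  obtain ⟨hm, h⟩ := h
  have : Fact (1 < m) := ⟨by omega⟩
  obtain ⟨z, hz, hez⟩ := hX.pure e
  obtain ⟨t, het, -, ht⟩ := exists_between hez (j := 2) (by omega) (by omega)
  obtain ⟨p, q, hpi, -, hp, hq, hpq⟩ := h t ht
  obtain ⟨i, rfl⟩ := (hq e).1 ⟨he, het⟩
  have hset : (Finset.univ.filter fun y : X => dim y = 0 ∧ ⊥ ≤ y ∧ y ≤ q i) = {p i, p (i + 1)} := by
    ext y
    simp only [Finset.mem_filter, Finset.mem_univ, true_and, bot_le, Finset.mem_insert,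
      Finset.mem_singleton]
    constructor
    · rintro ⟨h1, h2⟩
      obtain ⟨k, rfl⟩ := (hp y).1 ⟨h1, h2.trans het⟩
      rcases (hpq k i).1 h2 with rfl | rfl
      · exact Or.inl rfl
      · right
        rfl
    · rintro (rfl | rfl)
      · exact ⟨((hp _).2 ⟨i, rfl⟩).1, (hpq _ _).2 (Or.inl rfl)⟩
      · exact ⟨((hp _).2 ⟨i + 1, rfl⟩).1, (hpq _ _).2 (Or.inr rfl)⟩
  rw [numBetween, hset, Finset.card_pair]
  intro hi
  have := hpi hi
  simp at this

end Counts

/-! ### Checking the listed constants -/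

section Constants

/-- With κ = 1/2 and M = F the main condition reduces to F(1 + 2N) ≤ 3F² < 4F²; the powers of L and
the surplus powers of F leave room. -/
theorem generalConstants_admissible {F : ℕ} {L N : ℝ} (hF : 1 ≤ F) (hL : 1 ≤ L) (hN : 1 ≤ N)
    (hNF : N ≤ F) : (generalConstants F L).Admissible L N F (1 / 2) := by
  obtain ⟨G, hG⟩ : ∃ G : ℝ, G = F := ⟨_, rfl⟩
  have hG1 : 1 ≤ G := by rw [hG]; exact_mod_cast hF
  have hL0 : 0 < L := by linarith
  have hG0 : 0 < G := by linarith
  have hN0 : 0 < N := by linarith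
  have hLp : ∀ {m n : ℕ}, m ≤ n → L ^ m ≤ L ^ n := fun h => pow_le_pow_right₀ hL h
  have hGp : ∀ {m n : ℕ}, m ≤ n → G ^ m ≤ G ^ n := fun h => pow_le_pow_right₀ hG1 h
  have hNG2 : 1 ≤ N * G ^ 2 := one_le_mul_of_one_le_of_one_le hN (one_le_pow₀ hG1)
  rw [← hG] at hNF ⊢
  constructor <;> (try simp only [generalConstants]) <;> try rw [← hG]
  · norm_num
  · positivity
  · rw [div_le_one (by positivity)]
    exact one_le_pow₀ hL
  · positivity
  · positivity
  · rw [one_div_mul_eq_div, div_le_one (by positivity)]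
    exact hLp (by norm_num)
  · rw [mul_one_div, div_mul_eq_mul_div, div_lt_one (by positivity)]
    calc L ^ 10 * G * (1 + N / (1 / 2)) = L ^ 10 * (G * (1 + 2 * N)) := by ring
      _ ≤ L ^ 10 * (G * (G + 2 * G)) := by gcongr
      _ = 3 * (L ^ 10 * G ^ 2) := by ring
      _ < 4 * (L ^ 10 * G ^ 2) := by
          have : 0 < L ^ 10 * G ^ 2 := by positivity
          linarith
      _ ≤ 4 * (L ^ 18 * G ^ 5) := by
          gcongr 4 * (?_ * ?_)
          · exact hLp (by norm_num)
          · exact hGp (by norm_num)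
      _ = 4 * L ^ 18 * G ^ 5 := by ring
  · rw [mul_one_div, div_le_iff₀ (by positivity)]
    calc L ^ 3 ≤ L ^ 13 * 1 := by rw [mul_one]; exact hLp (by norm_num)
      _ ≤ L ^ 13 * (N * G ^ 2) := by gcongr
      _ = _ := by ring
  · rw [mul_one_div, div_le_iff₀ (by positivity)]
    calc L ^ 3 ≤ L ^ 12 * 1 := by rw [mul_one]; exact hLp (by norm_num)
      _ ≤ L ^ 12 * (2 * (N * G ^ 2)) := by gcongr; linarith
      _ = _ := by ring
  · rw [one_div_mul_eq_div, div_le_one (by positivity)]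
    calc L ^ 3 ≤ L ^ 13 * 1 := by rw [mul_one]; exact hLp (by norm_num)
      _ ≤ L ^ 13 * (2 * G ^ 2) := by
          gcongr
          have := one_le_pow₀ hG1 (n := 2)
          linarith
      _ = _ := by ring
  · rw [one_div_mul_eq_div, div_mul_eq_mul_div, div_le_one (by positivity), mul_comm]
    gcongr
    norm_num
  · rw [one_div_mul_eq_div, div_mul_eq_mul_div, div_le_div_iff₀ (by positivity) (by positivity)]
    calc N * L * (4 * L ^ 12 * G ^ 2) = 4 * L ^ 13 * (N * G ^ 2) := by ring
      _ ≤ 4 * L ^ 16 * (G * G ^ 2) := by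
          gcongr 4 * ?_ * (?_ * G ^ 2)
          exact hLp (by norm_num)
      _ = _ := by ring

theorem lowerRegularConstants_admissible {F : ℕ} {N : ℝ} (hF : 1 ≤ F) (hN : 1 ≤ N)
    (hNF : N ≤ F) : (lowerRegularConstants F).Admissible 1 N F (1 / 2) := by
  obtain ⟨G, hG⟩ : ∃ G : ℝ, G = F := ⟨_, rfl⟩
  have hG1 : 1 ≤ G := by rw [hG]; exact_mod_cast hF
  have hG0 : 0 < G := by linarith
  have hN0 : 0 < N := by linarith
  have hNG : 1 ≤ N * G := one_le_mul_of_one_le_of_one_le hN hG1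
  rw [← hG] at hNF ⊢
  constructor <;> (try simp only [lowerRegularConstants, one_pow, one_mul, mul_one]) <;> try rw [← hG]
  · norm_num
  · positivity
  · exact le_rfl
  · positivity
  · positivity
  · exact le_rfl
  · rw [mul_one_div, div_mul_eq_mul_div, div_lt_one (by positivity)]
    nlinarith
  · rw [div_le_iff₀ (by positivity)]
    linarith
  · rw [div_le_iff₀ (by positivity)]
    linarith
  · rw [div_le_one (by positivity)]
    linarith
  · rw [one_div_mul_eq_div, div_le_one (by positivity)]
    exact hNF
  · rw [one_div_mul_eq_div, div_le_div_iff₀ (by positivity) (by positivity)]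
    nlinarith

/-- For N = 2 and E'' = 1/2 the condition on E'' forces κ ≤ 3/4. With κ = 3/4 the main condition
reads 3·(1/12)·(1 + 8/3) = 11/12 < 1; the cube and m-gon cases give the same 11/12 when Λ = 1. -/
theorem simplicialConstants_admissible : simplicialConstants.Admissible 1 2 3 (3 / 4) := by
  constructor <;> norm_num [simplicialConstants]

theorem cubeConstants_admissible : cubeConstants.Admissible 1 2 4 (3 / 4) := by
  constructor <;> norm_num [cubeConstants]

theorem gonConstants_admissible {m : ℕ} {L : ℝ} (hm : 2 ≤ m) (hL : 1 ≤ L) :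
    (gonConstants m L).Admissible L 2 m (3 / 4) := by
  have hm0 : (0 : ℝ) < m := by exact_mod_cast (by omega : 0 < m)
  have hL0 : 0 < L := by linarith
  have hLp : ∀ {m n : ℕ}, m ≤ n → L ^ m ≤ L ^ n := fun h => pow_le_pow_right₀ hL h
  have h10 : L ^ 10 ≤ L ^ 18 := hLp (by norm_num)
  have h3 : L ^ 3 ≤ L ^ 12 := hLp (by norm_num)
  have h12 : L ^ 12 ≤ L ^ 13 := hLp (by norm_num)
  have h13 : L ^ 13 ≤ L ^ 16 := hLp (by norm_num)
  have h0 : 0 < L ^ 12 := by positivity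
  have h18 : 0 < L ^ 18 := by positivity
  constructor <;> (try simp only [gonConstants])
  · norm_num
  · positivity
  · rw [div_le_one (by positivity)]
    exact one_le_pow₀ hL
  · positivity
  · positivity
  · rw [one_div_mul_eq_div, div_le_one (by positivity)]
    exact hLp (by norm_num)
  · rw [mul_one_div, div_mul_eq_mul_div, div_lt_one (by positivity)]
    calc L ^ 10 * m * (1 + 2 / (3 / 4)) = m * (11 / 3 * L ^ 10) := by ring
      _ < m * (4 * L ^ 18) := by gcongr ?_ * ?_; linarith
      _ = 4 * m * L ^ 18 := by ring
  · rw [mul_one_div, div_le_iff₀ (by positivity)]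
    linarith
  · rw [mul_one_div, div_le_iff₀ (by positivity)]
    linarith
  · rw [one_div_mul_eq_div, div_le_one (by positivity)]
    have : 0 < L ^ 13 := by positivity
    linarith
  · rw [one_div_mul_eq_div, div_mul_eq_mul_div, div_le_one (by positivity)]
    gcongr 2 * ?_
    exact hLp (by norm_num)
  · rw [one_div_mul_eq_div, div_mul_eq_mul_div, div_le_div_iff₀ (by positivity) (by positivity)]
    calc 2 * L * (4 * L ^ 12) = 8 * L ^ 13 := by ring
      _ ≤ 8 * L ^ 16 := by gcongr
      _ = _ := by ring

end Constants

end CosystolicExpansion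

/-! ### The criterion with the explicit constants -/

theorem mainTheorem3
    -- the parameters on which the constants depend
    (F : ℕ) (hF : 1 ≤ F) (L : ℝ) (hL : 1 ≤ L)
    -- a properly weighted, oriented `d`-poset with a sheaf
    {R : Type*} [CommRing R]
    {X : Type*} [PartialOrder X] [OrderBot X] [Fintype X] [GradeOrder ℤ X]
    (d : ℕ) (hd : 2 ≤ d) (hX : IsDPoset X d)
    (w : X → ℝ) (hw : IsProperWeight d w)
    (O : PosetOrientation R X) (S : PosetSheaf R X)
    (hLX : lowerIrregularity X d ≤ L)
    (hF₀ : Fmax X (-1) 0 2 ≤ F) (hF₁ : Fmax X (-1) 1 2 ≤ F)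
    -- any of the listed tuples of constants
    (c : Constants) (hc : ListedConstants X F L c)
    (ε ε' : ℝ) (hε : 0 < ε) (hε' : 0 < ε')
    -- the indices `m` and `p` stand for `-1` and `||`
    (α₀ β₀ αm βm αp βp : ℝ)
    (hα₀ : 0 ≤ α₀) (hβ₀ : 0 ≤ β₀) (hαm : 0 ≤ αm) (hβm : 0 ≤ βm) (hαp : 0 ≤ αp) (hβp : 0 ≤ βp)
    (h1a : ∀ x : X, dim x = 0 →
      ENNReal.ofReal ε ≤ cbe (O.link x) (linkWeight d w x) (S.link x) (-1))
    (h1b : ∀ e : X, dim e = 1 →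
      ENNReal.ofReal ε' ≤ cbe (O.link e) (linkWeight d w e) (S.link e) (-1))
    (h1c : ∀ x : X, dim x = 0 →
      ENNReal.ofReal ε' ≤ cbe (O.link x) (linkWeight d w x) (S.link x) 0)
    (h2a : ∀ x : X, dim x = 0 → (ugr (linkWeight d w x)).IsSkeletonExpander α₀ β₀)
    (h2b : (ugr w).IsSkeletonExpander αm βm)
    (h2c : (noIntersection w 1 1 2).IsSkeletonExpander αp βp)
    (hαε : αm < c.E * ε)
    (h₀ hm hp : ℝ)
    (hh₀ : h₀ ∈ Set.Ioc (0 : ℝ) 1) (hhm : hm ∈ Set.Ioc (0 : ℝ) 1) (hhp : hp ∈ Set.Ioc (0 : ℝ) 1)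
    (hineq : (α₀ + β₀ * h₀) + (αp + βp * hp) + (αm + βm * hm) / h₀ ≤ c.E' * ε') :
    ENNReal.ofReal (c.E'' / (h₀⁻¹ * hm⁻¹ + hp⁻¹)) ≤ cse O w S 0 ∧
    -- in `[0, ∞]`: the left side is `∞` if `βm = 0`
    ENNReal.ofReal (c.E''' * (c.E * ε - αm)) / ENNReal.ofReal βm ≤ ccd O w S 0 ∧
    ∀ f : Cochain S 0,
      wdist w f (cocycles O S 0) < c.D / (h₀⁻¹ * hm⁻¹ + hp⁻¹) →
      CorrectionHalts O w S 0 (c.D' * h₀) f ∧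
      ∀ f' : Cochain S 0, CorrectionReturns O w S 0 (c.D' * h₀) f f' →
        f' ∈ cocycles O S 0 ∧
        wnorm w (f - f') ≤ 1 / (c.D'' * h₀) * wdist w f (cocycles O S 0) := by
  -- Each case now only has to supply Λ, M and κ: Λ = 1 for lower-regular X (including simplicial
  -- and cube complexes), and Λ = L otherwise.
  have close : ∀ {Λ M κ : ℝ}, IrregularityLE X d Λ → c.Admissible Λ (Fmax X (-1) 0 1) M κ →
      1 ≤ M → (Fmax X (-1) 0 2 : ℝ) ≤ M → (Fmax X (-1) 1 2 : ℝ) ≤ M → _ :=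
    fun hΛ hadm hM hM₀ hM₁ => hw.expansion_of_admissible hX hd hΛ c hadm hM hM₀ hM₁ hε hε' hα₀ hβ₀
      hαm hβm hαp hβp h1a h1b h1c h2a h2b h2c hαε hh₀.1 hhm.1 hhm.2 hhp.1 hineq
  have hN : (1 : ℝ) ≤ Fmax X (-1) 0 1 := by
    exact_mod_cast (hX.Fmin_pos le_rfl (by norm_num) (by norm_num) (by omega)).trans_le
      (hX.Fmin_le_Fmax le_rfl (by norm_num) (by norm_num) (by omega))
  have hNF : (Fmax X (-1) 0 1 : ℝ) ≤ F := by
    exact_mod_cast (hX.Fmax_zero_one_le hd).trans hF₀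
  have hFR : (1 : ℝ) ≤ F := by exact_mod_cast hF
  have hF₀R : (Fmax X (-1) 0 2 : ℝ) ≤ F := by exact_mod_cast hF₀
  have hF₁R : (Fmax X (-1) 1 2 : ℝ) ≤ F := by exact_mod_cast hF₁
  have hirr : IrregularityLE X d L := hX.irregularityLE hL hLX
  cases hc with
  | general => exact close hirr (generalConstants_admissible hF hL hN hNF) hFR hF₀R hF₁R
  | lowerRegular h =>
    exact close (h.irregularityLE d) (lowerRegularConstants_admissible hF hN hNF) hFR hF₀R hF₁R
  | simplicial h =>
    have hchoose : ∀ (z : X) (j : ℤ), -1 ≤ j →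
        numBetween ⊥ z j = (dim z + 1).toNat.choose (j + 1).toNat := by
      intro z j hj
      rw [h.numBetween_eq bot_le (by rw [hX.dim_bot]; exact hj), hX.dim_bot, sub_neg_eq_add,
        sub_neg_eq_add]
    have h01 : Fmax X (-1) 0 1 = 2 :=
      hX.Fmax_zero_one_eq hd fun e he => by rw [hchoose e 0 (by norm_num), he]; rfl
    have h02 : Fmax X (-1) 0 2 ≤ 3 :=
      Fmax_neg_one_le hX.dim_bot fun z hz => by rw [hchoose z 0 (by norm_num), hz]; rfl
    have h12 : Fmax X (-1) 1 2 ≤ 3 :=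
      Fmax_neg_one_le hX.dim_bot fun z hz => by rw [hchoose z 1 (by norm_num), hz]; rfl
    refine close (h.isLowerRegular.irregularityLE d) (M := 3) (κ := 3 / 4) ?_ (by norm_num)
      (by exact_mod_cast h02) (by exact_mod_cast h12)
    rw [h01]
    exact simplicialConstants_admissible
  | cube h =>
    have hb := hX.dim_bot
    have h01 : Fmax X (-1) 0 1 = 2 :=
      hX.Fmax_zero_one_eq hd fun e he => by
        rw [h.numBetween_bot_eq hb (n := 1) he, cubeCount_one_zero]
    have h02 : Fmax X (-1) 0 2 ≤ 4 :=
      Fmax_neg_one_le hb fun z hz => by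
        rw [h.numBetween_bot_eq hb (n := 2) hz, cubeCount_two_zero]
    have h12 : Fmax X (-1) 1 2 ≤ 4 :=
      Fmax_neg_one_le hb fun z hz => by
        rw [h.numBetween_bot_eq hb (n := 2) hz, cubeCount_two_one]
    refine close ((h.isLowerRegular hb).irregularityLE d) (M := 4) (κ := 3 / 4) ?_ (by norm_num)
      (by exact_mod_cast h02) (by exact_mod_cast h12)
    rw [h01]
    exact cubeConstants_admissible
  | gon m h =>
    have h01 : Fmax X (-1) 0 1 = 2 := hX.Fmax_zero_one_eq hd fun e he => h.numBetween_edge hX hd he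
    have h02 : Fmax X (-1) 0 2 ≤ m := Fmax_neg_one_le hX.dim_bot fun z hz => (h.numBetween_le hz).1
    have h12 : Fmax X (-1) 1 2 ≤ m := Fmax_neg_one_le hX.dim_bot fun z hz => (h.numBetween_le hz).2
    refine close hirr (M := m) (κ := 3 / 4) ?_ (by exact_mod_cast (by have := h.1; omega : 1 ≤ m))
      (by exact_mod_cast h02) (by exact_mod_cast h12)
    rw [h01]
    exact gonConstants_admissible h.1 hL
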